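/- Consider the uncoupled system of nonlinear heat equations $$u_t=\nabla\cdot(d_1(u)\nabla u),\qquad v_t=\nabla\cdot(d_2(v)\nabla v)\qquad(*)$$ with $(t,\mathbf x)$ in a domain (non-empty connected open set) $\Omega\subset\mathbb R\times\mathbb R^3$, $u\in I_1$, $v\in I_2$, where $I_1,I_2$ are non-empty open intervals and $d_1:I_1\to(0,\infty)$, $d_2:I_2\to(0,\infty)$ are smooth. The maximal algebra of invariance (MAI) of $(*)$ is the set of all operators $$X=\xi^0\partial_t+\xi^a\partial_{x_a}+\eta^1\partial_u+\eta^2\partial_v$$ whose coefficients are smooth functions of $(t,\mathbf x,u,v)\in\Omega\times I_1\times I_2$ and whose second prolongation annihilates both equations on the manifold that $(*)$ determines in the space of second order jets. Repeated indices $a$ are summed over $1,2,3$. Put $$AE(1,3)=\langle\partial_t,\ \partial_{x_a},\ x_a\partial_{x_b}-x_b\partial_{x_a}\ (b<a),\ 2t\partial_t+x_a\partial_{x_a}\rangle .$$ Let $E$ be the group of the transformations $$\tilde t=\alpha t+\gamma_0,\quad \tilde{\mathbf x}=\beta R\mathbf x+\Gamma,\quad \tilde u=\delta_1u+\gamma_4,\quad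 \tilde v=\delta_2v+\gamma_5,\quad \tilde d_k=\tfrac{\beta^2}{\alpha}d_k\ (k=1,2),$$ with $R\in SO(3)$, $\Gamma\in\mathbb R^3$, $\gamma_0,\gamma_4,\gamma_5\in\mathbb R$ and $\alpha\beta\delta_1\delta_2\neq0$. **Theorem 1.** 1. For arbitrary diffusivities the algebra is $AE(1,3)$: for every $\Omega,I_1,I_2$, the operators that belong to the MAI of $(*)$ for all smooth positive $d_1,d_2$ are exactly those of $AE(1,3)$. 2. In each of the following cases the MAI is the linear span of $AE(1,3)$ and the listed operators, and it is strictly larger than $AE(1,3)$. Here $\alpha(t,\mathbf x)$ and $\beta(t,\mathbf x)$ denote arbitrary smooth solutions on $\Omega$ of $\alpha_t=k_1\Delta\alpha$ and $\beta_t=k_2\Delta\beta$; the exponents $n,m$ are non-zero, the constants $k_1,k_2$ are positive, and $w>0$ on the interval where a diffusivity is a power of $w$. - (2) $d_1=k_1$, $d_2$ not constant: $u\partial_u$, $\alpha\partial_u$. - (3) $d_1$ not constant, $d_2=k_2$: $v\partial_v$, $\beta\partial_v$. - (4) $d_1=e^u$, $d_2=e^v$: $x_a\partial_{x_a}+2\partial_u+2\partial_v$.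 - (5) $d_1=e^u$, $d_2=v^m$: $x_a\partial_{x_a}+2\partial_u+\frac2m v\partial_v$. - (6) $d_1=u^n$, $d_2=e^v$: $x_a\partial_{x_a}+\frac2n u\partial_u+2\partial_v$. - (7) $d_1=u^n$, $d_2=v^m$, $(n,m)\ne(-\frac45,-\frac45)$: $D=x_a\partial_{x_a}+\frac2n u\partial_u+\frac2m v\partial_v$. - (8) $d_1=u^{-4/5}$, $d_2=v^{-4/5}$: $D$ with $n=m=-\frac45$, and $|\mathbf x|^2\partial_{x_b}-2x_bx_a\partial_{x_a}+5x_bu\partial_u+5x_bv\partial_v$ for $b=1,2,3$. - (9) $d_1=k_1$, $d_2=k_2$, $k_1\neq k_2$: $u\partial_u$, $v\partial_v$, $\alpha\partial_u$, $\beta\partial_v$, $G_a=t\partial_{x_a}-x_a\bigl(\frac1{2k_1}u\partial_u+\frac1{2k_2}v\partial_v\bigr)$ for $a=1,2,3$, and $\Pi=t^2\partial_t+tx_a\partial_{x_a}-\frac1{4k_1}(|\mathbf x|^2+6k_1t)u\partial_u-\frac1{4k_2}(|\mathbf x|^2+6k_2t)v\partial_v$. - (10) $d_1=d_2=k_1$: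 the operators of case (9) with $k_2=k_1$, and $v\partial_u$, $u\partial_v$. The algebra is infinite-dimensional in cases (2), (3), (9), (10) and finite-dimensional in cases (4)–(8). 3. There are no other extensions: for every system $(*)$, either the MAI is $AE(1,3)$, or some transformation from $E$ takes $(*)$ to a system with diffusivities from one of the cases (2)–(10), and the MAI of $(*)$ consists of the operators that this transformation carries to the algebra of that case. -/

import Mathlib

open scoped ContDiff

noncomputable section

namespace NHE

/-! Jet coordinates.  There are four independent variables, indexed by `Fin 4`: index `0` is the
time `t`, and `a.succ` with `a : Fin 3` is the space variable `x_a`.  There are two dependent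
variables, indexed by `Fin 2`: `u` is number `0` and `v` is number `1`. -/

/-- Independent variables `(t, x₁, x₂, x₃)`. -/
abbrev Indep := Fin 4 → ℝ

/-- Dependent variables `(u, v)`. -/
abbrev Dep := Fin 2 → ℝ

/-- The space of the variables `(t, x, u, v)`. -/
abbrev Jet0 := Indep × Dep

/-- First order jets: `j.2 k i` is the first derivative of the `k`-th dependent variable with
respect to the `i`-th independent one. -/
abbrev Jet1 := Jet0 × (Fin 2 → Fin 4 → ℝ)

/-- Second order jets: `j.2 k i l` is the second derivative of the `k`-th dependent variable with
respect to the `i`-th and the `l`-th independent ones. -/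
abbrev Jet2 := Jet1 × (Fin 2 → Fin 4 → Fin 4 → ℝ)

/-- Total derivative `D_i` of a function of `(t, x, u, v)`. -/
def totalDeriv0 (i : Fin 4) (F : Jet0 → ℝ) (j : Jet1) : ℝ :=
  fderiv ℝ F j.1 (Pi.single i 1, fun k => j.2 k i)

/-- Total derivative `D_i` of a function of the first order jet. -/
def totalDeriv1 (i : Fin 4) (F : Jet1 → ℝ) (j : Jet2) : ℝ :=
  fderiv ℝ F j.1 ((Pi.single i 1, fun k => j.1.2 k i), fun k l => j.2 k l i)

/-- An operator `ξ⁰ ∂_t + ξ^a ∂_{x_a} + η¹ ∂_u + η² ∂_v`, given by its coefficients `(ξ, η)`. -/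
abbrev Operator := Jet0 → Jet0

/-- First prolongation: `ζ^k_i = D_i η^k - ∑ l, w^k_l D_i ξ^l`. -/
def prolong1 (X : Operator) (k : Fin 2) (i : Fin 4) (j : Jet1) : ℝ :=
  totalDeriv0 i (fun m => (X m).2 k) j - ∑ l, j.2 k l * totalDeriv0 i (fun m => (X m).1 l) j

/-- Second prolongation: `ζ^k_{ih} = D_h ζ^k_i - ∑ l, w^k_{il} D_h ξ^l`. -/
def prolong2 (X : Operator) (k : Fin 2) (i h : Fin 4) (j : Jet2) : ℝ :=
  totalDeriv1 h (prolong1 X k i) j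
    - ∑ l, j.2 k i l * totalDeriv0 h (fun m => (X m).1 l) j.1

/-- The second prolongation of an operator, as a vector field on the space of second order jets. -/
def prolong (X : Operator) (j : Jet2) : Jet2 :=
  ((X j.1.1, fun k i => prolong1 X k i j.1), fun k i h => prolong2 X k i h j)

/-- The domain of the variables: `(t, x)` ranges over a domain `Ω` of `ℝ × ℝ³`, and `u` and `v`
range over open intervals. -/
structure Region where
  Ω : Set Indep
  I : Fin 2 → Set ℝ
  isOpen_Ω : IsOpen Ω
  isConnected_Ω : IsConnected Ω
  isOpen_I : ∀ k, IsOpen (I k)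
  isConnected_I : ∀ k, IsConnected (I k)

/-- The set `Ω × I₀ × I₁` of the variables `(t, x, u, v)`. -/
def Region.dom (B : Region) : Set Jet0 := {m | m.1 ∈ B.Ω ∧ ∀ k, m.2 k ∈ B.I k}

/-- The pair of diffusivities `(d₁, d₂)` is smooth and strictly positive. -/
def Region.Admissible (B : Region) (d : Fin 2 → ℝ → ℝ) : Prop :=
  ∀ k, ContDiffOn ℝ ∞ (d k) (B.I k) ∧ ∀ w ∈ B.I k, 0 < d k w

/-- Left-hand side minus right-hand side of the `k`-th heat equation `w_t = ∇(d(w)∇w)`, that is,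
of `w_t = d(w) Δw + d'(w) |∇w|²`, as a function on the second order jets. -/
def residual (d : Fin 2 → ℝ → ℝ) (k : Fin 2) (j : Jet2) : ℝ :=
  j.1.2 k 0 - (d k (j.1.1.2 k) * (∑ a : Fin 3, j.2 k a.succ a.succ)
    + deriv (d k) (j.1.1.2 k) * ∑ a : Fin 3, (j.1.2 k a.succ) ^ 2)

/-- The manifold in the space of second order jets that the heat system determines. -/
def Region.manifold (B : Region) (d : Fin 2 → ℝ → ℝ) : Set Jet2 :=
  {j | j.1.1 ∈ B.dom ∧ (∀ k i h, j.2 k i h = j.2 k h i) ∧ ∀ k, residual d k j = 0}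

/-- `X` is a Lie symmetry operator of the heat system: its coefficients are smooth, and its second
prolongation annihilates both equations on the manifold that they determine. -/
def Region.IsSymmetry (B : Region) (d : Fin 2 → ℝ → ℝ) (X : Operator) : Prop :=
  ContDiffOn ℝ ∞ X B.dom ∧
    ∀ k, ∀ j ∈ B.manifold d, fderiv ℝ (residual d k) j (prolong X j) = 0

/-- The maximal algebra of invariance: all Lie symmetry operators, as fields on the domain. -/
def Region.mai (B : Region) (d : Fin 2 → ℝ → ℝ) : Set (B.dom → Jet0) :=
  {X | ∃ Y : Operator, B.IsSymmetry d Y ∧ X = B.dom.domRestrict Y}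

/-! The operators of the table. -/

/-- `ξ⁰ ∂_t + ξ^a ∂_{x_a} + η^k ∂_{w_k}` from its coefficients at a point. -/
def coeffs (ξt : ℝ) (ξ : Fin 3 → ℝ) (η : Fin 2 → ℝ) : Jet0 := (Fin.cons ξt ξ, η)

/-- The time variable. -/
def tm (m : Jet0) : ℝ := m.1 0

/-- The space variables. -/
def sp (m : Jet0) (a : Fin 3) : ℝ := m.1 a.succ

/-- `|x|²` -/
def spSq (m : Jet0) : ℝ := ∑ a, sp m a ^ 2

/-- `∂_t` -/
def opT : Operator := fun _ => coeffs 1 0 0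

/-- `∂_{x_a}` -/
def opP (a : Fin 3) : Operator := fun _ => coeffs 0 (Pi.single a 1) 0

/-- `x_a ∂_{x_b} - x_b ∂_{x_a}` -/
def opJ (a b : Fin 3) : Operator :=
  fun m => coeffs 0 (Pi.single b (sp m a) - Pi.single a (sp m b)) 0

/-- `2t ∂_t + x_a ∂_{x_a}` -/
def opD0 : Operator := fun m => coeffs (2 * tm m) (sp m) 0

/-- `f ∂_{w_k}` -/
def opW (k : Fin 2) (f : Jet0 → ℝ) : Operator := fun m => coeffs 0 0 (Pi.single k (f m))

/-- `x_a ∂_{x_a} + f ∂_u + g ∂_v` -/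
def opD (f g : Jet0 → ℝ) : Operator := fun m => coeffs 0 (sp m) ![f m, g m]

/-- `|x|² ∂_{x_b} - 2 x_b x_a ∂_{x_a} + 5 x_b u ∂_u + 5 x_b v ∂_v` -/
def opK (b : Fin 3) : Operator := fun m =>
  coeffs 0 (Pi.single b (spSq m) - fun a => 2 * sp m b * sp m a) (fun k => 5 * sp m b * m.2 k)

/-- `t ∂_{x_a} - x_a (1/(2κ₁) u ∂_u + 1/(2κ₂) v ∂_v)` -/
def opG (κ : Fin 2 → ℝ) (a : Fin 3) : Operator := fun m =>
  coeffs 0 (Pi.single a (tm m)) (fun k => -(sp m a * (1 / (2 * κ k) * m.2 k)))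

/-- `t² ∂_t + t x_a ∂_{x_a} - 1/(4κ₁) (|x|² + 6κ₁t) u ∂_u - 1/(4κ₂) (|x|² + 6κ₂t) v ∂_v` -/
def opPi (κ : Fin 2 → ℝ) : Operator := fun m =>
  coeffs (tm m ^ 2) (fun a => tm m * sp m a)
    (fun k => -(1 / (4 * κ k) * (spSq m + 6 * κ k * tm m) * m.2 k))

/-- The partial derivative with respect to the `i`-th independent variable. -/
def pd (i : Fin 4) (f : Indep → ℝ) (z : Indep) : ℝ := fderiv ℝ f z (Pi.single i 1)

/-- The smooth solutions on `Ω` of the linear heat equation `f_t = κ Δf`. -/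
def heatSolutions (Ω : Set Indep) (κ : ℝ) : Set (Indep → ℝ) :=
  {f | ContDiffOn ℝ ∞ f Ω ∧ ∀ z ∈ Ω, pd 0 f z = κ * ∑ a : Fin 3, pd a.succ (pd a.succ f) z}

/-- The basic operators of `AE(1,3)`. -/
def gensAE : Set Operator :=
  {opT} ∪ Set.range opP ∪ {X | ∃ a b : Fin 3, b < a ∧ X = opJ a b} ∪ {opD0}

/-- `AE(1,3)`, as operators on the domain `B`. -/
def Region.AE (B : Region) : Submodule ℝ (B.dom → Jet0) :=
  Submodule.span ℝ (B.dom.domRestrict '' gensAE)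

/-- The operators `f(t,x) ∂_{w_k}`, where `f` solves the linear heat equation. -/
def gensHeat (Ω : Set Indep) (k : Fin 2) (κ : ℝ) : Set Operator :=
  {X | ∃ f ∈ heatSolutions Ω κ, X = opW k (fun m => f m.1)}

/-- The basic operators, other than those of `AE(1,3)`, when both diffusivities are constant. -/
def gensLinear (Ω : Set Indep) (κ : Fin 2 → ℝ) : Set Operator :=
  {opW 0 (fun m => m.2 0), opW 1 (fun m => m.2 1)} ∪ gensHeat Ω 0 (κ 0) ∪ gensHeat Ω 1 (κ 1)
    ∪ Set.range (opG κ) ∪ {opPi κ}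

/-- The nine cases in which `AE(1,3)` is extended, with their parameters. -/
inductive ExtCase
  | constAny (k₁ : ℝ)
  | anyConst (k₂ : ℝ)
  | expExp
  | expPow (m : ℝ)
  | powExp (n : ℝ)
  | powPow (n m : ℝ)
  | conformal
  | constConst (k₁ k₂ : ℝ)
  | constSame (k₁ : ℝ)

/-- `d = κ` on `I` -/
def IsConstOn (d : ℝ → ℝ) (I : Set ℝ) (κ : ℝ) : Prop := ∀ w ∈ I, d w = κ

/-- `d(w) = e^w` on `I` -/
def IsExpOn (d : ℝ → ℝ) (I : Set ℝ) : Prop := ∀ w ∈ I, d w = Real.exp w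

/-- `d(w) = w^n` on `I`, where `n ≠ 0` and `w > 0` -/
def IsPowOn (d : ℝ → ℝ) (I : Set ℝ) (n : ℝ) : Prop := n ≠ 0 ∧ ∀ w ∈ I, 0 < w ∧ d w = w ^ n

/-- The diffusivities of a case.  The cases exclude one another: an arbitrary diffusivity next to
a constant one is not constant, the two powers of `powPow` are not both `-4/5`, and the two
constants of `constConst` differ. -/
def ExtCase.Describes (B : Region) (d : Fin 2 → ℝ → ℝ) : ExtCase → Prop
  | constAny k₁ => IsConstOn (d 0) (B.I 0) k₁ ∧ ¬ ∃ κ, IsConstOn (d 1) (B.I 1) κ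
  | anyConst k₂ => (¬ ∃ κ, IsConstOn (d 0) (B.I 0) κ) ∧ IsConstOn (d 1) (B.I 1) k₂
  | expExp => IsExpOn (d 0) (B.I 0) ∧ IsExpOn (d 1) (B.I 1)
  | expPow m => IsExpOn (d 0) (B.I 0) ∧ IsPowOn (d 1) (B.I 1) m
  | powExp n => IsPowOn (d 0) (B.I 0) n ∧ IsExpOn (d 1) (B.I 1)
  | powPow n m => IsPowOn (d 0) (B.I 0) n ∧ IsPowOn (d 1) (B.I 1) m ∧
      ¬ (n = -(4 / 5) ∧ m = -(4 / 5))
  | conformal => IsPowOn (d 0) (B.I 0) (-(4 / 5)) ∧ IsPowOn (d 1) (B.I 1) (-(4 / 5))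
  | constConst k₁ k₂ => IsConstOn (d 0) (B.I 0) k₁ ∧ IsConstOn (d 1) (B.I 1) k₂ ∧ k₁ ≠ k₂
  | constSame k₁ => IsConstOn (d 0) (B.I 0) k₁ ∧ IsConstOn (d 1) (B.I 1) k₁

/-- The basic operators of a case, other than those of `AE(1,3)`. -/
def ExtCase.gens (Ω : Set Indep) : ExtCase → Set Operator
  | constAny k₁ => {opW 0 (fun m => m.2 0)} ∪ gensHeat Ω 0 k₁
  | anyConst k₂ => {opW 1 (fun m => m.2 1)} ∪ gensHeat Ω 1 k₂
  | expExp => {opD (fun _ => 2) (fun _ => 2)}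
  | expPow m => {opD (fun _ => 2) (fun p => 2 / m * p.2 1)}
  | powExp n => {opD (fun p => 2 / n * p.2 0) (fun _ => 2)}
  | powPow n m => {opD (fun p => 2 / n * p.2 0) (fun p => 2 / m * p.2 1)}
  | conformal => Set.range opK ∪
      {opD (fun p => 2 / (-(4 / 5)) * p.2 0) (fun p => 2 / (-(4 / 5)) * p.2 1)}
  | constConst k₁ k₂ => gensLinear Ω ![k₁, k₂]
  | constSame k₁ => gensLinear Ω ![k₁, k₁] ∪
      {opW 0 (fun m => m.2 1), opW 1 (fun m => m.2 0)}

/-- The algebra of a case, as operators on the domain `B`. -/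
def ExtCase.algebra (c : ExtCase) (B : Region) : Submodule ℝ (B.dom → Jet0) :=
  Submodule.span ℝ (B.dom.domRestrict '' (gensAE ∪ c.gens B.Ω))

/-- The cases in which at least one of the two equations is linear. -/
def ExtCase.IsLinear : ExtCase → Prop
  | constAny _ | anyConst _ | constConst _ _ | constSame _ => True
  | _ => False

/-- The equivalence transformations
`t ↦ α t + γ₀`, `x ↦ β R x + Γ`, `u ↦ δ₁ u + γ₄`, `v ↦ δ₂ v + γ₅`, `dₖ ↦ (β²/α) dₖ`,
where `R` is a rotation and `α β δ₁ δ₂ ≠ 0`. -/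
structure Equivalence where
  α : ℝ
  β : ℝ
  R : Matrix (Fin 3) (Fin 3) ℝ
  δ : Fin 2 → ℝ
  shiftT : ℝ
  shiftX : Fin 3 → ℝ
  shiftW : Fin 2 → ℝ
  hα : α ≠ 0
  hβ : β ≠ 0
  hR : R ∈ Matrix.specialOrthogonalGroup (Fin 3) ℝ
  hδ : ∀ k, δ k ≠ 0

/-- The linear part of the action on `(t, x, u, v)`. -/
def Equivalence.lin (e : Equivalence) (m : Jet0) : Jet0 :=
  coeffs (e.α * tm m) (e.β • e.R.mulVec (sp m)) (fun k => e.δ k * m.2 k)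

/-- The action on `(t, x, u, v)`. -/
def Equivalence.map (e : Equivalence) (m : Jet0) : Jet0 :=
  e.lin m + coeffs e.shiftT e.shiftX e.shiftW

/-- The transformation `e` takes the system with diffusivities `d` on `B` to the system with
diffusivities `d'` on `B'`. -/
def Equivalence.Maps (e : Equivalence) (B : Region) (d : Fin 2 → ℝ → ℝ)
    (B' : Region) (d' : Fin 2 → ℝ → ℝ) : Prop :=
  e.map '' B.dom = B'.dom ∧
    ∀ k, ∀ w ∈ B.I k, d' k (e.δ k * w + e.shiftW k) = e.β ^ 2 / e.α * d k w

/-- The operators on `B` that `e` transforms into operators from the set `A` on `B'`. -/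
def Equivalence.pullback (e : Equivalence) (B B' : Region) (A : Set (B'.dom → Jet0)) :
    Set (B.dom → Jet0) :=
  {X | ∃ Y ∈ A, ∀ (m : B.dom) (m' : B'.dom), (m' : Jet0) = e.map m → Y m' = e.lin (X m)}

end NHE

end

noncomputable section

namespace NHE

/-! This is Lie's infinitesimal method. On the manifold each equation gives the time derivative of
its unknown, so the spatial first derivatives and all (symmetric) second derivatives are free. Over
a fixed point the symmetry condition is then a polynomial identity in these free coordinates, and
its coefficients must vanish. The terms containing mixed second derivatives (`SymAt.trace_free`)
show that `ξ` does not depend on `u, v`, that `ξ⁰` depends on `t` alone, and that `(ξ^a)` is a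
conformal Killing field in `x`. What remains is a quadratic polynomial (`defect_eq`), whose eight
coefficients are the determining equations (`SymAt.determining`). They make `η` affine in `(u, v)`,
with a constant cross coefficient that vanishes unless both diffusivities equal one common constant.
So a symmetry amounts to functions of `(t, x)` that solve the system `DetEqs` (`mem_mai_iff`).

Write `λ = ∂₁ξ¹` for the conformal factor and `μ = 2λ - ξ⁰_t` (`mu`). The key equation is `d_k'(A_k
w + b_k) = d_k μ`. In three space dimensions the second spatial derivatives of `λ` vanish
(`Conformal.factor`), so all `ξ` become explicit polynomials once their dependence on time is known
(`Conformal.integrate`). If `μ ≠ 0` at some point, division by it gives `d_k'(α_k w + β_k) = d_k`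
for both `k`. Then `A_k = α_k μ` and `b_k = β_k μ`, and the drift equation leaves the quadratic part
of `ξ` multiplied by `5 + 4α_k`, which is the origin of the exponent `-4/5` (`DetEqs.scaling_form`).
If `μ = 0` everywhere, a nonconstant `d_k` forces `η^k` to lose its `A_k` and `b_k`, and forces `ξ`
to be that of `AE(1,3)` (`DetEqs.rigid_form`). Two constant diffusivities give the Galilean and
projective operators (`DetEqs.linear_form`).

Up to an affine change of `w`, the positive solutions of `d'(αw + β) = d` are exponentials and
powers (`exists_normal_form`), which makes the list complete. The diffusivity `exp(w²)` satisfies no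
such equation, so it alone cuts the common algebra down to `AE(1,3)`. Extensions are strict because
`η = 0` on `AE(1,3)`. Infinite dimension comes from exponential solutions of the heat equation
(`linearIndependent_expSol`). -/

/-! ### Prolongation as an algebraic expression in the jet coordinates. -/

/-- The coefficient `ξ^l` of an operator. -/
def xi (X : Operator) (l : Fin 4) : Jet0 → ℝ := fun m => (X m).1 l

/-- The coefficient `η^k` of an operator. -/
def eta (X : Operator) (k : Fin 2) : Jet0 → ℝ := fun m => (X m).2 k

/-- The second derivative as a bilinear form. -/
def D2 (F : Jet0 → ℝ) (p v w : Jet0) : ℝ := fderiv ℝ (fderiv ℝ F) p v w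

/-- The total derivative direction `∂_i + ∑ m, P m i ∂_{w_m}`. -/
def tvec (P : Fin 2 → Fin 4 → ℝ) (i : Fin 4) : Jet0 := (Pi.single i 1, fun m => P m i)

/-- First prolongation in terms of derivatives of the coefficients. -/
def z1 (X : Operator) (p : Jet0) (P : Fin 2 → Fin 4 → ℝ) (k : Fin 2) (i : Fin 4) : ℝ :=
  fderiv ℝ (eta X k) p (tvec P i) - ∑ l, P k l * fderiv ℝ (xi X l) p (tvec P i)

/-- Second prolongation in terms of derivatives of the coefficients. -/
def z2 (X : Operator) (p : Jet0) (P : Fin 2 → Fin 4 → ℝ) (S : Fin 2 → Fin 4 → Fin 4 → ℝ)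
    (k : Fin 2) (i h : Fin 4) : ℝ :=
  D2 (eta X k) p (tvec P h) (tvec P i) + fderiv ℝ (eta X k) p (0, fun m => S m i h)
    - ∑ l, (S k l h * fderiv ℝ (xi X l) p (tvec P i)
        + P k l * (D2 (xi X l) p (tvec P h) (tvec P i)
          + fderiv ℝ (xi X l) p (0, fun m => S m i h)))
    - ∑ l, S k i l * fderiv ℝ (xi X l) p (tvec P h)

lemma prolong1_eq (X : Operator) (k : Fin 2) (i : Fin 4) (j : Jet1) :
    prolong1 X k i j = z1 X j.1 j.2 k i := rfl

/-- The coordinate `w^k_i` on first order jets. -/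
def coordP (k : Fin 2) (i : Fin 4) : Jet1 →L[ℝ] ℝ :=
  (ContinuousLinearMap.proj (R := ℝ) (φ := fun _ : Fin 4 => ℝ) i).comp
    ((ContinuousLinearMap.proj (R := ℝ) (φ := fun _ : Fin 2 => Fin 4 → ℝ) k).comp
      (ContinuousLinearMap.snd ℝ Jet0 (Fin 2 → Fin 4 → ℝ)))

/-- The coordinate `w^k_{ih}` on second order jets. -/
def coordS (k : Fin 2) (i h : Fin 4) : Jet2 →L[ℝ] ℝ :=
  (ContinuousLinearMap.proj (R := ℝ) (φ := fun _ : Fin 4 => ℝ) h).comp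
    ((ContinuousLinearMap.proj (R := ℝ) (φ := fun _ : Fin 4 => Fin 4 → ℝ) i).comp
      ((ContinuousLinearMap.proj (R := ℝ) (φ := fun _ : Fin 2 => Fin 4 → Fin 4 → ℝ) k).comp
        (ContinuousLinearMap.snd ℝ Jet1 (Fin 2 → Fin 4 → Fin 4 → ℝ))))

/-- The coordinate `w^k` on jets of order zero. -/
def coordW (k : Fin 2) : Jet0 →L[ℝ] ℝ :=
  (ContinuousLinearMap.proj (R := ℝ) (φ := fun _ : Fin 2 => ℝ) k).comp
    (ContinuousLinearMap.snd ℝ Indep Dep)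

@[simp] lemma coordP_apply (k : Fin 2) (i : Fin 4) (j : Jet1) : coordP k i j = j.2 k i := rfl

@[simp] lemma coordS_apply (k : Fin 2) (i h : Fin 4) (j : Jet2) : coordS k i h j = j.2 k i h := rfl

@[simp] lemma coordW_apply (k : Fin 2) (j : Jet0) : coordW k j = j.2 k := rfl

/-- The direction `tvec` itself moves with the first order jet. The product rule therefore gives a
second derivative of `F` plus `dF` applied to the change of direction. -/
lemma hasFDerivAt_fderiv_tvec {F : Jet0 → ℝ} {j : Jet1} (hF : ContDiffAt ℝ ∞ F j.1) (i : Fin 4) :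
    ∃ L : Jet1 →L[ℝ] ℝ,
      HasFDerivAt (fun j : Jet1 => fderiv ℝ F j.1 (tvec j.2 i)) L j ∧
      ∀ v : Jet1, L v = D2 F j.1 v.1 (tvec j.2 i) + fderiv ℝ F j.1 (0, fun m => v.2 m i) := by
  have h1 : DifferentiableAt ℝ (fderiv ℝ F) j.1 :=
    (hF.fderiv_right (m := 1) (by norm_cast)).differentiableAt (by simp)
  have h2 : HasFDerivAt (fun j : Jet1 => fderiv ℝ F j.1)
      ((fderiv ℝ (fderiv ℝ F) j.1).comp (ContinuousLinearMap.fst ℝ Jet0 _)) j :=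
    h1.hasFDerivAt.comp (f := fun j : Jet1 => j.1) j hasFDerivAt_fst
  have h3 : HasFDerivAt (fun j : Jet1 => tvec j.2 i)
      ((0 : Jet1 →L[ℝ] Indep).prod (ContinuousLinearMap.pi fun m => coordP m i)) j :=
    (hasFDerivAt_const _ _).prodMk (ContinuousLinearMap.hasFDerivAt
      (ContinuousLinearMap.pi fun m => coordP m i))
  refine ⟨_, h2.clm_apply h3, fun v => ?_⟩
  rw [add_comm]
  rfl

lemma prolong2_eq {X : Operator} {j : Jet2} (hX : ContDiffAt ℝ ∞ X j.1.1) (k : Fin 2)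
    (i h : Fin 4) : prolong2 X k i h j = z2 X j.1.1 j.1.2 j.2 k i h := by
  have hη : ContDiffAt ℝ ∞ (eta X k) j.1.1 := contDiffAt_pi.1 hX.snd k
  have hξ : ∀ l, ContDiffAt ℝ ∞ (xi X l) j.1.1 := fun l => contDiffAt_pi.1 hX.fst l
  obtain ⟨L, hL, hL'⟩ := hasFDerivAt_fderiv_tvec hη i
  choose K hK hK' using fun l => hasFDerivAt_fderiv_tvec (hξ l) i
  have hP : ∀ l, HasFDerivAt (fun j : Jet1 => j.2 k l) (coordP k l) j.1 :=
    fun l => (coordP k l).hasFDerivAt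
  have key := (hL.fun_sub (HasFDerivAt.fun_sum (u := Finset.univ)
    fun l _ => (hP l).fun_mul (hK l))).fderiv
  have : prolong1 X k i = fun j : Jet1 => fderiv ℝ (eta X k) j.1 (tvec j.2 i) -
    ∑ l, j.2 k l * fderiv ℝ (xi X l) j.1 (tvec j.2 i) := rfl
  rw [prolong2, totalDeriv1, this, key]
  simp only [sub_apply, hL', sum_apply,
    add_apply, smul_apply, hK', smul_eq_mul, z2]
  congr 1
  congr 1
  refine Finset.sum_congr rfl fun l _ => ?_
  simp [tvec]
  ring

/-- The linearized `k`-th equation on the second prolongation, as a function of the jet. -/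
def defect (d : Fin 2 → ℝ → ℝ) (X : Operator) (k : Fin 2) (p : Jet0) (P : Fin 2 → Fin 4 → ℝ)
    (S : Fin 2 → Fin 4 → Fin 4 → ℝ) : ℝ :=
  z1 X p P k 0 - d k (p.2 k) * ∑ a : Fin 3, z2 X p P S k a.succ a.succ
    - deriv (d k) (p.2 k) * eta X k p * ∑ a : Fin 3, S k a.succ a.succ
    - deriv (deriv (d k)) (p.2 k) * eta X k p * ∑ a : Fin 3, P k a.succ ^ 2
    - deriv (d k) (p.2 k) * ∑ a : Fin 3, 2 * P k a.succ * z1 X p P k a.succ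

lemma fderiv_residual {B : Region} {d : Fin 2 → ℝ → ℝ} (hd : B.Admissible d) {X : Operator}
    {j : Jet2} (hj : j.1.1 ∈ B.dom) (hX : ContDiffAt ℝ ∞ X j.1.1) (k : Fin 2) :
    fderiv ℝ (residual d k) j (prolong X j) = defect d X k j.1.1 j.1.2 j.2 := by
  have hI := (B.isOpen_I k).mem_nhds (hj.2 k)
  have hdk : ContDiffAt ℝ ∞ (d k) (j.1.1.2 k) := (hd k).1.contDiffAt hI
  have h1 : HasDerivAt (d k) (deriv (d k) (j.1.1.2 k)) (j.1.1.2 k) :=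
    (hdk.differentiableAt (by simp)).hasDerivAt
  have h2 : HasDerivAt (deriv (d k)) (deriv (deriv (d k)) (j.1.1.2 k)) (j.1.1.2 k) := by
    have : ContDiffAt ℝ 1 (deriv (d k)) (j.1.1.2 k) := by
      have h := hdk.fderiv_right (m := 1) (by norm_cast)
      have e : deriv (d k) = fun x => fderiv ℝ (d k) x 1 := by
        ext x; simp
      rw [e]
      exact h.clm_apply contDiffAt_const
    exact (this.differentiableAt (by simp)).hasDerivAt
  have hw : HasFDerivAt (fun j : Jet2 => j.1.1.2 k)
      (((coordW k).comp (ContinuousLinearMap.fst ℝ Jet0 _)).comp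
        (ContinuousLinearMap.fst ℝ Jet1 (Fin 2 → Fin 4 → Fin 4 → ℝ))) j :=
    ContinuousLinearMap.hasFDerivAt (((coordW k).comp (ContinuousLinearMap.fst ℝ Jet0 _)).comp
        (ContinuousLinearMap.fst ℝ Jet1 (Fin 2 → Fin 4 → Fin 4 → ℝ)))
  have hP : ∀ l, HasFDerivAt (fun j : Jet2 => j.1.2 k l) ((coordP k l).comp
      (ContinuousLinearMap.fst ℝ Jet1 (Fin 2 → Fin 4 → Fin 4 → ℝ))) j :=
    fun l => ContinuousLinearMap.hasFDerivAt ((coordP k l).comp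
      (ContinuousLinearMap.fst ℝ Jet1 (Fin 2 → Fin 4 → Fin 4 → ℝ)))
  have hS : ∀ a : Fin 3, HasFDerivAt (fun j : Jet2 => j.2 k a.succ a.succ)
      (coordS k a.succ a.succ) j := fun a => (coordS k a.succ a.succ).hasFDerivAt
  have key := ((hP 0).fun_sub (((h1.comp_hasFDerivAt j hw).fun_mul (HasFDerivAt.fun_sum
    (u := Finset.univ) fun a _ => hS a)).fun_add ((h2.comp_hasFDerivAt j hw).fun_mul
      (HasFDerivAt.fun_sum (u := Finset.univ) fun a _ => (hP (Fin.succ a)).pow 2)))).fderiv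
  have e : residual d k = fun j : Jet2 => j.1.2 k 0 - ((d k ∘ fun j : Jet2 => j.1.1.2 k) j *
    (∑ a : Fin 3, j.2 k a.succ a.succ) + (deriv (d k) ∘ fun j : Jet2 => j.1.1.2 k) j *
      ∑ a : Fin 3, (j.1.2 k a.succ) ^ 2) := rfl
  rw [e, key]
  simp [prolong, prolong1_eq, prolong2_eq hX, defect, eta, Fin.sum_univ_succ]
  ring

/-- The symmetry condition at the level of second order jets over a point. -/
lemma isSymmetry_iff {B : Region} {d : Fin 2 → ℝ → ℝ} (hd : B.Admissible d) {X : Operator}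
    (hB : IsOpen B.dom) :
    B.IsSymmetry d X ↔ ContDiffOn ℝ ∞ X B.dom ∧ ∀ k, ∀ p ∈ B.dom, ∀ P S,
      (∀ k i h, S k i h = S k h i) →
      (∀ k, P k 0 = d k (p.2 k) * (∑ a : Fin 3, S k a.succ a.succ)
        + deriv (d k) (p.2 k) * ∑ a : Fin 3, P k a.succ ^ 2) → defect d X k p P S = 0 := by
  refine and_congr_right fun hX => forall_congr' fun k => ?_
  have hX' : ∀ p ∈ B.dom, ContDiffAt ℝ ∞ X p := fun p hp => hX.contDiffAt (hB.mem_nhds hp)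
  constructor
  · intro h p hp P S hS hP
    rw [← h ((p, P), S) ⟨hp, hS, fun k => sub_eq_zero.2 (hP k)⟩]
    exact (fderiv_residual hd (j := ((p, P), S)) hp (hX' p hp) k).symm
  · intro h j hj
    rw [fderiv_residual hd hj.1 (hX' _ hj.1)]
    exact h _ hj.1 _ _ hj.2.1 fun k => sub_eq_zero.1 (hj.2.2 k)

lemma Region.isOpen_dom (B : Region) : IsOpen B.dom := by
  have : B.dom = B.Ω ×ˢ (Set.univ.pi B.I) := by
    ext m; simp [Region.dom]
  rw [this]
  exact B.isOpen_Ω.prod (isOpen_set_pi Set.finite_univ fun k _ => B.isOpen_I k)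

/-! ### Partial derivatives and the reduced symmetry condition. -/

/-- Partial derivative in the direction of an independent variable. -/
def dZ (F : Jet0 → ℝ) (i : Fin 4) (p : Jet0) : ℝ := fderiv ℝ F p (Pi.single i 1, 0)

/-- Partial derivative in the direction of a dependent variable. -/
def dW (F : Jet0 → ℝ) (m : Fin 2) (p : Jet0) : ℝ := fderiv ℝ F p (0, Pi.single m 1)

/-- The coordinate direction of an independent variable. -/
abbrev eZ (i : Fin 4) : Jet0 := (Pi.single i 1, 0)

/-- The coordinate direction of a dependent variable. -/
abbrev eW (m : Fin 2) : Jet0 := (0, Pi.single m 1)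

lemma dep_eq {k l : Fin 2} (h : l ≠ k) (w : Dep) :
    w = w k • Pi.single k 1 + w l • Pi.single l 1 := by
  ext m
  fin_cases k <;> fin_cases l <;> fin_cases m <;> simp_all

lemma tvec_eq {k l : Fin 2} (h : l ≠ k) (P : Fin 2 → Fin 4 → ℝ) (i : Fin 4) :
    tvec P i = eZ i + (P k i • eW k + P l i • eW l) := by
  ext m
  · simp [tvec]
  · simpa [tvec] using congrFun (dep_eq h (fun m => P m i)) m

lemma vert_eq {k l : Fin 2} (h : l ≠ k) (w : Dep) :
    ((0 : Indep), w) = w k • eW k + w l • eW l := by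
  ext m
  · simp
  · simpa using congrFun (dep_eq h w) m

lemma fderiv_tvec {k l : Fin 2} (h : l ≠ k) (F : Jet0 → ℝ) (p : Jet0) (P : Fin 2 → Fin 4 → ℝ)
    (i : Fin 4) :
    fderiv ℝ F p (tvec P i) = dZ F i p + P k i * dW F k p + P l i * dW F l p := by
  rw [tvec_eq h]; simp only [map_add, map_smul, smul_eq_mul, dZ, dW, add_assoc]

lemma fderiv_vert {k l : Fin 2} (h : l ≠ k) (F : Jet0 → ℝ) (p : Jet0) (w : Dep) :
    fderiv ℝ F p (0, w) = w k * dW F k p + w l * dW F l p := by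
  rw [vert_eq h]; simp only [map_add, map_smul, smul_eq_mul, dW]

lemma D2_tvec {k l : Fin 2} (h : l ≠ k) {F : Jet0 → ℝ} {p : Jet0}
    (hF : ∀ m v, D2 F p (eW m) v = D2 F p v (eW m)) (P : Fin 2 → Fin 4 → ℝ) (i : Fin 4) :
    D2 F p (tvec P i) (tvec P i) = D2 F p (eZ i) (eZ i) + 2 * P k i * D2 F p (eZ i) (eW k)
      + 2 * P l i * D2 F p (eZ i) (eW l) + P k i ^ 2 * D2 F p (eW k) (eW k)
      + 2 * P k i * P l i * D2 F p (eW k) (eW l) + P l i ^ 2 * D2 F p (eW l) (eW l) := by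
  have e1 := hF k (eZ i)
  have e2 := hF l (eZ i)
  have e3 := hF l (eW k)
  rw [tvec_eq h]
  simp only [D2, map_add, add_apply, map_smul, smul_apply, smul_eq_mul] at *
  rw [e1, e2, e3]
  ring

/-- The coefficients `ξ` have, at a point, the form which the leading terms of the symmetry
condition impose. -/
structure ProjectableAt (X : Operator) (p : Jet0) : Prop where
  dW_xi : ∀ l m, dW (xi X l) m p = 0
  D2_xi : ∀ l v m, D2 (xi X l) p v (eW m) = 0
  D2_xi' : ∀ l v m, D2 (xi X l) p (eW m) v = 0
  dZ_xi0 : ∀ a : Fin 3, dZ (xi X 0) a.succ p = 0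
  D2_xi0 : ∀ a : Fin 3, D2 (xi X 0) p (eZ a.succ) (eZ a.succ) = 0
  skew : ∀ a b : Fin 3, a ≠ b → dZ (xi X b.succ) a.succ p + dZ (xi X a.succ) b.succ p = 0
  diag : ∀ a b : Fin 3, dZ (xi X a.succ) a.succ p = dZ (xi X b.succ) b.succ p

lemma fin3_succ_two : (2 : Fin 3).succ = 3 := rfl

/-- For a conformal `ξ` that depends on `(t, x)` only, second derivatives survive only through the
two spatial traces: skewness cancels the mixed ones against each other, and equality of the diagonal
entries combines the pure ones. The result is a polynomial in the free coordinates whose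
coefficients can be read off. -/
lemma defect_eq {d : Fin 2 → ℝ → ℝ} {X : Operator} {p : Jet0} (hX : ProjectableAt X p)
    {k l : Fin 2} (hkl : l ≠ k) (hη : ∀ m v, D2 (eta X k) p (eW m) v = D2 (eta X k) p v (eW m))
    {P : Fin 2 → Fin 4 → ℝ} {S : Fin 2 → Fin 4 → Fin 4 → ℝ} (hS : ∀ k i h, S k i h = S k h i)
    (hP : ∀ k, P k 0 = d k (p.2 k) * (∑ a : Fin 3, S k a.succ a.succ)
        + deriv (d k) (p.2 k) * ∑ a : Fin 3, P k a.succ ^ 2) :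
    defect d X k p P S =
      (dZ (eta X k) 0 p - d k (p.2 k) * ∑ a : Fin 3, D2 (eta X k) p (eZ a.succ) (eZ a.succ))
      + (∑ a : Fin 3, P k a.succ * (-dZ (xi X a.succ) 0 p
          - 2 * d k (p.2 k) * D2 (eta X k) p (eZ a.succ) (eW k)
          + d k (p.2 k) * (∑ b : Fin 3, D2 (xi X a.succ) p (eZ b.succ) (eZ b.succ))
          - 2 * deriv (d k) (p.2 k) * dZ (eta X k) a.succ p))
      + (∑ a : Fin 3, P l a.succ * (-2 * d k (p.2 k) * D2 (eta X k) p (eZ a.succ) (eW l)))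
      + (∑ a : Fin 3, S k a.succ a.succ) * (d k (p.2 k) * (2 * dZ (xi X 1) 1 p - dZ (xi X 0) 0 p)
          - deriv (d k) (p.2 k) * eta X k p)
      + (∑ a : Fin 3, S l a.succ a.succ) * (dW (eta X k) l p * (d l (p.2 l) - d k (p.2 k)))
      + (∑ a : Fin 3, P k a.succ ^ 2) * ((dW (eta X k) k p - dZ (xi X 0) 0 p) * deriv (d k) (p.2 k)
          - d k (p.2 k) * D2 (eta X k) p (eW k) (eW k) - deriv (deriv (d k)) (p.2 k) * eta X k p
          - 2 * deriv (d k) (p.2 k) * dW (eta X k) k p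
          + 2 * deriv (d k) (p.2 k) * dZ (xi X 1) 1 p)
      + (∑ a : Fin 3, P k a.succ * P l a.succ) * (-2 * d k (p.2 k) * D2 (eta X k) p (eW k) (eW l)
          - 2 * deriv (d k) (p.2 k) * dW (eta X k) l p)
      + (∑ a : Fin 3, P l a.succ ^ 2) * (dW (eta X k) l p * deriv (d l) (p.2 l)
          - d k (p.2 k) * D2 (eta X k) p (eW l) (eW l)) := by
  have hξ : ∀ i l' , fderiv ℝ (xi X l') p (tvec P i) = dZ (xi X l') i p := fun i l' => by
    rw [fderiv_tvec hkl, hX.dW_xi, hX.dW_xi]; ring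
  have hξ2 : ∀ i l', D2 (xi X l') p (tvec P i) (tvec P i) = D2 (xi X l') p (eZ i) (eZ i) := by
    intro i l'
    rw [D2_tvec hkl]
    · simp only [hX.D2_xi]; ring
    · intro m v; rw [hX.D2_xi, hX.D2_xi']
  have hv : ∀ l' w, fderiv ℝ (xi X l') p (0, w) = 0 := fun l' w => by
    rw [fderiv_vert hkl, hX.dW_xi, hX.dW_xi]; ring
  have s01 := hX.dZ_xi0 0
  have s02 := hX.dZ_xi0 1
  have s03 := hX.dZ_xi0 2
  have r01 := hX.D2_xi0 0
  have r02 := hX.D2_xi0 1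
  have r03 := hX.D2_xi0 2
  have k12 := hX.skew 0 1 (by decide)
  have k13 := hX.skew 0 2 (by decide)
  have k23 := hX.skew 1 2 (by decide)
  have g2 := hX.diag 1 0
  have g3 := hX.diag 2 0
  have Pk := hP k
  have Pl := hP l
  have S12 := hS k 1 2
  have S13 := hS k 1 3
  have S23 := hS k 2 3
  have S01 := hS k 0 1
  have S02 := hS k 0 2
  have S03 := hS k 0 3
  simp only [Fin.sum_univ_three, Fin.succ_zero_eq_one, Fin.succ_one_eq_two, fin3_succ_two] at *
  simp only [defect, z1, z2, hξ, hξ2, hv, D2_tvec hkl hη, fderiv_tvec hkl, fderiv_vert hkl,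
    Fin.sum_univ_four, Fin.sum_univ_three, Fin.succ_zero_eq_one, Fin.succ_one_eq_two,
    fin3_succ_two, s01, s02, s03, r01, r02, r03, g2, g3]
  -- Both time derivatives are eliminated: the other equation enters through `η^k` depending on
  -- `w_l`, which produces the factor `d_l - d_k`.
  rw [Pk, Pl, S12, S13, S23, S01, S02, S03]
  have k12' := eq_neg_of_add_eq_zero_left k12
  have k13' := eq_neg_of_add_eq_zero_left k13
  have k23' := eq_neg_of_add_eq_zero_left k23
  rw [k12', k13', k23']
  ring

lemma fderiv_vert_single (F : Jet0 → ℝ) (p : Jet0) (k : Fin 2) (c : ℝ) :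
    fderiv ℝ F p (0, Pi.single k c) = c * dW F k p := by
  have : ((0 : Indep), (Pi.single k c : Dep)) = c • eW k := by
    ext m
    · simp
    · simp [Pi.single_apply]
  rw [this, map_smul, smul_eq_mul, dW]

/-! ### The leading terms: `ξ` is projectable and conformal. -/

/-- The symmetry condition over a point. -/
def SymAt (d : Fin 2 → ℝ → ℝ) (X : Operator) (p : Jet0) : Prop :=
  ∀ k, ∀ P S, (∀ k i h, S k i h = S k h i) →
      (∀ k, P k 0 = d k (p.2 k) * (∑ a : Fin 3, S k a.succ a.succ)
        + deriv (d k) (p.2 k) * ∑ a : Fin 3, P k a.succ ^ 2) → defect d X k p P S = 0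

/-- Extend spatial first derivatives by the time derivative for vanishing second derivatives. -/
def extP (d : Fin 2 → ℝ → ℝ) (p : Jet0) (q : Fin 2 → Fin 3 → ℝ) : Fin 2 → Fin 4 → ℝ :=
  fun m => Fin.cons (deriv (d m) (p.2 m) * ∑ a, q m a ^ 2) (q m)

/-- The jets with second derivatives `0` and `T` in the `k`-th slot have the same first derivatives,
because the equation sees only the spatial trace of `T`. The difference of the two conditions is
linear in `T`, and only the terms `S · Dξ` of the second prolongation remain, with the common factor
`2 d_k`. Time-space entries of `T` are allowed too, which gives access to `ξ⁰`. -/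
lemma SymAt.trace_free {d : Fin 2 → ℝ → ℝ} {X : Operator} {p : Jet0} (h : SymAt d X p)
    {k : Fin 2} (hd : d k (p.2 k) ≠ 0) (q : Fin 2 → Fin 3 → ℝ) (T : Fin 4 → Fin 4 → ℝ)
    (hT : ∀ i h, T i h = T h i) (hT0 : ∑ a : Fin 3, T a.succ a.succ = 0) :
    ∑ a : Fin 3, ∑ l, T a.succ l * fderiv ℝ (xi X l) p (tvec (extP d p q) a.succ) = 0 := by
  have h1 := h k (extP d p q) (fun _ _ _ => 0) (fun _ _ _ => rfl) (fun k => by simp [extP])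
  have h2 := h k (extP d p q) (fun m i h => (Pi.single k (T i h) : Dep) m)
    (fun m i h => by rw [hT]) (fun m => by
      have : ∑ a : Fin 3, (Pi.single k (T a.succ a.succ) : Dep) m = 0 := by
        rcases eq_or_ne m k with rfl | hm
        · simpa using hT0
        · simp [Pi.single_eq_of_ne hm]
      rw [this]; simp [extP])
  have e0 : ∀ F : Jet0 → ℝ, fderiv ℝ F p (0, fun _ => (0 : ℝ)) = 0 := fun F => by
    have : ((0 : Indep), fun _ : Fin 2 => (0 : ℝ)) = 0 := rfl
    rw [this, map_zero]
  have e1 : ∀ F : Jet0 → ℝ, ∀ i h,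
      fderiv ℝ F p (0, fun m => (Pi.single k (T i h) : Dep) m) = T i h * dW F k p :=
    fun F i h => fderiv_vert_single F p k _
  have t10 := hT 1 0
  have t20 := hT 2 0
  have t30 := hT 3 0
  have t21 := hT 2 1
  have t31 := hT 3 1
  have t32 := hT 3 2
  refine mul_left_cancel₀ (mul_ne_zero two_ne_zero hd) ?_
  simp only [defect, z2, e0, e1, Fin.sum_univ_four, Fin.sum_univ_three, Fin.succ_zero_eq_one,
    Fin.succ_one_eq_two, fin3_succ_two, Pi.single_eq_same] at *
  rw [t10, t20, t30, t21, t31, t32] at *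
  linear_combination h2 - h1 + hT0 * (d k (p.2 k) * (dW (eta X k) k p
    - extP d p q k 0 * dW (xi X 0) k p - extP d p q k 1 * dW (xi X 1) k p
    - extP d p q k 2 * dW (xi X 2) k p - extP d p q k 3 * dW (xi X 3) k p)
    + deriv (d k) (p.2 k) * eta X k p)

lemma SymAt.dZ_xi0 {d : Fin 2 → ℝ → ℝ} {X : Operator} {p : Jet0} (h : SymAt d X p)
    (hd : d 0 (p.2 0) ≠ 0) (a : Fin 3) (q : Fin 2 → Fin 3 → ℝ) :
    fderiv ℝ (xi X 0) p (tvec (extP d p q) a.succ) = 0 := by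
  have := h.trace_free hd q 
    (fun i h => (if i = a.succ ∧ h = 0 then 1 else 0) + if h = a.succ ∧ i = 0 then 1 else 0)
    (fun i h => by rw [add_comm]) (by simp [Fin.succ_ne_zero])
  simpa [add_mul, Finset.sum_add_distrib, ite_and] using this

lemma SymAt.skew {d : Fin 2 → ℝ → ℝ} {X : Operator} {p : Jet0} (h : SymAt d X p)
    (hd : d 0 (p.2 0) ≠ 0) {a b : Fin 3} (hab : a ≠ b) (q : Fin 2 → Fin 3 → ℝ) :
    fderiv ℝ (xi X b.succ) p (tvec (extP d p q) a.succ)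
      + fderiv ℝ (xi X a.succ) p (tvec (extP d p q) b.succ) = 0 := by
  have := h.trace_free hd q
    (fun i h => (if i = a.succ ∧ h = b.succ then 1 else 0) + if h = a.succ ∧ i = b.succ then 1 else 0)
    (fun i h => by rw [add_comm]) (by
      rw [Finset.sum_eq_zero]
      intro c _
      have : ¬ (c = a ∧ c = b) := fun ⟨h1, h2⟩ => hab (h1.symm.trans h2)
      simp [this])
  simpa [add_mul, Finset.sum_add_distrib, ite_and] using this

lemma SymAt.diag {d : Fin 2 → ℝ → ℝ} {X : Operator} {p : Jet0} (h : SymAt d X p)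
    (hd : d 0 (p.2 0) ≠ 0) (a b : Fin 3) (q : Fin 2 → Fin 3 → ℝ) :
    fderiv ℝ (xi X a.succ) p (tvec (extP d p q) a.succ)
      = fderiv ℝ (xi X b.succ) p (tvec (extP d p q) b.succ) := by
  have := h.trace_free hd q
    (fun i h => (if i = a.succ ∧ h = a.succ then 1 else 0) - if i = b.succ ∧ h = b.succ then 1 else 0)
    (fun i h => by simp only [and_comm]) (by simp)
  have h2 : ∀ c : Fin 3, (∑ x : Fin 3, ∑ l, ((if x.succ = c.succ ∧ l = c.succ then (1:ℝ) else 0)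
      * fderiv ℝ (xi X l) p (tvec (extP d p q) x.succ))) =
      fderiv ℝ (xi X c.succ) p (tvec (extP d p q) c.succ) := by
    intro c; simp [ite_and]
  simp only [sub_mul, Finset.sum_sub_distrib, h2] at this
  linarith

lemma extP_zero_tvec (d : Fin 2 → ℝ → ℝ) (p : Jet0) (a : Fin 3) :
    tvec (extP d p 0) a.succ = eZ a.succ := by
  ext m <;> simp [tvec, extP]

lemma extP_single_tvec (d : Fin 2 → ℝ → ℝ) (p : Jet0) (a b : Fin 3) (m : Fin 2) :
    tvec (extP d p (Pi.single m (Pi.single a 1))) b.succ =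
      if b = a then eZ b.succ + eW m else eZ b.succ := by
  have : ∀ n, (Pi.single m (Pi.single a 1) : Fin 2 → Fin 3 → ℝ) n b =
      if b = a then (Pi.single m 1 : Dep) n else 0 := by
    intro n
    rcases eq_or_ne n m with rfl | hn <;> simp [Pi.single_apply, *]
  ext n
  · split_ifs <;> simp [tvec]
  · simp only [tvec, extP, Fin.cons_succ, this]
    split_ifs <;> simp

/-- The identities for total derivatives hold for all spatial slopes `q`. Slope zero gives the
statements about `x`-derivatives, and a unit slope in one direction then isolates the derivative
along `w_m`. -/
lemma SymAt.basic {d : Fin 2 → ℝ → ℝ} {X : Operator} {p : Jet0} (h : SymAt d X p)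
    (hd : d 0 (p.2 0) ≠ 0) :
    (∀ l m, dW (xi X l) m p = 0) ∧ (∀ a : Fin 3, dZ (xi X 0) a.succ p = 0) ∧
    (∀ a b : Fin 3, a ≠ b → dZ (xi X b.succ) a.succ p + dZ (xi X a.succ) b.succ p = 0) ∧
    (∀ a b : Fin 3, dZ (xi X a.succ) a.succ p = dZ (xi X b.succ) b.succ p) := by
  have h0 : ∀ a : Fin 3, dZ (xi X 0) a.succ p = 0 := fun a => by
    have := h.dZ_xi0 hd a 0
    rwa [extP_zero_tvec] at this
  have hs : ∀ a b : Fin 3, a ≠ b → dZ (xi X b.succ) a.succ p + dZ (xi X a.succ) b.succ p = 0 :=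
    fun a b hab => by
      have := h.skew hd hab 0
      rwa [extP_zero_tvec, extP_zero_tvec] at this
  refine ⟨fun l m => ?_, h0, hs, fun a b => by
    have := h.diag hd a b 0
    rwa [extP_zero_tvec, extP_zero_tvec] at this⟩
  induction l using Fin.cases with
  | zero =>
    have := h.dZ_xi0 hd 0 (Pi.single m (Pi.single 0 1))
    rw [extP_single_tvec, if_pos rfl, map_add] at this
    have h' := h0 0
    rw [dZ] at h'
    rw [dW]; linarith
  | succ b =>
    obtain ⟨a, hab⟩ : ∃ a : Fin 3, a ≠ b := exists_ne b
    -- The slope is nonzero only along `a ≠ b`, so `D_b` is still `∂_b`, whereas `D_a ξ^b` gains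
    -- exactly `∂ξ^b/∂w_m`. This needs a second space direction.
    have := h.skew hd hab (Pi.single m (Pi.single a 1))
    rw [extP_single_tvec, extP_single_tvec, if_pos rfl, if_neg hab.symm, map_add] at this
    have h' := hs a b hab
    rw [dZ, dZ] at h'
    rw [dW]; linarith

lemma D2_symm {F : Jet0 → ℝ} {p : Jet0} (hF : ContDiffAt ℝ ∞ F p) (v w : Jet0) :
    D2 F p v w = D2 F p w v :=
  (hF.isSymmSndFDerivAt (by
    rw [minSmoothness_of_isRCLikeNormedField, ← one_add_one_eq_two]; norm_cast)).eq v w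

lemma D2_eq {F : Jet0 → ℝ} {p : Jet0} (hF : ContDiffAt ℝ ∞ F p) (v w : Jet0) :
    D2 F p v w = fderiv ℝ (fun m => fderiv ℝ F m w) p v := by
  have h1 : DifferentiableAt ℝ (fderiv ℝ F) p :=
    (hF.fderiv_right (m := 1) (by norm_cast)).differentiableAt (by simp)
  rw [fderiv_clm_apply h1 (differentiableAt_const w)]
  simp [D2]

lemma contDiffAt_xi {X : Operator} {p : Jet0} (hX : ContDiffAt ℝ ∞ X p) (l : Fin 4) :
    ContDiffAt ℝ ∞ (xi X l) p := contDiffAt_pi.1 hX.fst l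

lemma fderiv_eq_zero_of_eqOn {F : Jet0 → ℝ} {U : Set Jet0} (hU : IsOpen U)
    (hF : ∀ m ∈ U, F m = 0) {p : Jet0} (hp : p ∈ U) : fderiv ℝ F p = 0 := by
  have : F =ᶠ[nhds p] fun _ => 0 := by
    filter_upwards [hU.mem_nhds hp] with m hm using hF m hm
  rw [this.fderiv_eq]; simp

/-- The first order identities hold on an open set, so differentiating them gives the second order
ones. -/
lemma projectableAt {d : Fin 2 → ℝ → ℝ} {X : Operator} {U : Set Jet0} (hU : IsOpen U)
    (hX : ContDiffOn ℝ ∞ X U) (hd : ∀ p ∈ U, d 0 (p.2 0) ≠ 0) (h : ∀ p ∈ U, SymAt d X p)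
    {p : Jet0} (hp : p ∈ U) : ProjectableAt X p := by
  have hb := fun q hq => (h q hq).basic (hd q hq)
  have hXp := hX.contDiffAt (hU.mem_nhds hp)
  have h2 : ∀ l v m, D2 (xi X l) p v (eW m) = 0 := fun l v m => by
    rw [D2_eq (contDiffAt_xi hXp l)]
    change fderiv ℝ (dW (xi X l) m) p v = 0
    rw [fderiv_eq_zero_of_eqOn hU (fun q hq => (hb q hq).1 l m) hp]
    rfl
  refine ⟨(hb p hp).1, h2, fun l v m => ?_, (hb p hp).2.1, fun a => ?_, (hb p hp).2.2.1,
    (hb p hp).2.2.2⟩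
  · rw [D2_symm (contDiffAt_xi hXp l), h2]
  · rw [D2_eq (contDiffAt_xi hXp 0)]
    change fderiv ℝ (dZ (xi X 0) a.succ) p _ = 0
    rw [fderiv_eq_zero_of_eqOn hU (fun q hq => (hb q hq).2.1 a) hp]
    rfl

/-! ### Splitting the polynomial identity into the determining equations. -/

lemma quadratic_coeffs {c0 c1 c2 c3 c4 c5 c6 c7 : ℝ} (h : ∀ x y s t : ℝ, c0 + x * c1 + y * c2
    + s * c3 + t * c4 + x ^ 2 * c5 + x * y * c6 + y ^ 2 * c7 = 0) :
    c0 = 0 ∧ c1 = 0 ∧ c2 = 0 ∧ c3 = 0 ∧ c4 = 0 ∧ c5 = 0 ∧ c6 = 0 ∧ c7 = 0 := by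
  have h0 := h 0 0 0 0
  have h1 := h 1 0 0 0
  have h2 := h (-1) 0 0 0
  have h3 := h 0 1 0 0
  have h4 := h 0 (-1) 0 0
  have h5 := h 0 0 1 0
  have h6 := h 0 0 0 1
  have h7 := h 1 1 0 0
  refine ⟨?_, ?_, ?_, ?_, ?_, ?_, ?_, ?_⟩ <;> linarith

/-- The determining equations at a point for one of the dependent variables. -/
lemma SymAt.determining {d : Fin 2 → ℝ → ℝ} {X : Operator} {p : Jet0} (h : SymAt d X p)
    (hX : ProjectableAt X p) {k l : Fin 2} (hkl : l ≠ k)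
    (hη : ∀ m v, D2 (eta X k) p (eW m) v = D2 (eta X k) p v (eW m)) (a : Fin 3) :
    (dZ (eta X k) 0 p - d k (p.2 k) * ∑ a : Fin 3, D2 (eta X k) p (eZ a.succ) (eZ a.succ)) = 0 ∧
    (-dZ (xi X a.succ) 0 p
          - 2 * d k (p.2 k) * D2 (eta X k) p (eZ a.succ) (eW k)
          + d k (p.2 k) * (∑ b : Fin 3, D2 (xi X a.succ) p (eZ b.succ) (eZ b.succ))
          - 2 * deriv (d k) (p.2 k) * dZ (eta X k) a.succ p) = 0 ∧
    (-2 * d k (p.2 k) * D2 (eta X k) p (eZ a.succ) (eW l)) = 0 ∧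
    (d k (p.2 k) * (2 * dZ (xi X 1) 1 p - dZ (xi X 0) 0 p) - deriv (d k) (p.2 k) * eta X k p) = 0 ∧
    (dW (eta X k) l p * (d l (p.2 l) - d k (p.2 k))) = 0 ∧
    ((dW (eta X k) k p - dZ (xi X 0) 0 p) * deriv (d k) (p.2 k)
          - d k (p.2 k) * D2 (eta X k) p (eW k) (eW k) - deriv (deriv (d k)) (p.2 k) * eta X k p
          - 2 * deriv (d k) (p.2 k) * dW (eta X k) k p
          + 2 * deriv (d k) (p.2 k) * dZ (xi X 1) 1 p) = 0 ∧
    (-2 * d k (p.2 k) * D2 (eta X k) p (eW k) (eW l)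
          - 2 * deriv (d k) (p.2 k) * dW (eta X k) l p) = 0 ∧
    (dW (eta X k) l p * deriv (d l) (p.2 l) - d k (p.2 k) * D2 (eta X k) p (eW l) (eW l)) = 0 := by
  apply quadratic_coeffs
  intro x y s t
  -- A jet varying in the single space direction `a` suffices: `x, y` are the slopes of `w_k, w_l`
  -- along it and `s, t` their second derivatives. The time components are those that the equations
  -- prescribe.
  have := h k (fun m => Fin.cons (d m (p.2 m) * (if m = k then s else t)
      + deriv (d m) (p.2 m) * (if m = k then x else y) ^ 2)
      (Pi.single a (if m = k then x else y)))
    (fun m i h => if i = a.succ ∧ h = a.succ then (if m = k then s else t) else 0)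
    (fun m i h => by simp only [and_comm]) (fun m => by simp [Pi.single_apply, ite_pow])
  rw [defect_eq hX hkl hη (fun m i h => by simp only [and_comm])
    (fun m => by simp [Pi.single_apply, ite_pow])] at this
  simp only [Fin.cons_succ, if_true, hkl, if_false, Pi.single_apply, Fin.succ_inj, and_self,
    ite_pow, ite_mul, zero_mul, mul_ite, mul_zero, Finset.sum_ite_eq', Finset.mem_univ, ne_eq,
    OfNat.ofNat_ne_zero, not_false_eq_true, zero_pow] at this
  convert this using 1

/-! Calculus of partial derivatives on open sets. -/

lemma pd_congr {Ω : Set Indep} (hΩ : IsOpen Ω) {f g : Indep → ℝ} (h : ∀ z ∈ Ω, f z = g z)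
    {z : Indep} (hz : z ∈ Ω) (i : Fin 4) : pd i f z = pd i g z := by
  have : f =ᶠ[nhds z] g := by
    filter_upwards [hΩ.mem_nhds hz] with y hy using h y hy
  rw [pd, this.fderiv_eq, pd]

lemma contDiffOn_pd {Ω : Set Indep} (hΩ : IsOpen Ω) {f : Indep → ℝ} (hf : ContDiffOn ℝ ∞ f Ω)
    (i : Fin 4) : ContDiffOn ℝ ∞ (pd i f) Ω :=
  (hf.fderiv_of_isOpen hΩ (by norm_cast)).clm_apply contDiffOn_const

lemma pd_affine {Ω : Set Indep} (hΩ : IsOpen Ω) {f g h : Indep → ℝ} (hf : ContDiffOn ℝ ∞ f Ω)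
    (hg : ContDiffOn ℝ ∞ g Ω) {c e : ℝ} (hh : ∀ z ∈ Ω, h z = c * f z + g z + e) {z : Indep}
    (hz : z ∈ Ω) (i : Fin 4) : pd i h z = c * pd i f z + pd i g z := by
  have h1 := (hf.contDiffAt (hΩ.mem_nhds hz)).differentiableAt (by simp)
  have h2 := (hg.contDiffAt (hΩ.mem_nhds hz)).differentiableAt (by simp)
  rw [pd_congr hΩ hh hz, pd, (((h1.hasFDerivAt.const_mul c).fun_add h2.hasFDerivAt).add_const e).fderiv]
  simp [pd]

lemma contDiffOn_dZ {U : Set Jet0} (hU : IsOpen U) {F : Jet0 → ℝ} (hF : ContDiffOn ℝ ∞ F U)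
    (i : Fin 4) : ContDiffOn ℝ ∞ (dZ F i) U :=
  (hF.fderiv_of_isOpen hU (by norm_cast)).clm_apply contDiffOn_const

lemma contDiffOn_dW {U : Set Jet0} (hU : IsOpen U) {F : Jet0 → ℝ} (hF : ContDiffOn ℝ ∞ F U)
    (m : Fin 2) : ContDiffOn ℝ ∞ (dW F m) U :=
  (hF.fderiv_of_isOpen hU (by norm_cast)).clm_apply contDiffOn_const

lemma dZ_congr {U : Set Jet0} (hU : IsOpen U) {F G : Jet0 → ℝ} (h : ∀ m ∈ U, F m = G m)
    {p : Jet0} (hp : p ∈ U) (i : Fin 4) : dZ F i p = dZ G i p := by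
  have : F =ᶠ[nhds p] G := by
    filter_upwards [hU.mem_nhds hp] with y hy using h y hy
  rw [dZ, this.fderiv_eq, dZ]

lemma dW_congr {U : Set Jet0} (hU : IsOpen U) {F G : Jet0 → ℝ} (h : ∀ m ∈ U, F m = G m)
    {p : Jet0} (hp : p ∈ U) (i : Fin 2) : dW F i p = dW G i p := by
  have : F =ᶠ[nhds p] G := by
    filter_upwards [hU.mem_nhds hp] with y hy using h y hy
  rw [dW, this.fderiv_eq, dW]

lemma D2_eZ {F : Jet0 → ℝ} {p : Jet0} (hF : ContDiffAt ℝ ∞ F p) (v : Jet0) (i : Fin 4) :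
    D2 F p v (eZ i) = fderiv ℝ (dZ F i) p v := D2_eq hF v _

lemma D2_eW {F : Jet0 → ℝ} {p : Jet0} (hF : ContDiffAt ℝ ∞ F p) (v : Jet0) (m : Fin 2) :
    D2 F p v (eW m) = fderiv ℝ (dW F m) p v := D2_eq hF v _

lemma contDiffOn_slice {B : Region} {F : Jet0 → ℝ} (hF : ContDiffOn ℝ ∞ F B.dom) {w : Dep}
    (hw : ∀ k, w k ∈ B.I k) : ContDiffOn ℝ ∞ (fun z => F (z, w)) B.Ω :=
  hF.comp (contDiff_id.prodMk contDiff_const).contDiffOn fun _ hz => ⟨hz, hw⟩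

/-- A function with vanishing derivative in the direction `w_k` does not depend on `w_k`. -/
lemma eq_update_of_dW_eq_zero {B : Region} {F : Jet0 → ℝ} (hF : ContDiffOn ℝ ∞ F B.dom)
    {k : Fin 2} (h : ∀ m ∈ B.dom, dW F k m = 0) {z : Indep} {w : Dep} (hz : z ∈ B.Ω)
    (hw : ∀ k, w k ∈ B.I k) {τ : ℝ} (hτ : τ ∈ B.I k) :
    F (z, w) = F (z, Function.update w k τ) := by
  have hmem : ∀ s ∈ B.I k, (z, Function.update w k s) ∈ B.dom := fun s hs => ⟨hz, fun l => by
    rcases eq_or_ne l k with rfl | hl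
    · simpa using hs
    · simpa [hl] using hw l⟩
  have hder : ∀ s ∈ B.I k, HasDerivAt (fun s => F (z, Function.update w k s)) 0 s := by
    intro s hs
    have h1 : HasDerivAt (fun s : ℝ => (z, Function.update w k s)) ((0 : Indep), Pi.single k 1) s :=
      (hasDerivAt_const s z).prodMk (hasDerivAt_update w k s)
    have h2 := ((hF.contDiffAt (B.isOpen_dom.mem_nhds (hmem s hs))).differentiableAt
      (by simp)).hasFDerivAt.comp_hasDerivAt s h1
    have h3 : (fderiv ℝ F (z, Function.update w k s)) ((0 : Indep), Pi.single k 1) = 0 :=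
      h _ (hmem s hs)
    rw [h3] at h2
    exact h2
  have := (B.isOpen_I k).is_const_of_deriv_eq_zero (B.isConnected_I k).isPreconnected
    (fun s hs => (hder s hs).differentiableAt.differentiableWithinAt)
    (fun s hs => (hder s hs).deriv) (hw k) hτ
  simpa using this

lemma eq_of_dW_eq_zero {B : Region} {F : Jet0 → ℝ} (hF : ContDiffOn ℝ ∞ F B.dom)
    (h : ∀ m ∈ B.dom, ∀ k, dW F k m = 0) {z : Indep} {w w' : Dep} (hz : z ∈ B.Ω)
    (hw : ∀ k, w k ∈ B.I k) (hw' : ∀ k, w' k ∈ B.I k) : F (z, w) = F (z, w') := by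
  rw [eq_update_of_dW_eq_zero hF (fun m hm => h m hm 0) hz hw (hw' 0),
    eq_update_of_dW_eq_zero hF (fun m hm => h m hm 1) hz ?_ (hw' 1)]
  · congr
    ext l; fin_cases l <;> simp
  · intro l; fin_cases l
    · simpa using hw' 0
    · simpa using hw 1

lemma Region.isPreconnected_dom (B : Region) : IsPreconnected B.dom := by
  have : B.dom = B.Ω ×ˢ (Set.univ.pi B.I) := by
    ext m; simp [Region.dom]
  rw [this]
  exact B.isConnected_Ω.isPreconnected.prod
    (isPreconnected_univ_pi fun k => (B.isConnected_I k).isPreconnected)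

/-! ### Functions affine in the dependent variables. -/

lemma rev_ne (k : Fin 2) : k.rev ≠ k := by fin_cases k <;> decide

/-- The function `f(z) w_k + c w_{k.rev} + g(z)`. -/
def lin (k : Fin 2) (f : Indep → ℝ) (c : ℝ) (g : Indep → ℝ) : Jet0 → ℝ :=
  fun m => f m.1 * m.2 k + c * m.2 k.rev + g m.1

section lin

variable {B : Region} {k : Fin 2} {f g : Indep → ℝ} {c : ℝ}

lemma hasFDerivAt_lin (hf : ContDiffOn ℝ ∞ f B.Ω) (hg : ContDiffOn ℝ ∞ g B.Ω) {p : Jet0}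
    (hp : p ∈ B.dom) (v : Jet0) : fderiv ℝ (lin k f c g) p v =
      fderiv ℝ f p.1 v.1 * p.2 k + f p.1 * v.2 k + c * v.2 k.rev + fderiv ℝ g p.1 v.1 := by
  have hn := B.isOpen_Ω.mem_nhds hp.1
  have h1 : HasFDerivAt (fun m : Jet0 => f m.1) _ p :=
    ((hf.contDiffAt hn).differentiableAt (by simp)).hasFDerivAt.comp p hasFDerivAt_fst
  have h2 : HasFDerivAt (fun m : Jet0 => g m.1) _ p :=
    ((hg.contDiffAt hn).differentiableAt (by simp)).hasFDerivAt.comp p hasFDerivAt_fst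
  have h3 : HasFDerivAt (fun m : Jet0 => m.2 k) (coordW k) p := (coordW k).hasFDerivAt
  have h4 : HasFDerivAt (fun m : Jet0 => m.2 k.rev) (coordW k.rev) p := (coordW k.rev).hasFDerivAt
  have h5 : HasFDerivAt (lin k f c g) _ p := ((h1.fun_mul h3).fun_add (h4.const_mul c)).fun_add h2
  rw [h5.fderiv]
  simp
  ring

lemma contDiffOn_lin (hf : ContDiffOn ℝ ∞ f B.Ω) (hg : ContDiffOn ℝ ∞ g B.Ω) :
    ContDiffOn ℝ ∞ (lin k f c g) B.dom := by
  have h1 : ContDiffOn ℝ ∞ (fun m : Jet0 => f m.1) B.dom :=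
    hf.comp contDiff_fst.contDiffOn fun m hm => hm.1
  have h2 : ContDiffOn ℝ ∞ (fun m : Jet0 => g m.1) B.dom :=
    hg.comp contDiff_fst.contDiffOn fun m hm => hm.1
  have h3 : ∀ k, ContDiffOn ℝ ∞ (fun m : Jet0 => m.2 k) B.dom := fun k =>
    (coordW k).contDiff.contDiffOn
  exact ((h1.mul (h3 k)).add (contDiffOn_const.mul (h3 k.rev))).add h2

lemma dZ_lin (hf : ContDiffOn ℝ ∞ f B.Ω) (hg : ContDiffOn ℝ ∞ g B.Ω) (i : Fin 4) {p : Jet0}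
    (hp : p ∈ B.dom) : dZ (lin k f c g) i p = lin k (pd i f) 0 (pd i g) p := by
  rw [dZ, hasFDerivAt_lin hf hg hp]
  simp [lin, pd]

lemma dW_lin (hf : ContDiffOn ℝ ∞ f B.Ω) (hg : ContDiffOn ℝ ∞ g B.Ω) {p : Jet0}
    (hp : p ∈ B.dom) : dW (lin k f c g) k p = lin k 0 0 f p := by
  rw [dW, hasFDerivAt_lin hf hg hp]
  simp [lin, rev_ne k]

lemma dW_lin' (hf : ContDiffOn ℝ ∞ f B.Ω) (hg : ContDiffOn ℝ ∞ g B.Ω) {p : Jet0}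
    (hp : p ∈ B.dom) : dW (lin k f c g) k.rev p = lin k 0 0 (fun _ => c) p := by
  rw [dW, hasFDerivAt_lin hf hg hp]
  simp [lin, (rev_ne k).symm]

end lin

/-! ### The determining system for functions of `(t, x)`. -/

/-- The operator `ξ^l(t,x) ∂_l + (A^k(t,x) w_k + C^k w_{k.rev} + b^k(t,x)) ∂_{w_k}`. -/
def dataOp (ξ : Fin 4 → Indep → ℝ) (A b : Fin 2 → Indep → ℝ) (C : Fin 2 → ℝ) : Operator :=
  fun m => (fun l => ξ l m.1, fun k => lin k (A k) (C k) (b k) m)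

/-- The determining equations of the symmetries of the heat system. -/
structure DetEqs (B : Region) (d : Fin 2 → ℝ → ℝ) (ξ : Fin 4 → Indep → ℝ)
    (A b : Fin 2 → Indep → ℝ) (C : Fin 2 → ℝ) : Prop where
  smooth_xi : ∀ l, ContDiffOn ℝ ∞ (ξ l) B.Ω
  smooth_A : ∀ k, ContDiffOn ℝ ∞ (A k) B.Ω
  smooth_b : ∀ k, ContDiffOn ℝ ∞ (b k) B.Ω
  cross : C = 0 ∨ ∃ κ, ∀ k, IsConstOn (d k) (B.I k) κ
  time : ∀ z ∈ B.Ω, ∀ a : Fin 3, pd a.succ (ξ 0) z = 0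
  skew : ∀ z ∈ B.Ω, ∀ a b : Fin 3, a ≠ b → pd a.succ (ξ b.succ) z + pd b.succ (ξ a.succ) z = 0
  scale : ∀ z ∈ B.Ω, ∀ k, ∀ w ∈ B.I k, ∀ a : Fin 3, deriv (d k) w * (A k z * w + b k z) =
    d k w * (2 * pd a.succ (ξ a.succ) z - pd 0 (ξ 0) z)
  drift : ∀ z ∈ B.Ω, ∀ k, ∀ w ∈ B.I k, ∀ a : Fin 3, -pd 0 (ξ a.succ) z
    - 2 * d k w * pd a.succ (A k) z + d k w * (∑ b : Fin 3, pd b.succ (pd b.succ (ξ a.succ)) z)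
    - 2 * deriv (d k) w * (pd a.succ (A k) z * w + pd a.succ (b k) z) = 0
  heat : ∀ z ∈ B.Ω, ∀ k, ∀ w ∈ B.I k, pd 0 (A k) z * w + pd 0 (b k) z =
    d k w * ∑ a : Fin 3, (pd a.succ (pd a.succ (A k)) z * w + pd a.succ (pd a.succ (b k)) z)

lemma deriv_eq_zero_of_isConstOn {d : ℝ → ℝ} {I : Set ℝ} (hI : IsOpen I) {κ : ℝ}
    (h : IsConstOn d I κ) {w : ℝ} (hw : w ∈ I) : deriv d w = 0 := by
  have : d =ᶠ[nhds w] fun _ => κ := by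
    filter_upwards [hI.mem_nhds hw] with y hy using h y hy
  rw [this.deriv_eq]; simp

lemma dW_of_w {k : Fin 2} {f : ℝ → ℝ} {p : Jet0} (hf : DifferentiableAt ℝ f (p.2 k)) :
    DifferentiableAt ℝ (fun m : Jet0 => f (m.2 k)) p ∧
    dW (fun m : Jet0 => f (m.2 k)) k p = deriv f (p.2 k) := by
  have h := hf.hasDerivAt.comp_hasFDerivAt p (coordW k).hasFDerivAt
  refine ⟨h.differentiableAt, ?_⟩
  have : dW (fun m : Jet0 => f (m.2 k)) k p = _ := congrArg (· (eW k)) h.fderiv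
  rw [this]
  simp

lemma dW_mul {F G : Jet0 → ℝ} {p : Jet0} {k : Fin 2} (hF : DifferentiableAt ℝ F p)
    (hG : DifferentiableAt ℝ G p) :
    dW (fun m => F m * G m) k p = F p * dW G k p + dW F k p * G p := by
  rw [dW, fderiv_fun_mul hF hG]
  simp [dW, mul_comm]

lemma dW_sub {F G : Jet0 → ℝ} {p : Jet0} {k : Fin 2} (hF : DifferentiableAt ℝ F p)
    (hG : DifferentiableAt ℝ G p) :
    dW (fun m => F m - G m) k p = dW F k p - dW G k p := by
  rw [dW, fderiv_fun_sub hF hG]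
  simp [dW]

/-! ### Every symmetry comes from a solution of the determining system. -/

section necessity

variable {B : Region} {d : Fin 2 → ℝ → ℝ} {X : Operator}

lemma Region.Admissible.contDiffAt (hd : B.Admissible d) {k : Fin 2} {w : ℝ} (hw : w ∈ B.I k) :
    ContDiffAt ℝ ∞ (d k) w := (hd k).1.contDiffAt ((B.isOpen_I k).mem_nhds hw)

lemma Region.Admissible.differentiableAt (hd : B.Admissible d) {k : Fin 2} {w : ℝ}
    (hw : w ∈ B.I k) : DifferentiableAt ℝ (d k) w :=
  (hd.contDiffAt hw).differentiableAt (by simp)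

lemma Region.Admissible.contDiffAt_deriv (hd : B.Admissible d) {k : Fin 2} {w : ℝ}
    (hw : w ∈ B.I k) : ContDiffAt ℝ ∞ (deriv (d k)) w := by
  have h := (hd.contDiffAt hw).fderiv_right (m := ∞) (by norm_cast)
  have e : deriv (d k) = fun x => fderiv ℝ (d k) x 1 := by
    ext x; simp
  rw [e]
  exact h.clm_apply contDiffAt_const

lemma Region.Admissible.differentiableAt_deriv (hd : B.Admissible d) {k : Fin 2} {w : ℝ}
    (hw : w ∈ B.I k) : DifferentiableAt ℝ (deriv (d k)) w :=
  (hd.contDiffAt_deriv hw).differentiableAt (by simp)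

lemma Region.IsSymmetry.symAt (hd : B.Admissible d) (hX : B.IsSymmetry d X) {p : Jet0}
    (hp : p ∈ B.dom) : SymAt d X p := fun k P S hS hP =>
  ((isSymmetry_iff hd B.isOpen_dom).1 hX).2 k p hp P S hS hP

lemma Region.IsSymmetry.projectableAt (hd : B.Admissible d) (hX : B.IsSymmetry d X) {p : Jet0}
    (hp : p ∈ B.dom) : ProjectableAt X p :=
  NHE.projectableAt B.isOpen_dom hX.1 (fun _ hq => ((hd 0).2 _ (hq.2 0)).ne')
    (fun _ hq => hX.symAt hd hq) hp

lemma Region.IsSymmetry.contDiffOn_xi (hX : B.IsSymmetry d X) (l : Fin 4) :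
    ContDiffOn ℝ ∞ (xi X l) B.dom := contDiffOn_pi.1 hX.1.fst l

lemma Region.IsSymmetry.contDiffOn_eta (hX : B.IsSymmetry d X) (k : Fin 2) :
    ContDiffOn ℝ ∞ (eta X k) B.dom := contDiffOn_pi.1 hX.1.snd k

lemma Region.contDiffAt_of_mem {F : Jet0 → ℝ} (hF : ContDiffOn ℝ ∞ F B.dom) {p : Jet0}
    (hp : p ∈ B.dom) : ContDiffAt ℝ ∞ F p := hF.contDiffAt (B.isOpen_dom.mem_nhds hp)

lemma Region.differentiableAt_of_mem {F : Jet0 → ℝ} (hF : ContDiffOn ℝ ∞ F B.dom) {p : Jet0}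
    (hp : p ∈ B.dom) : DifferentiableAt ℝ F p :=
  (B.contDiffAt_of_mem hF hp).differentiableAt (by simp)

lemma Region.IsSymmetry.determining (hd : B.Admissible d) (hX : B.IsSymmetry d X) {p : Jet0}
    (hp : p ∈ B.dom) (k : Fin 2) (a : Fin 3) :
    (dZ (eta X k) 0 p - d k (p.2 k) * ∑ a : Fin 3, dZ (dZ (eta X k) a.succ) a.succ p = 0) ∧
    (-dZ (xi X a.succ) 0 p - 2 * d k (p.2 k) * dZ (dW (eta X k) k) a.succ p
      + d k (p.2 k) * (∑ b : Fin 3, dZ (dZ (xi X a.succ) b.succ) b.succ p)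
      - 2 * deriv (d k) (p.2 k) * dZ (eta X k) a.succ p = 0) ∧
    (-2 * d k (p.2 k) * dZ (dW (eta X k) k.rev) a.succ p = 0) ∧
    (d k (p.2 k) * (2 * dZ (xi X 1) 1 p - dZ (xi X 0) 0 p)
      - deriv (d k) (p.2 k) * eta X k p = 0) ∧
    (dW (eta X k) k.rev p * (d k.rev (p.2 k.rev) - d k (p.2 k)) = 0) ∧
    ((dW (eta X k) k p - dZ (xi X 0) 0 p) * deriv (d k) (p.2 k)
      - d k (p.2 k) * dW (dW (eta X k) k) k p - deriv (deriv (d k)) (p.2 k) * eta X k p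
      - 2 * deriv (d k) (p.2 k) * dW (eta X k) k p
      + 2 * deriv (d k) (p.2 k) * dZ (xi X 1) 1 p = 0) ∧
    (-2 * d k (p.2 k) * dW (dW (eta X k) k.rev) k p
      - 2 * deriv (d k) (p.2 k) * dW (eta X k) k.rev p = 0) ∧
    (dW (eta X k) k.rev p * deriv (d k.rev) (p.2 k.rev)
      - d k (p.2 k) * dW (dW (eta X k) k.rev) k.rev p = 0) := by
  have hη := B.contDiffAt_of_mem (hX.contDiffOn_eta k) hp
  have h := (hX.symAt hd hp).determining (hX.projectableAt hd hp) (rev_ne k)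
    (fun _ _ => D2_symm hη _ _) a
  simp only [D2_eW hη, D2_eZ hη, D2_eZ (B.contDiffAt_of_mem (hX.contDiffOn_xi _) hp)] at h
  exact h

/-- The differential equation says that the product `g(w_l) F` is constant along `w_l`. A single
zero on each such line then makes `F` vanish on the whole line. -/
lemma eq_zero_of_const_mul {F : Jet0 → ℝ} {g : ℝ → ℝ} {l : Fin 2} (hF : ContDiffOn ℝ ∞ F B.dom)
    (hg : ∀ w ∈ B.I l, ContDiffAt ℝ ∞ g w) (hg0 : ∀ w, w ∈ B.I l → g w ≠ 0)
    (h : ∀ m ∈ B.dom, g (m.2 l) * dW F l m + deriv g (m.2 l) * F m = 0)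
    (hz : ∀ m ∈ B.dom, ∃ τ ∈ B.I l, F (m.1, Function.update m.2 l τ) = 0) :
    ∀ m ∈ B.dom, F m = 0 := by
  have hg' : ContDiffOn ℝ ∞ (fun m : Jet0 => g (m.2 l)) B.dom := fun m hm =>
    ((hg _ (hm.2 l)).comp m (coordW l).contDiff.contDiffAt).contDiffWithinAt
  rintro ⟨z, w⟩ hm
  obtain ⟨τ, hτ, h0⟩ := hz _ hm
  have := eq_update_of_dW_eq_zero (hg'.mul hF) (k := l) (fun m hm => by
    have e := dW_mul (k := l) (B.differentiableAt_of_mem hg' hm) (B.differentiableAt_of_mem hF hm)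
    have e' := (dW_of_w (p := m) (k := l) ((hg _ (hm.2 l)).differentiableAt (by simp))).2
    rw [e'] at e
    rw [← h m hm, ← e]) hm.1 hm.2 hτ
  rw [h0, mul_zero] at this
  exact (mul_eq_zero.1 this).resolve_left (hg0 _ (hm.2 l))

lemma exists_ne_of_not_const {d : ℝ → ℝ} {I : Set ℝ} (h : ¬ ∃ κ, IsConstOn d I κ) (κ : ℝ) :
    ∃ w ∈ I, d w ≠ κ := by
  by_contra! h'
  exact h ⟨κ, h'⟩

/-- A dependent variable does not enter the coefficient of the other one, unless both equations are
linear with the same diffusivity. -/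
lemma Region.IsSymmetry.cross (hd : B.Admissible d) (hX : B.IsSymmetry d X) :
    (∃ κ, ∀ k, IsConstOn (d k) (B.I k) κ) ∨ ∀ k, ∀ p ∈ B.dom, dW (eta X k) k.rev p = 0 := by
  by_cases hs : ∃ κ, ∀ k, IsConstOn (d k) (B.I k) κ
  · exact Or.inl hs
  refine Or.inr fun k => ?_
  have hc : ∀ p ∈ B.dom, dW (eta X k) k.rev p * (d k.rev (p.2 k.rev) - d k (p.2 k)) = 0 :=
    fun p hp => (hX.determining hd hp k 0).2.2.2.2.1
  have hs' := contDiffOn_dW B.isOpen_dom (hX.contDiffOn_eta k) k.rev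
  have hupd : ∀ m ∈ B.dom, ∀ l, ∀ τ ∈ B.I l, (m.1, Function.update m.2 l τ) ∈ B.dom :=
    fun m hm l τ hτ => ⟨hm.1, fun l' => by
      rcases eq_or_ne l' l with rfl | hl
      · simpa using hτ
      · simpa [hl] using hm.2 l'⟩
  by_cases h1 : ∃ κ, IsConstOn (d k) (B.I k) κ
  · obtain ⟨κ, hκ⟩ := h1
    by_cases h2 : ∃ κ, IsConstOn (d k.rev) (B.I k.rev) κ
    · obtain ⟨μ, hμ⟩ := h2
      intro p hp
      have := hc p hp
      rw [hκ _ (hp.2 k), hμ _ (hp.2 k.rev)] at this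
      refine (mul_eq_zero.1 this).resolve_right fun h => hs ⟨κ, fun l => ?_⟩
      have hμκ : μ = κ := sub_eq_zero.1 h
      rcases eq_or_ne l k with rfl | hl
      · exact hκ
      · have : l = k.rev := by
          revert hl; fin_cases l <;> fin_cases k <;> decide
        rw [this, ← hμκ]; exact hμ
    · obtain ⟨τ, hτ, hne⟩ := exists_ne_of_not_const h2 κ
      -- With `d_k = κ`, the equation `κ ∂_l σ = d_l' σ` for `σ = ∂η^k/∂w_l` has the integrating
      -- factor `exp(-d_l/κ)`. A zero of `σ` lies where `d_l ≠ κ`.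
      refine eq_zero_of_const_mul (g := fun w => Real.exp (-(κ⁻¹ * d k.rev w))) (l := k.rev) hs'
        (fun w hw => ((contDiffAt_const.mul (hd.contDiffAt hw)).neg).exp)
        (fun w _ => (Real.exp_pos _).ne') ?_ ?_
      · intro m hm
        have e := (hX.determining hd hm k 0).2.2.2.2.2.2.2
        have hd' : HasDerivAt (fun w => Real.exp (-(κ⁻¹ * d k.rev w)))
            (Real.exp (-(κ⁻¹ * d k.rev (m.2 k.rev))) * -(κ⁻¹ * deriv (d k.rev) (m.2 k.rev)))
            (m.2 k.rev) :=
          (((hd.differentiableAt (hm.2 k.rev)).hasDerivAt.const_mul κ⁻¹).fun_neg).exp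
        have hκ0 : κ ≠ 0 := by
          rw [← hκ _ (hm.2 k)]; exact ((hd k).2 _ (hm.2 k)).ne'
        rw [hκ _ (hm.2 k)] at e
        rw [hd'.deriv]
        have : dW (dW (eta X k) k.rev) k.rev m = κ⁻¹ * (dW (eta X k) k.rev m *
            deriv (d k.rev) (m.2 k.rev)) := by
          field_simp; linarith
        rw [this]; ring
      · intro m hm
        refine ⟨τ, hτ, ?_⟩
        have e := hc _ (hupd m hm k.rev τ hτ)
        simp only [Function.update_self, Function.update_of_ne (rev_ne k).symm] at e
        rw [hκ _ (hm.2 k)] at e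
        exact (mul_eq_zero.1 e).resolve_right (sub_ne_zero.2 hne)
  -- Here `∂_k(d_k σ) = 0`. Moving along `w_k` reaches a value of `d_k` different from that of the
  -- other diffusivity, where `σ (d_l - d_k) = 0` forces `σ = 0`.
  · refine eq_zero_of_const_mul (g := d k) (l := k) hs' (fun w hw => hd.contDiffAt hw)
      (fun w hw => ((hd k).2 w hw).ne') ?_ ?_
    · intro m hm
      have e := (hX.determining hd hm k 0).2.2.2.2.2.2.1
      linarith
    · intro m hm
      obtain ⟨τ, hτ, hne⟩ := exists_ne_of_not_const h1 (d k.rev (m.2 k.rev))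
      refine ⟨τ, hτ, ?_⟩
      have e := hc _ (hupd m hm k τ hτ)
      simp only [Function.update_self, Function.update_of_ne (rev_ne k)] at e
      exact (mul_eq_zero.1 e).resolve_right (sub_ne_zero.2 hne.symm)

/-- The coefficients `η` are affine in the dependent variables. -/
lemma Region.IsSymmetry.dW_dW (hd : B.Admissible d) (hX : B.IsSymmetry d X) (k : Fin 2) {p : Jet0}
    (hp : p ∈ B.dom) : dW (dW (eta X k) k) k p = 0 := by
  have hη := hX.contDiffOn_eta k
  have hpos := (hd k).2 _ (hp.2 k)
  have e := (hX.determining hd hp k 0).2.2.2.2.2.1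
  have hb : ∀ m ∈ B.dom, d k (m.2 k) * (2 * dZ (xi X 1) 1 m - dZ (xi X 0) 0 m)
      - deriv (d k) (m.2 k) * eta X k m = 0 := fun m hm => (hX.determining hd hm k 0).2.2.2.1
  -- The equation `d μ = d' η` is differentiated along `w_k`, with `μ` independent of `w`.
  -- Comparison with the coefficient of the squared gradient leaves only `d η_ww = 0`.
  have h1 := dW_congr B.isOpen_dom hb hp k
  have hz : ∀ l i, DifferentiableAt ℝ (dZ (xi X l) i) p := fun l i =>
    B.differentiableAt_of_mem (contDiffOn_dZ B.isOpen_dom (hX.contDiffOn_xi l) i) hp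
  have hzW : ∀ l i, fderiv ℝ (dZ (xi X l) i) p (eW k) = 0 := fun l i => by
    rw [← D2_eZ (B.contDiffAt_of_mem (hX.contDiffOn_xi l) hp)]
    exact (hX.projectableAt hd hp).D2_xi' _ _ _
  have hg : DifferentiableAt ℝ (fun m => 2 * dZ (xi X 1) 1 m - dZ (xi X 0) 0 m) p :=
    ((hz 1 1).const_mul 2).sub (hz 0 0)
  have hg0 : dW (fun m => 2 * dZ (xi X 1) 1 m - dZ (xi X 0) 0 m) k p = 0 := by
    rw [dW_sub ((hz 1 1).const_mul 2) (hz 0 0), dW_mul (differentiableAt_const _) (hz 1 1)]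
    simp only [dW, hzW]
    simp
  obtain ⟨h2, h3⟩ := dW_of_w (p := p) (k := k) (hd.differentiableAt (hp.2 k))
  obtain ⟨h4, h5⟩ := dW_of_w (p := p) (k := k) (hd.differentiableAt_deriv (hp.2 k))
  have h6 := B.differentiableAt_of_mem hη hp
  rw [dW_sub (h2.fun_mul hg) (h4.fun_mul h6), dW_mul h2 hg, dW_mul h4 h6, hg0, h3, h5] at h1
  have h7 : dW (fun _ => (0 : ℝ)) k p = 0 := by simp [dW]
  rw [h7] at h1
  refine (mul_eq_zero.1 (?_ : d k (p.2 k) * _ = 0)).resolve_left hpos.ne'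
  linarith

/-- The off-diagonal coefficient is constant. -/
lemma Region.IsSymmetry.exists_cross (hd : B.Admissible d) (hX : B.IsSymmetry d X) :
    ∃ C : Fin 2 → ℝ, (C = 0 ∨ ∃ κ, ∀ k, IsConstOn (d k) (B.I k) κ) ∧
      ∀ k, ∀ p ∈ B.dom, dW (eta X k) k.rev p = C k := by
  rcases hX.cross hd with ⟨κ, hκ⟩ | h
  · have key : ∀ k, ∃ c, ∀ p ∈ B.dom, dW (eta X k) k.rev p = c := by
      intro k
      have hη := hX.contDiffOn_eta k
      have hs := contDiffOn_dW B.isOpen_dom hη k.rev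
      refine B.isOpen_dom.exists_is_const_of_fderiv_eq_zero B.isPreconnected_dom
        (fun p hp => (B.differentiableAt_of_mem hs hp).differentiableWithinAt) ?_
      intro p hp
      have hpos : κ ≠ 0 := by
        rw [← hκ k _ (hp.2 k)]; exact ((hd k).2 _ (hp.2 k)).ne'
      have hdd : ∀ l, deriv (d l) (p.2 l) = 0 := fun l =>
        deriv_eq_zero_of_isConstOn (B.isOpen_I l) (hκ l) (hp.2 l)
      have hZ : ∀ m ∈ B.dom, ∀ a : Fin 3, dZ (dW (eta X k) k.rev) a.succ m = 0 := by
        intro m hm a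
        have e := (hX.determining hd hm k a).2.2.1
        rw [hκ k _ (hm.2 k)] at e
        exact (mul_eq_zero.1 e).resolve_left (mul_ne_zero (by norm_num) hpos)
      have hW1 : dW (dW (eta X k) k.rev) k p = 0 := by
        have e := (hX.determining hd hp k 0).2.2.2.2.2.2.1
        rw [hκ k _ (hp.2 k), hdd, mul_zero, zero_mul,
          sub_zero] at e
        exact (mul_eq_zero.1 e).resolve_left (mul_ne_zero (by norm_num) hpos)
      have hW2 : dW (dW (eta X k) k.rev) k.rev p = 0 := by
        have e := (hX.determining hd hp k 0).2.2.2.2.2.2.2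
        rw [hκ k _ (hp.2 k), hdd, mul_zero, zero_sub,
          neg_eq_zero] at e
        exact (mul_eq_zero.1 e).resolve_left hpos
      have swap : ∀ {F : Jet0 → ℝ}, ContDiffOn ℝ ∞ F B.dom → ∀ i, ∀ m ∈ B.dom,
          dW (dZ F i) k.rev m = dZ (dW F k.rev) i m := by
        intro F hF i m hm
        have hFm := B.contDiffAt_of_mem hF hm
        have := D2_symm hFm (eZ i) (eW k.rev)
        rw [D2_eW hFm, D2_eZ hFm] at this
        exact this.symm
      -- Differentiating the heat equation for `η^k` along the other variable shows that the cross
      -- coefficient solves the same heat equation. Its space derivatives vanish, hence so does its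
      -- time derivative.
      have hT : dZ (dW (eta X k) k.rev) 0 p = 0 := by
        rw [← swap hη 0 p hp]
        have e : ∀ m ∈ B.dom, dZ (eta X k) 0 m =
            ∑ a : Fin 3, κ * dZ (dZ (eta X k) a.succ) a.succ m := by
          intro m hm
          have e := (hX.determining hd hm k 0).1
          rw [hκ k _ (hm.2 k)] at e
          rw [← Finset.mul_sum]
          exact sub_eq_zero.1 e
        rw [dW_congr B.isOpen_dom e hp, dW]
        have hsm : ∀ a : Fin 3, ContDiffOn ℝ ∞ (dZ (eta X k) a.succ) B.dom := fun a =>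
          contDiffOn_dZ B.isOpen_dom hη _
        have hsm2 : ∀ a : Fin 3, DifferentiableAt ℝ (dZ (dZ (eta X k) a.succ) a.succ) p := fun a =>
          B.differentiableAt_of_mem (contDiffOn_dZ B.isOpen_dom (hsm a) _) hp
        rw [fderiv_fun_sum fun a _ => (hsm2 a).const_mul κ, sum_apply]
        refine Finset.sum_eq_zero fun a _ => ?_
        rw [fderiv_const_mul (hsm2 a), smul_apply]
        have : dW (dZ (dZ (eta X k) a.succ) a.succ) k.rev p = 0 := by
          rw [swap (hsm a) _ p hp, dZ_congr B.isOpen_dom (G := fun _ => 0) (fun m hm => by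
            rw [swap hη _ m hm, hZ m hm]) hp]
          simp [dZ]
        rw [dW] at this
        rw [this, smul_zero]
      refine ContinuousLinearMap.ext fun v => ?_
      have hv : v = (∑ i, v.1 i • eZ i) + (v.2 k • eW k + v.2 k.rev • eW k.rev) := by
        rw [← vert_eq (rev_ne k)]
        ext i
        · simp [Fin.sum_univ_four]
          fin_cases i <;> simp
        · simp [Prod.snd_sum]
      have hZ' : ∀ i, fderiv ℝ (dW (eta X k) k.rev) p (eZ i) = 0 := by
        intro i
        induction i using Fin.cases with
        | zero => exact hT
        | succ a => exact hZ p hp a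
      have hWk : fderiv ℝ (dW (eta X k) k.rev) p (eW k) = 0 := hW1
      have hWl : fderiv ℝ (dW (eta X k) k.rev) p (eW k.rev) = 0 := hW2
      rw [hv]
      simp only [map_add, map_sum, map_smul, hZ', hWk, hWl]
      simp
    choose C hC using key
    exact ⟨C, Or.inr ⟨κ, hκ⟩, hC⟩
  · exact ⟨0, Or.inl rfl, fun k p hp => h k p hp⟩

end necessity

section

variable {B : Region} {d : Fin 2 → ℝ → ℝ} {X : Operator}

lemma Region.exists_point (B : Region) : ∃ w : Dep, ∀ k, w k ∈ B.I k := by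
  choose w hw using fun k => (B.isConnected_I k).nonempty
  exact ⟨w, hw⟩

/-- The intervals and their product are connected, so the coefficients with vanishing
`w`-derivatives equal their values at a frozen `w₀`. This applies to `ξ`, to the derivative of `η^k`
along `w_k`, and to what is left of `η^k` after its linear part is removed. -/
theorem Region.IsSymmetry.exists_data (hd : B.Admissible d) (hX : B.IsSymmetry d X) :
    ∃ ξ A b C, DetEqs B d ξ A b C ∧ ∀ m ∈ B.dom, X m = dataOp ξ A b C m := by
  obtain ⟨w₀, hw₀⟩ := B.exists_point
  obtain ⟨C, hC, hCη⟩ := hX.exists_cross hd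
  have hξ := hX.contDiffOn_xi
  have hη := hX.contDiffOn_eta
  have hηk := fun k => contDiffOn_dW B.isOpen_dom (hη k) k
  let G : Fin 2 → Jet0 → ℝ := fun k m => eta X k m - (dW (eta X k) k m * m.2 k + C k * m.2 k.rev)
  have hw : ∀ k, ContDiffOn ℝ ∞ (fun m : Jet0 => m.2 k) B.dom := fun k =>
    (coordW k).contDiff.contDiffOn
  have hG : ∀ k, ContDiffOn ℝ ∞ (G k) B.dom := fun k =>
    (hη k).sub (((hηk k).mul (hw k)).add (contDiffOn_const.mul (hw k.rev)))
  have hrev : ∀ k l : Fin 2, l ≠ k → l = k.rev := by decide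
  have hηkW : ∀ k, ∀ m ∈ B.dom, ∀ l, dW (dW (eta X k) k) l m = 0 := by
    intro k m hm l
    rcases eq_or_ne l k with rfl | hl
    · exact hX.dW_dW hd _ hm
    · rw [hrev k l hl]
      have hηm := B.contDiffAt_of_mem (hη k) hm
      have := D2_symm hηm (eW k.rev) (eW k)
      rw [D2_eW hηm, D2_eW hηm] at this
      have h2 := dW_congr B.isOpen_dom (G := fun _ => C k) (hCη k) hm k
      change dW (dW (eta X k) k) k.rev m = dW (dW (eta X k) k.rev) k m at this
      rw [this, h2]
      simp [dW]
  have hGW : ∀ k, ∀ m ∈ B.dom, ∀ l, dW (G k) l m = 0 := by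
    intro k m hm l
    have D := fun {F : Jet0 → ℝ} (h : ContDiffOn ℝ ∞ F B.dom) => B.differentiableAt_of_mem h hm
    have h1 : HasFDerivAt (G k) _ m := (D (hη k)).hasFDerivAt.fun_sub
      (((D (hηk k)).hasFDerivAt.fun_mul (coordW k).hasFDerivAt).fun_add
        ((coordW k.rev).hasFDerivAt.const_mul (C k)))
    have h2 : fderiv ℝ (dW (eta X k) k) m (eW l) = 0 := hηkW k m hm l
    rw [dW, h1.fderiv]
    rcases eq_or_ne l k with rfl | hl
    · simp [h2, rev_ne l, dW]
    · rw [hrev k l hl] at h2 ⊢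
      have h3 : fderiv ℝ (eta X k) m (eW k.rev) = C k := hCη k m hm
      simp [h2, (rev_ne k).symm, h3]
  let ξ : Fin 4 → Indep → ℝ := fun l z => xi X l (z, w₀)
  let A : Fin 2 → Indep → ℝ := fun k z => dW (eta X k) k (z, w₀)
  let b : Fin 2 → Indep → ℝ := fun k z => G k (z, w₀)
  have eξ : ∀ l, ∀ m ∈ B.dom, xi X l m = ξ l m.1 := fun l m hm =>
    eq_of_dW_eq_zero (hξ l) (fun q hq k => (hX.projectableAt hd hq).dW_xi l k) hm.1 hm.2 hw₀
  have eA : ∀ k, ∀ m ∈ B.dom, dW (eta X k) k m = A k m.1 := fun k m hm =>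
    eq_of_dW_eq_zero (hηk k) (hηkW k) hm.1 hm.2 hw₀
  have eG : ∀ k, ∀ m ∈ B.dom, G k m = b k m.1 := fun k m hm =>
    eq_of_dW_eq_zero (hG k) (hGW k) hm.1 hm.2 hw₀
  have eη : ∀ k, ∀ m ∈ B.dom, eta X k m = lin k (A k) (C k) (b k) m := by
    intro k m hm
    rw [lin, ← eA k m hm, ← eG k m hm]
    simp only [G]; ring
  have sξ : ∀ l, ContDiffOn ℝ ∞ (ξ l) B.Ω := fun l => contDiffOn_slice (hξ l) hw₀
  have sA : ∀ k, ContDiffOn ℝ ∞ (A k) B.Ω := fun k => contDiffOn_slice (hηk k) hw₀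
  have sb : ∀ k, ContDiffOn ℝ ∞ (b k) B.Ω := fun k => contDiffOn_slice (hG k) hw₀
  have s0 : ContDiffOn ℝ ∞ (0 : Indep → ℝ) B.Ω := contDiffOn_const
  have hU : ∀ {F G : Jet0 → ℝ}, (∀ m ∈ B.dom, F m = G m) → ∀ i, ∀ m ∈ B.dom,
      dZ F i m = dZ G i m := fun h i m hm => dZ_congr B.isOpen_dom h hm i
  have dξ : ∀ l i, ∀ m ∈ B.dom, dZ (xi X l) i m = pd i (ξ l) m.1 := by
    intro l i m hm
    have e : ∀ m ∈ B.dom, xi X l m = lin 0 0 0 (ξ l) m := fun m hm => by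
      rw [eξ l m hm]; simp [lin]
    rw [hU e i m hm, dZ_lin s0 (sξ l) i hm]
    simp [lin, pd]
  have ddξ : ∀ l i j, ∀ m ∈ B.dom, dZ (dZ (xi X l) i) j m = pd j (pd i (ξ l)) m.1 := by
    intro l i j m hm
    have e : ∀ m ∈ B.dom, dZ (xi X l) i m = lin 0 0 0 (pd i (ξ l)) m := fun m hm => by
      rw [dξ l i m hm]; simp [lin]
    rw [hU e j m hm, dZ_lin s0 (contDiffOn_pd B.isOpen_Ω (sξ l) i) j hm]
    simp [lin, pd]
  have dη : ∀ k i, ∀ m ∈ B.dom, dZ (eta X k) i m = lin k (pd i (A k)) 0 (pd i (b k)) m := by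
    intro k i m hm
    rw [hU (eη k) i m hm, dZ_lin (sA k) (sb k) i hm]
  have ddη : ∀ k i j, ∀ m ∈ B.dom, dZ (dZ (eta X k) i) j m =
      lin k (pd j (pd i (A k))) 0 (pd j (pd i (b k))) m := by
    intro k i j m hm
    rw [hU (dη k i) j m hm, dZ_lin (contDiffOn_pd B.isOpen_Ω (sA k) i)
      (contDiffOn_pd B.isOpen_Ω (sb k) i) j hm]
  have dηA : ∀ k i, ∀ m ∈ B.dom, dZ (dW (eta X k) k) i m = pd i (A k) m.1 := by
    intro k i m hm
    have e : ∀ m ∈ B.dom, dW (eta X k) k m = lin 0 0 0 (A k) m := fun m hm => by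
      rw [eA k m hm]; simp [lin]
    rw [hU e i m hm, dZ_lin s0 (sA k) i hm]
    simp [lin, pd]
  -- a point of the domain over `z` with a prescribed `k`-th dependent variable
  have pt : ∀ z ∈ B.Ω, ∀ k, ∀ w ∈ B.I k, ∃ m ∈ B.dom, m.1 = z ∧ m.2 k = w := by
    intro z hz k w hw
    refine ⟨(z, Function.update w₀ k w), ⟨hz, fun l => ?_⟩, rfl, by simp⟩
    rcases eq_or_ne l k with rfl | hl
    · simpa using hw
    · simpa [hl] using hw₀ l
  -- Either there is no cross term or `d' = 0`. In both cases the cross term drops out of the scale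
  -- equation.
  have hcd : C = 0 ∨ ∀ k, ∀ w ∈ B.I k, deriv (d k) w = 0 := hC.imp id fun ⟨κ, hκ⟩ k w hw =>
    deriv_eq_zero_of_isConstOn (B.isOpen_I k) (hκ k) hw
  refine ⟨ξ, A, b, C, ⟨sξ, sA, sb, hC, ?_, ?_, ?_, ?_, ?_⟩, fun m hm => ?_⟩
  · intro z hz a
    have hm : (z, w₀) ∈ B.dom := ⟨hz, hw₀⟩
    rw [← dξ 0 a.succ _ hm]; exact (hX.projectableAt hd hm).dZ_xi0 a
  · intro z hz a b hab
    have hm : (z, w₀) ∈ B.dom := ⟨hz, hw₀⟩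
    have := (hX.projectableAt hd hm).skew a b hab
    rwa [dξ _ _ _ hm, dξ _ _ _ hm] at this
  · intro z hz k w hw a
    obtain ⟨m, hm, rfl, rfl⟩ := pt z hz k w hw
    have h1 := (hX.determining hd hm k 0).2.2.2.1
    have h2 := (hX.projectableAt hd hm).diag 0 a
    simp only [Fin.succ_zero_eq_one] at h2
    rw [h2, dξ _ _ _ hm, dξ _ _ _ hm, eη k m hm, lin] at h1
    have h3 : deriv (d k) (m.2 k) * (C k * m.2 k.rev) = 0 := by
      rcases hcd with h | h
      · simp [h]
      · simp [h k _ hw]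
    linarith
  · intro z hz k w hw a
    obtain ⟨m, hm, rfl, rfl⟩ := pt z hz k w hw
    have h1 := (hX.determining hd hm k a).2.1
    simp only [dξ _ _ _ hm, ddξ _ _ _ _ hm, dη _ _ _ hm, dηA _ _ _ hm, lin] at h1
    linarith
  · intro z hz k w hw
    obtain ⟨m, hm, rfl, rfl⟩ := pt z hz k w hw
    have h1 := (hX.determining hd hm k 0).1
    simp only [ddη _ _ _ _ hm, dη _ _ _ hm, lin] at h1
    simp only [zero_mul, add_zero] at h1
    linarith
  · ext l
    · exact eξ l m hm
    · exact eη l m hm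

/-! ### Conversely, solutions of the determining system are symmetries. -/

lemma dataOp_xi (ξ : Fin 4 → Indep → ℝ) (A b : Fin 2 → Indep → ℝ) (C : Fin 2 → ℝ) (l : Fin 4)
    (k : Fin 2) : xi (dataOp ξ A b C) l = lin k 0 0 (ξ l) := by
  ext m; simp [xi, dataOp, lin]

theorem DetEqs.isSymmetry (hd : B.Admissible d) {ξ : Fin 4 → Indep → ℝ}
    {A b : Fin 2 → Indep → ℝ} {C : Fin 2 → ℝ} (h : DetEqs B d ξ A b C) :
    B.IsSymmetry d (dataOp ξ A b C) := by
  have sX : ContDiffOn ℝ ∞ (dataOp ξ A b C) B.dom := by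
    refine ContDiffOn.prodMk (contDiffOn_pi.2 fun l => ?_) (contDiffOn_pi.2 fun k =>
      contDiffOn_lin (h.smooth_A k) (h.smooth_b k))
    exact (h.smooth_xi l).comp contDiff_fst.contDiffOn fun m hm => hm.1
  rw [isSymmetry_iff hd B.isOpen_dom]
  refine ⟨sX, fun k p hp P S hS hP => ?_⟩
  set X := dataOp ξ A b C with hXdef
  have sη : ContDiffOn ℝ ∞ (eta X k) B.dom := contDiffOn_pi.1 sX.snd k
  have sξ : ∀ l, ContDiffOn ℝ ∞ (xi X l) B.dom := fun l => contDiffOn_pi.1 sX.fst l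
  have eη : eta X k = lin k (A k) (C k) (b k) := rfl
  have hU : ∀ {F G : Jet0 → ℝ}, (∀ m ∈ B.dom, F m = G m) → ∀ i, ∀ m ∈ B.dom,
      dZ F i m = dZ G i m := fun h i m hm => dZ_congr B.isOpen_dom h hm i
  have hV : ∀ {F G : Jet0 → ℝ}, (∀ m ∈ B.dom, F m = G m) → ∀ i, ∀ m ∈ B.dom,
      dW F i m = dW G i m := fun h i m hm => dW_congr B.isOpen_dom h hm i
  have s0 : ContDiffOn ℝ ∞ (0 : Indep → ℝ) B.Ω := contDiffOn_const
  have dξ : ∀ l i, ∀ m ∈ B.dom, dZ (xi X l) i m = lin k 0 0 (pd i (ξ l)) m := by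
    intro l i m hm
    rw [hXdef, dataOp_xi ξ A b C l k, dZ_lin s0 (h.smooth_xi l) i hm]
    simp [lin, pd]
  have ddξ : ∀ l i j, dZ (dZ (xi X l) i) j p = pd j (pd i (ξ l)) p.1 := by
    intro l i j
    rw [hU (dξ l i) j p hp, dZ_lin s0 (contDiffOn_pd B.isOpen_Ω (h.smooth_xi l) i) j hp]
    simp [lin, pd]
  have wξ : ∀ l j, ∀ m ∈ B.dom, dW (xi X l) j m = 0 := by
    intro l j m hm
    rw [hXdef, dataOp_xi ξ A b C l j, dW_lin s0 (h.smooth_xi l) hm]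
    simp [lin]
  have dη : ∀ i, ∀ m ∈ B.dom, dZ (eta X k) i m = lin k (pd i (A k)) 0 (pd i (b k)) m := by
    intro i m hm
    rw [eη, dZ_lin (h.smooth_A k) (h.smooth_b k) i hm]
  have wη : ∀ m ∈ B.dom, dW (eta X k) k m = lin k 0 0 (A k) m := by
    intro m hm
    rw [eη, dW_lin (h.smooth_A k) (h.smooth_b k) hm]
  have wη' : ∀ m ∈ B.dom, dW (eta X k) k.rev m = lin k 0 0 (fun _ => C k) m := by
    intro m hm
    rw [eη, dW_lin' (h.smooth_A k) (h.smooth_b k) hm]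
  have ddη : ∀ i j, dZ (dZ (eta X k) i) j p = lin k (pd j (pd i (A k))) 0 (pd j (pd i (b k))) p := by
    intro i j
    rw [hU (dη i) j p hp, dZ_lin (contDiffOn_pd B.isOpen_Ω (h.smooth_A k) i)
      (contDiffOn_pd B.isOpen_Ω (h.smooth_b k) i) j hp]
  have zwη : ∀ i, dZ (dW (eta X k) k) i p = pd i (A k) p.1 := by
    intro i
    rw [hU wη i p hp, dZ_lin s0 (h.smooth_A k) i hp]
    simp [lin, pd]
  have zwη' : ∀ i, dZ (dW (eta X k) k.rev) i p = 0 := by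
    intro i
    rw [hU wη' i p hp, dZ_lin s0 contDiffOn_const i hp]
    simp [lin, pd]
  have wwη : dW (dW (eta X k) k) k p = 0 := by
    rw [hV wη k p hp, dW_lin s0 (h.smooth_A k) hp]
    simp [lin]
  have wwη' : ∀ j, dW (dW (eta X k) k.rev) j p = 0 := by
    intro j
    have : (fun _ => C k : Jet0 → ℝ) = lin j 0 0 (fun _ => C k) := by
      ext; simp [lin]
    rw [hV (G := fun _ => C k) (fun m hm => by rw [wη' m hm]; simp [lin]) j p hp, this,
      dW_lin s0 contDiffOn_const hp]
    simp [lin]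
  have hpos := (hd k).2 _ (hp.2 k)
  -- The left side of the scale equation does not involve the space index, and `d > 0` can be
  -- cancelled.
  have hdiag : ∀ a c : Fin 3, pd a.succ (ξ a.succ) p.1 = pd c.succ (ξ c.succ) p.1 := by
    intro a c
    have h1 := h.scale p.1 hp.1 k _ (hp.2 k) a
    have h2 := h.scale p.1 hp.1 k _ (hp.2 k) c
    have := mul_left_cancel₀ hpos.ne' (h1.symm.trans h2)
    linarith
  have hproj : ProjectableAt X p := by
    have D2W : ∀ l v m, D2 (xi X l) p v (eW m) = 0 := fun l v m => by
      rw [D2_eW (B.contDiffAt_of_mem (sξ l) hp), fderiv_eq_zero_of_eqOn B.isOpen_dom (wξ l m) hp]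
      rfl
    refine ⟨fun l m => wξ l m p hp, D2W, fun l v m => ?_, fun a => ?_, fun a => ?_, ?_, ?_⟩
    · rw [D2_symm (B.contDiffAt_of_mem (sξ l) hp), D2W]
    · rw [dξ _ _ _ hp]; simpa [lin] using h.time p.1 hp.1 a
    · rw [D2_eZ (B.contDiffAt_of_mem (sξ 0) hp), fderiv_eq_zero_of_eqOn B.isOpen_dom _ hp]
      · rfl
      · intro m hm
        rw [dξ _ _ _ hm]; simpa [lin] using h.time m.1 hm.1 a
    · intro a c hac
      rw [dξ _ _ _ hp, dξ _ _ _ hp]; simpa [lin] using h.skew p.1 hp.1 a c hac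
    · intro a c
      rw [dξ _ _ _ hp, dξ _ _ _ hp]; simpa [lin] using hdiag a c
  have hηp := B.contDiffAt_of_mem sη hp
  rw [defect_eq hproj (rev_ne k) (fun _ _ => D2_symm hηp _ _) hS hP]
  have hwk : (p.2 k) ∈ B.I k := hp.2 k
  have hc : C k = 0 ∨ ∃ κ, ∀ k, IsConstOn (d k) (B.I k) κ := h.cross.imp (fun e => by rw [e]; rfl) id
  have c1 : C k * (d k.rev (p.2 k.rev) - d k (p.2 k)) = 0 := by
    rcases hc with e | ⟨κ, hκ⟩
    · simp [e]
    · simp [hκ k _ (hp.2 k), hκ k.rev _ (hp.2 k.rev)]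
  have c2 : ∀ l, C k * deriv (d l) (p.2 l) = 0 := by
    intro l
    rcases hc with e | ⟨κ, hκ⟩
    · simp [e]
    · simp [deriv_eq_zero_of_isConstOn (B.isOpen_I l) (hκ l) (hp.2 l)]
  have c3 : C k * deriv (deriv (d k)) (p.2 k) = 0 := by
    rcases hc with e | ⟨κ, hκ⟩
    · simp [e]
    · rw [deriv_eq_zero_of_isConstOn (B.isOpen_I k) (κ := 0)
        (fun w hw => deriv_eq_zero_of_isConstOn (B.isOpen_I k) (hκ k) hw) (hp.2 k), mul_zero]
  have hsc := h.scale p.1 hp.1 k _ hwk 0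
  -- The `w`-derivative of the scale equation; it supplies the coefficient of the squared gradient,
  -- which is not listed separately in `DetEqs`.
  have hsc' : deriv (deriv (d k)) (p.2 k) * (A k p.1 * p.2 k + b k p.1)
      + deriv (d k) (p.2 k) * A k p.1
      = deriv (d k) (p.2 k) * (2 * pd 1 (ξ 1) p.1 - pd 0 (ξ 0) p.1) := by
    have e1 : HasDerivAt (fun w => deriv (d k) w * (A k p.1 * w + b k p.1)) _ (p.2 k) :=
      (hd.differentiableAt_deriv hwk).hasDerivAt.fun_mul
        (((hasDerivAt_id (p.2 k)).const_mul (A k p.1)).add_const (b k p.1))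
    have e2 : HasDerivAt (fun w => d k w * (2 * pd 1 (ξ 1) p.1 - pd 0 (ξ 0) p.1)) _ (p.2 k) :=
      (hd.differentiableAt hwk).hasDerivAt.mul_const _
    have e3 : (fun w => deriv (d k) w * (A k p.1 * w + b k p.1)) =ᶠ[nhds (p.2 k)]
        fun w => d k w * (2 * pd 1 (ξ 1) p.1 - pd 0 (ξ 0) p.1) := by
      filter_upwards [(B.isOpen_I k).mem_nhds hwk] with w hw using h.scale p.1 hp.1 k w hw 0
    have := e3.deriv_eq
    rw [e1.deriv, e2.deriv] at this
    simpa using this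
  have hdr := h.drift p.1 hp.1 k _ hwk
  have hht := h.heat p.1 hp.1 k _ hwk
  have T1 : dZ (eta X k) 0 p - d k (p.2 k) * ∑ a : Fin 3, D2 (eta X k) p (eZ a.succ) (eZ a.succ)
      = 0 := by
    simp only [D2_eZ hηp]
    change _ - _ * (∑ a : Fin 3, dZ (dZ (eta X k) a.succ) a.succ p) = 0
    simp only [ddη, dη _ _ hp, lin, zero_mul, add_zero]
    linarith
  have T2 : ∀ a : Fin 3, -dZ (xi X a.succ) 0 p
          - 2 * d k (p.2 k) * D2 (eta X k) p (eZ a.succ) (eW k)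
          + d k (p.2 k) * (∑ b : Fin 3, D2 (xi X a.succ) p (eZ b.succ) (eZ b.succ))
          - 2 * deriv (d k) (p.2 k) * dZ (eta X k) a.succ p = 0 := by
    intro a
    have e : ∀ c : Fin 3, D2 (xi X a.succ) p (eZ c.succ) (eZ c.succ) =
        pd c.succ (pd c.succ (ξ a.succ)) p.1 := fun c => by
      rw [D2_eZ (B.contDiffAt_of_mem (sξ _) hp)]; exact ddξ _ _ _
    have e' : D2 (eta X k) p (eZ a.succ) (eW k) = pd a.succ (A k) p.1 := by
      rw [D2_eW hηp]; exact zwη _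
    simp only [e, e', dη _ _ hp, dξ _ _ _ hp, lin]
    have := hdr a
    simp only [Pi.zero_apply, zero_mul, zero_add, add_zero]
    linarith
  have T3 : ∀ a : Fin 3, -2 * d k (p.2 k) * D2 (eta X k) p (eZ a.succ) (eW k.rev) = 0 := by
    intro a
    rw [D2_eW hηp]
    change _ * dZ (dW (eta X k) k.rev) a.succ p = 0
    rw [zwη', mul_zero]
  have T4 : d k (p.2 k) * (2 * dZ (xi X 1) 1 p - dZ (xi X 0) 0 p)
          - deriv (d k) (p.2 k) * eta X k p = 0 := by
    rw [dξ _ _ _ hp, dξ _ _ _ hp, eη]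
    simp only [lin, Pi.zero_apply, zero_mul, zero_add, add_zero]
    simp only [Fin.succ_zero_eq_one] at hsc
    linear_combination -hsc - p.2 k.rev * c2 k
  have T5 : dW (eta X k) k.rev p * (d k.rev (p.2 k.rev) - d k (p.2 k)) = 0 := by
    rw [wη' p hp]; simpa [lin] using c1
  have T6 : (dW (eta X k) k p - dZ (xi X 0) 0 p) * deriv (d k) (p.2 k)
          - d k (p.2 k) * D2 (eta X k) p (eW k) (eW k) - deriv (deriv (d k)) (p.2 k) * eta X k p
          - 2 * deriv (d k) (p.2 k) * dW (eta X k) k p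
          + 2 * deriv (d k) (p.2 k) * dZ (xi X 1) 1 p = 0 := by
    have e : D2 (eta X k) p (eW k) (eW k) = 0 := by rw [D2_eW hηp]; exact wwη
    rw [e, dξ _ _ _ hp, dξ _ _ _ hp, wη p hp, eη]
    simp only [lin, Pi.zero_apply, zero_mul, zero_add, add_zero]
    linear_combination -hsc' - p.2 k.rev * c3
  have T7 : -2 * d k (p.2 k) * D2 (eta X k) p (eW k) (eW k.rev)
          - 2 * deriv (d k) (p.2 k) * dW (eta X k) k.rev p = 0 := by
    have e : D2 (eta X k) p (eW k) (eW k.rev) = 0 := by rw [D2_eW hηp]; exact wwη' k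
    rw [e, wη' p hp]
    simp only [lin, Pi.zero_apply, zero_mul, zero_add, add_zero]
    linear_combination -2 * c2 k
  have T8 : dW (eta X k) k.rev p * deriv (d k.rev) (p.2 k.rev)
          - d k (p.2 k) * D2 (eta X k) p (eW k.rev) (eW k.rev) = 0 := by
    have e : D2 (eta X k) p (eW k.rev) (eW k.rev) = 0 := by rw [D2_eW hηp]; exact wwη' k.rev
    rw [e, wη' p hp]
    simp only [lin, Pi.zero_apply, zero_mul, zero_add, add_zero]
    linear_combination c2 k.rev
  rw [T1, T4, T5, T6, T7, T8]
  simp only [T2, T3]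
  simp

/-- Reduces all questions about the algebra to the solutions of `DetEqs`; jets do not occur after
this point. -/
theorem mem_mai_iff (hd : B.Admissible d) {X : B.dom → Jet0} : X ∈ B.mai d ↔
    ∃ ξ A b C, DetEqs B d ξ A b C ∧ ∀ m : B.dom, X m = dataOp ξ A b C m := by
  constructor
  · rintro ⟨Y, hY, rfl⟩
    obtain ⟨ξ, A, b, C, h, hYm⟩ := hY.exists_data hd
    exact ⟨ξ, A, b, C, h, fun m => hYm m m.2⟩
  · rintro ⟨ξ, A, b, C, h, hX⟩
    exact ⟨dataOp ξ A b C, h.isSymmetry hd, funext hX⟩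

end

/-! ### Calculus in `(t, x)` and linearity of the determining system. -/

lemma pd_const (i : Fin 4) (c : ℝ) : pd i (fun _ => c) = fun _ => 0 := by
  ext z; simp [pd]

lemma pd_coord (i j : Fin 4) : pd i (fun z => z j) = fun _ => (Pi.single i 1 : Indep) j := by
  ext z
  have : HasFDerivAt (fun z : Indep => z j)
      (ContinuousLinearMap.proj (R := ℝ) (φ := fun _ : Fin 4 => ℝ) j) z :=
    (ContinuousLinearMap.proj (R := ℝ) (φ := fun _ : Fin 4 => ℝ) j).hasFDerivAt
  rw [pd, this.fderiv]
  rfl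

lemma pd_add (i : Fin 4) {f g : Indep → ℝ} (hf : Differentiable ℝ f) (hg : Differentiable ℝ g) :
    pd i (fun z => f z + g z) = fun z => pd i f z + pd i g z := by
  ext z
  rw [pd, fderiv_fun_add (hf z) (hg z)]; rfl

lemma pd_sub (i : Fin 4) {f g : Indep → ℝ} (hf : Differentiable ℝ f) (hg : Differentiable ℝ g) :
    pd i (fun z => f z - g z) = fun z => pd i f z - pd i g z := by
  ext z
  rw [pd, fderiv_fun_sub (hf z) (hg z)]; rfl

lemma pd_mul (i : Fin 4) {f g : Indep → ℝ} (hf : Differentiable ℝ f) (hg : Differentiable ℝ g) :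
    pd i (fun z => f z * g z) = fun z => f z * pd i g z + pd i f z * g z := by
  ext z
  rw [pd, fderiv_fun_mul (hf z) (hg z)]
  simp [pd, mul_comm]

lemma pd_sq (i : Fin 4) {f : Indep → ℝ} (hf : Differentiable ℝ f) :
    pd i (fun z => f z ^ 2) = fun z => 2 * f z * pd i f z := by
  simp only [sq]
  rw [pd_mul i hf hf]
  ext z; ring

section

variable {B : Region} {d : Fin 2 → ℝ → ℝ}

lemma pd_comm {f : Indep → ℝ} (hf : ContDiffOn ℝ ∞ f B.Ω) {z : Indep} (hz : z ∈ B.Ω)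
    (i j : Fin 4) : pd i (pd j f) z = pd j (pd i f) z := by
  have hfz := hf.contDiffAt (B.isOpen_Ω.mem_nhds hz)
  have h1 : DifferentiableAt ℝ (fderiv ℝ f) z :=
    (hfz.fderiv_right (m := 1) (by norm_cast)).differentiableAt (by simp)
  have key : ∀ i j, pd i (pd j f) z =
      fderiv ℝ (fderiv ℝ f) z (Pi.single i 1) (Pi.single j 1) := by
    intro i j
    have : pd i (pd j f) z = fderiv ℝ (fun z => fderiv ℝ f z (Pi.single j 1)) z
      (Pi.single i 1) := rfl
    rw [this, fderiv_clm_apply h1 (differentiableAt_const _)]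
    simp
  rw [key, key]
  refine (hfz.isSymmSndFDerivAt ?_).eq _ _
  rw [minSmoothness_of_isRCLikeNormedField, ← one_add_one_eq_two]; norm_cast

lemma pd_linear {f g h : Indep → ℝ} (hf : ContDiffOn ℝ ∞ f B.Ω) (hg : ContDiffOn ℝ ∞ g B.Ω)
    {c e : ℝ} (hh : ∀ z ∈ B.Ω, h z = c * f z + e * g z) {z : Indep} (hz : z ∈ B.Ω) (i : Fin 4) :
    pd i h z = c * pd i f z + e * pd i g z := by
  have h1 : ContDiffOn ℝ ∞ (fun z => e * g z) B.Ω := contDiffOn_const.mul hg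
  rw [pd_affine B.isOpen_Ω (h := h) (c := c) (e := 0) hf h1
    (fun y hy => by rw [hh y hy, add_zero]) hz i,
    pd_affine B.isOpen_Ω (h := fun z => e * g z) (c := e) (e := 0) hg (contDiffOn_const (c := 0))
    (fun y hy => by simp) hz i, pd_const, add_zero]

lemma pd_pd_linear {f g h : Indep → ℝ} (hf : ContDiffOn ℝ ∞ f B.Ω) (hg : ContDiffOn ℝ ∞ g B.Ω)
    {c e : ℝ} (hh : ∀ z ∈ B.Ω, h z = c * f z + e * g z) {z : Indep} (hz : z ∈ B.Ω) (i j : Fin 4) :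
    pd j (pd i h) z = c * pd j (pd i f) z + e * pd j (pd i g) z :=
  pd_linear (contDiffOn_pd B.isOpen_Ω hf i) (contDiffOn_pd B.isOpen_Ω hg i)
    (fun _ hy => pd_linear hf hg hh hy i) hz j

lemma DetEqs.smul_add {ξ ξ' : Fin 4 → Indep → ℝ} {A b A' b' : Fin 2 → Indep → ℝ}
    {C C' : Fin 2 → ℝ} (h : DetEqs B d ξ A b C) (h' : DetEqs B d ξ' A' b' C') (c : ℝ) :
    DetEqs B d (fun l z => c * ξ l z + 1 * ξ' l z) (fun k z => c * A k z + 1 * A' k z)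
      (fun k z => c * b k z + 1 * b' k z) (c • C + C') := by
  have p1 : ∀ l i, ∀ z ∈ B.Ω, pd i (fun z => c * ξ l z + 1 * ξ' l z) z =
      c * pd i (ξ l) z + 1 * pd i (ξ' l) z := fun l i z hz =>
    pd_linear (h.smooth_xi l) (h'.smooth_xi l) (fun _ _ => rfl) hz i
  have p2 : ∀ l i j, ∀ z ∈ B.Ω, pd j (pd i (fun z => c * ξ l z + 1 * ξ' l z)) z =
      c * pd j (pd i (ξ l)) z + 1 * pd j (pd i (ξ' l)) z := fun l i j z hz =>
    pd_pd_linear (h.smooth_xi l) (h'.smooth_xi l) (fun _ _ => rfl) hz i j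
  have q1 : ∀ l i, ∀ z ∈ B.Ω, pd i (fun z => c * A l z + 1 * A' l z) z =
      c * pd i (A l) z + 1 * pd i (A' l) z := fun l i z hz =>
    pd_linear (h.smooth_A l) (h'.smooth_A l) (fun _ _ => rfl) hz i
  have q2 : ∀ l i j, ∀ z ∈ B.Ω, pd j (pd i (fun z => c * A l z + 1 * A' l z)) z =
      c * pd j (pd i (A l)) z + 1 * pd j (pd i (A' l)) z := fun l i j z hz =>
    pd_pd_linear (h.smooth_A l) (h'.smooth_A l) (fun _ _ => rfl) hz i j
  have r1 : ∀ l i, ∀ z ∈ B.Ω, pd i (fun z => c * b l z + 1 * b' l z) z =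
      c * pd i (b l) z + 1 * pd i (b' l) z := fun l i z hz =>
    pd_linear (h.smooth_b l) (h'.smooth_b l) (fun _ _ => rfl) hz i
  have r2 : ∀ l i j, ∀ z ∈ B.Ω, pd j (pd i (fun z => c * b l z + 1 * b' l z)) z =
      c * pd j (pd i (b l)) z + 1 * pd j (pd i (b' l)) z := fun l i j z hz =>
    pd_pd_linear (h.smooth_b l) (h'.smooth_b l) (fun _ _ => rfl) hz i j
  refine ⟨fun l => (contDiffOn_const.mul (h.smooth_xi l)).add
      (contDiffOn_const.mul (h'.smooth_xi l)), fun l => (contDiffOn_const.mul (h.smooth_A l)).add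
      (contDiffOn_const.mul (h'.smooth_A l)), fun l => (contDiffOn_const.mul (h.smooth_b l)).add
      (contDiffOn_const.mul (h'.smooth_b l)), ?_, ?_, ?_, ?_, ?_, ?_⟩
  · rcases h.cross with e | e
    · rcases h'.cross with e' | e'
      · left; rw [e, e']; simp
      · exact Or.inr e'
    · exact Or.inr e
  · intro z hz a
    rw [p1 _ _ z hz, h.time z hz, h'.time z hz]; ring
  · intro z hz a a' ha
    rw [p1 _ _ z hz, p1 _ _ z hz]
    linear_combination c * h.skew z hz a a' ha + h'.skew z hz a a' ha
  · intro z hz k w hw a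
    rw [p1 _ _ z hz, p1 _ _ z hz]
    linear_combination c * h.scale z hz k w hw a + h'.scale z hz k w hw a
  · intro z hz k w hw a
    simp only [p1 _ _ z hz, p2 _ _ _ z hz, q1 _ _ z hz, r1 _ _ z hz, Fin.sum_univ_three]
    have e1 := h.drift z hz k w hw a
    have e2 := h'.drift z hz k w hw a
    simp only [Fin.sum_univ_three] at e1 e2
    linear_combination c * e1 + e2
  · intro z hz k w hw
    simp only [q1 _ _ z hz, q2 _ _ _ z hz, r1 _ _ z hz, r2 _ _ _ z hz, Fin.sum_univ_three]
    have e1 := h.heat z hz k w hw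
    have e2 := h'.heat z hz k w hw
    simp only [Fin.sum_univ_three] at e1 e2
    linear_combination c * e1 + e2

lemma DetEqs.zero : DetEqs B d (fun _ _ => 0) (fun _ _ => 0) (fun _ _ => 0) 0 := by
  constructor <;> simp [contDiffOn_const, pd_const]

/-- The determining equations are linear, and the alternative to `C = 0` concerns the diffusivities
only. Hence it is enough to check generators. -/
lemma span_subset_mai (hd : B.Admissible d) {S : Set Operator}
    (hS : ∀ X ∈ S, ∃ ξ A b C, DetEqs B d ξ A b C ∧ ∀ m ∈ B.dom, X m = dataOp ξ A b C m) :
    (Submodule.span ℝ (B.dom.domRestrict '' S) : Set (B.dom → Jet0)) ⊆ B.mai d := by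
  have key : ∀ X ∈ B.mai d, ∀ Y ∈ B.mai d, ∀ c : ℝ, c • X + Y ∈ B.mai d := by
    intro X hX Y hY c
    rw [mem_mai_iff hd] at *
    obtain ⟨ξ, A, b, C, h, e⟩ := hX
    obtain ⟨ξ', A', b', C', h', e'⟩ := hY
    refine ⟨_, _, _, _, h.smul_add h' c, fun m => ?_⟩
    rw [Pi.add_apply, Pi.smul_apply, e, e']
    ext l
    · simp [dataOp]
    · simp [dataOp, lin]; ring
  have h0 : (0 : B.dom → Jet0) ∈ B.mai d := by
    rw [mem_mai_iff hd]
    refine ⟨_, _, _, _, DetEqs.zero, fun m => ?_⟩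
    ext l <;> simp [dataOp, lin]
  intro X hX
  induction hX using Submodule.span_induction with
  | mem x hx =>
    obtain ⟨Y, hY, rfl⟩ := hx
    rw [mem_mai_iff hd]
    obtain ⟨ξ, A, b, C, h, e⟩ := hS Y hY
    exact ⟨ξ, A, b, C, h, fun m => e m m.2⟩
  | zero => exact h0
  | add x y _ _ hx hy => simpa using key x hx y hy 1
  | smul c x _ hx => simpa using key x hx 0 h0 c

lemma eq_add_const {f g : Indep → ℝ} (hf : ContDiffOn ℝ ∞ f B.Ω) (hg : Differentiable ℝ g)
    (h : ∀ z ∈ B.Ω, ∀ i, pd i f z = pd i g z) : ∃ c, ∀ z ∈ B.Ω, f z = g z + c := by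
  obtain ⟨c, hc⟩ := B.isOpen_Ω.exists_eq_add_of_fderiv_eq (𝕜 := ℝ) (f := f) (g := g)
    B.isConnected_Ω.isPreconnected (hf.differentiableOn (by simp)) hg.differentiableOn (by
      intro z hz
      refine ContinuousLinearMap.ext fun v => ?_
      have hv : v = ∑ i, v i • (Pi.single i 1 : Indep) := by
        ext j; simp [Finset.sum_apply, Pi.single_apply]
      rw [hv]
      simp only [map_sum, map_smul]
      exact Finset.sum_congr rfl fun i _ => by rw [← pd, h z hz i, pd])
  exact ⟨c, fun z hz => hc hz⟩

/-! ### Conformal Killing fields in three dimensions. -/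

/-- The Kronecker symbol. -/
def kr (a b : Fin 3) : ℝ := if a = b then 1 else 0

/-- The spatial components of `ξ` satisfy the conformal Killing equations. -/
structure Conformal (B : Region) (ξ : Fin 4 → Indep → ℝ) : Prop where
  smooth : ∀ l, ContDiffOn ℝ ∞ (ξ l) B.Ω
  skew : ∀ z ∈ B.Ω, ∀ a b : Fin 3, a ≠ b → pd a.succ (ξ b.succ) z + pd b.succ (ξ a.succ) z = 0
  diag : ∀ z ∈ B.Ω, ∀ a : Fin 3, pd a.succ (ξ a.succ) z = pd 1 (ξ 1) z

variable {ξ : Fin 4 → Indep → ℝ}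

lemma Conformal.pd_symm (h : Conformal B ξ) {z : Indep} (hz : z ∈ B.Ω) (i : Fin 4) (a b : Fin 3) :
    pd i (pd a.succ (ξ b.succ)) z + pd i (pd b.succ (ξ a.succ)) z
      = 2 * pd i (pd 1 (ξ 1)) z * kr a b := by
  have hp := fun l j => contDiffOn_pd B.isOpen_Ω (h.smooth l) j
  rcases eq_or_ne a b with rfl | hab
  · have := pd_linear (hp 1 1) (hp 1 1) (c := 1) (e := 0) (h := pd a.succ (ξ a.succ))
      (fun y hy => by rw [h.diag y hy a]; ring) hz i
    rw [this, kr, if_pos rfl]; ring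
  · have := pd_linear (hp a.succ b.succ) (hp a.succ b.succ) (c := -1) (e := 0)
      (h := pd a.succ (ξ b.succ)) (fun y hy => by linarith [h.skew y hy a b hab]) hz i
    rw [this, kr, if_neg hab]; ring

/-- The permutation argument for Christoffel symbols: the differentiated Killing equation, taken for
the three cyclic arrangements of `a, b, c` and combined with symmetry of second derivatives, can be
solved for each second derivative of `ξ`. -/
lemma Conformal.second (h : Conformal B ξ) {z : Indep} (hz : z ∈ B.Ω) (a b c : Fin 3) :
    pd c.succ (pd a.succ (ξ b.succ)) z = pd c.succ (pd 1 (ξ 1)) z * kr a b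
      + pd a.succ (pd 1 (ξ 1)) z * kr c b - pd b.succ (pd 1 (ξ 1)) z * kr c a := by
  have hd := fun i a b => h.pd_symm hz i a b
  have k1 : kr b c = kr c b := by simp [kr, eq_comm]
  have k2 : kr b a = kr a b := by simp [kr, eq_comm]
  have k3 : kr a c = kr c a := by simp [kr, eq_comm]
  have h1 := hd c.succ a b
  have h2 := hd b.succ c a
  have h3 := hd a.succ b c
  have s1 := pd_comm (h.smooth a.succ) hz b.succ c.succ
  have s2 := pd_comm (h.smooth c.succ) hz b.succ a.succ
  have s3 := pd_comm (h.smooth b.succ) hz c.succ a.succ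
  rw [k1] at h3
  linarith

lemma Conformal.third (h : Conformal B ξ) {z : Indep} (hz : z ∈ B.Ω) (a b c e : Fin 3) :
    pd e.succ (pd c.succ (pd a.succ (ξ b.succ))) z
      = pd e.succ (pd c.succ (pd 1 (ξ 1))) z * kr a b
      + pd e.succ (pd a.succ (pd 1 (ξ 1))) z * kr c b
      - pd e.succ (pd b.succ (pd 1 (ξ 1))) z * kr c a := by
  have hp := fun l j => contDiffOn_pd B.isOpen_Ω (h.smooth l) j
  have hL := fun c : Fin 3 => contDiffOn_pd B.isOpen_Ω (hp 1 1) c.succ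
  have sm : ContDiffOn ℝ ∞ (fun z => kr a b * pd c.succ (pd 1 (ξ 1)) z
      + kr c b * pd a.succ (pd 1 (ξ 1)) z) B.Ω :=
    (contDiffOn_const.mul (hL c)).add (contDiffOn_const.mul (hL a))
  rw [pd_linear sm (hL b) (c := 1) (e := -kr c a) (fun y hy => by
    rw [h.second hy a b c]; ring) hz e.succ,
    pd_linear (hL c) (hL a) (fun y _ => rfl) hz e.succ]
  ring

/-- The third derivatives of `ξ`, expressed through the Hessian of `λ`, must be symmetric in the
last two differentiations. This is Liouville's rigidity, and it needs three dimensions. -/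
lemma Conformal.factor (h : Conformal B ξ) {z : Indep} (hz : z ∈ B.Ω) (a c : Fin 3) :
    pd c.succ (pd a.succ (pd 1 (ξ 1))) z = 0 := by
  have hp := fun l j => contDiffOn_pd B.isOpen_Ω (h.smooth l) j
  have key : ∀ a b c e : Fin 3, _ := fun a b c e =>
    (h.third hz a b c e).symm.trans
      ((pd_comm (hp b.succ a.succ) hz e.succ c.succ).trans
        (h.third hz a b e c))
  -- A third index `b`, distinct from `a` and `e`, makes one side equal to `λ_ea` and the other
  -- equal to zero.
  have off : ∀ a b e : Fin 3, a ≠ b → e ≠ a → e ≠ b →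
      pd e.succ (pd a.succ (pd 1 (ξ 1))) z = 0 := by
    intro a b e h1 h2 h3
    have := key a b b e
    simp only [kr, if_pos, if_neg h1, if_neg h1.symm, if_neg h2, if_neg h3] at this
    linarith
  -- The diagonal Hessian entries are pairwise opposite; for three of them this forces all to
  -- vanish.
  have dia : ∀ a b : Fin 3, a ≠ b → pd a.succ (pd a.succ (pd 1 (ξ 1))) z =
      -pd b.succ (pd b.succ (pd 1 (ξ 1))) z := by
    intro a b h1
    have := key a b b a
    simp only [kr, if_pos, if_neg h1, if_neg h1.symm] at this
    linarith
  have d01 := dia 0 1 (by decide)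
  have d02 := dia 0 2 (by decide)
  have d12 := dia 1 2 (by decide)
  rcases eq_or_ne a c with rfl | hac
  · fin_cases a
    · simp only [Fin.zero_eta] at *; linarith
    · simp only [Fin.mk_one] at *; linarith
    · simp only [Fin.reduceFinMk] at *; linarith
  · obtain ⟨b, hb1, hb2⟩ : ∃ b : Fin 3, a ≠ b ∧ c ≠ b := by
      revert a c; decide
    exact off a b c hb1 hac.symm hb2

end

section

variable {B : Region} {d : Fin 2 → ℝ → ℝ} {ξ : Fin 4 → Indep → ℝ}

lemma eq_const {f : Indep → ℝ} (hf : ContDiffOn ℝ ∞ f B.Ω)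
    (h : ∀ z ∈ B.Ω, ∀ i, pd i f z = 0) : ∃ c, ∀ z ∈ B.Ω, f z = c := by
  obtain ⟨c, hc⟩ := eq_add_const hf (g := fun _ => 0) (differentiable_const _) (fun z hz i => by
    rw [h z hz i, pd_const])
  exact ⟨c, fun z hz => by rw [hc z hz, zero_add]⟩

lemma pd_eq_zero_of_eqOn {f : Indep → ℝ} {c : ℝ} (h : ∀ z ∈ B.Ω, f z = c) {z : Indep}
    (hz : z ∈ B.Ω) (i : Fin 4) : pd i f z = 0 := by
  rw [pd_congr B.isOpen_Ω h hz, pd_const]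

lemma pd_of_eqOn_mul {f g : Indep → ℝ} {c : ℝ} (hf : ContDiffOn ℝ ∞ f B.Ω)
    (h : ∀ z ∈ B.Ω, g z = c * f z) {z : Indep} (hz : z ∈ B.Ω) (i : Fin 4) :
    pd i g z = c * pd i f z := by
  rw [pd_linear hf hf (c := c) (e := 0) (fun y hy => by rw [h y hy]; ring) hz]; ring

/-- Once the time derivatives are governed by the constant `p₂`, the gradient of `λ` is a constant
vector `c`. Repeated integration on the connected `Ω` (`eq_add_const`) then yields polynomials: `c`
parametrises the special conformal part, `ℓ` dilation, `r` rotations, `g` Galilean boosts and `p₂`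
the projective part. -/
theorem Conformal.integrate (h : Conformal B ξ)
    (time : ∀ z ∈ B.Ω, ∀ a : Fin 3, pd a.succ (ξ 0) z = 0) {p₂ : ℝ}
    (h00 : ∀ z ∈ B.Ω, pd 0 (pd 0 (ξ 0)) z = 2 * p₂)
    (h0b : ∀ z ∈ B.Ω, ∀ a b : Fin 3, pd b.succ (pd 0 (ξ a.succ)) z = p₂ * kr a b)
    (hat : ∀ z ∈ B.Ω, ∀ a : Fin 3, pd 0 (pd 0 (ξ a.succ)) z = 0) :
    ∃ (p₀ p₁ ℓ : ℝ) (T c g : Fin 3 → ℝ) (r : Fin 3 → Fin 3 → ℝ), (∀ a b, r a b = -r b a) ∧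
      ∀ z ∈ B.Ω, ξ 0 z = p₀ + p₁ * z 0 + p₂ * z 0 ^ 2 ∧ pd 0 (ξ 0) z = p₁ + 2 * p₂ * z 0 ∧
      (∀ a : Fin 3, pd a.succ (pd 1 (ξ 1)) z = c a) ∧
      pd 1 (ξ 1) z = c 0 * z 1 + c 1 * z 2 + c 2 * z 3 + ℓ + p₂ * z 0 ∧
      (∀ a : Fin 3, pd 0 (ξ a.succ) z = p₂ * z a.succ + g a) ∧
      (∀ a : Fin 3, ξ a.succ z = T a + g a * z 0 + (r a 0 * z 1 + r a 1 * z 2 + r a 2 * z 3)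
        + ℓ * z a.succ + p₂ * z 0 * z a.succ + (c 0 * z 1 + c 1 * z 2 + c 2 * z 3) * z a.succ
        - 1 / 2 * c a * (z 1 ^ 2 + z 2 ^ 2 + z 3 ^ 2)) := by
  have hs := h.smooth
  have hp := fun l j => contDiffOn_pd B.isOpen_Ω (h.smooth l) j
  have hpp := fun l j i => contDiffOn_pd B.isOpen_Ω (hp l j) i
  have hsingle : ∀ a b : Fin 3, (Pi.single a.succ 1 : Indep) b.succ = kr a b := by
    intro a b; simp [Pi.single_apply, kr, eq_comm]
  have hkr : ∀ a b : Fin 3, kr a b = kr b a := fun a b => by simp [kr, eq_comm]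
  -- the time component
  obtain ⟨p₁, hp₁⟩ := eq_add_const (hp 0 0) (g := fun z => 2 * p₂ * z 0) (by fun_prop) (by
    intro z hz i
    simp (disch := fun_prop) only [pd_mul, pd_const, pd_coord]
    induction i using Fin.cases with
    | zero => rw [h00 z hz]; simp
    | succ a =>
      rw [pd_comm (hs 0) hz, pd_eq_zero_of_eqOn (fun y hy => time y hy a) hz]
      simp)
  obtain ⟨p₀, hp₀⟩ := eq_add_const (hs 0) (g := fun z => p₁ * z 0 + p₂ * z 0 ^ 2) (by fun_prop) (by
    intro z hz i
    simp (disch := fun_prop) only [pd_mul, pd_const, pd_coord, pd_add, pd_sq]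
    induction i using Fin.cases with
    | zero => rw [hp₁ z hz]; simp; ring
    | succ a => rw [time z hz]; simp)
  -- the conformal factor
  have key : ∀ a : Fin 3, ∃ c, ∀ z ∈ B.Ω, pd a.succ (pd 1 (ξ 1)) z = c := fun a =>
    eq_const (hpp 1 1 a.succ) (by
      intro z hz i
      induction i using Fin.cases with
      | zero =>
        rw [pd_comm (hp 1 1) hz, pd_eq_zero_of_eqOn (c := p₂) _ hz]
        intro y hy
        rw [pd_comm (hs 1) hy]
        simpa [kr] using h0b y hy 0 0
      | succ b => exact h.factor hz a b)
  choose c hc using key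
  -- the first derivatives of the spatial components
  have key2 : ∀ a b : Fin 3, ∃ m, ∀ z ∈ B.Ω, pd b.succ (ξ a.succ) z =
      (c 0 * z 1 + c 1 * z 2 + c 2 * z 3) * kr a b + c b * z a.succ - c a * z b.succ
        + p₂ * kr a b * z 0 + m := fun a b =>
    eq_add_const (hp a.succ b.succ) (g := fun z =>
      (c 0 * z 1 + c 1 * z 2 + c 2 * z 3) * kr a b + c b * z a.succ - c a * z b.succ
        + p₂ * kr a b * z 0) (by fun_prop) (by
      intro z hz i
      simp (disch := fun_prop) only [pd_mul, pd_const, pd_coord, pd_add, pd_sub]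
      induction i using Fin.cases with
      | zero =>
        rw [pd_comm (hs a.succ) hz, h0b z hz]
        simp
      | succ e =>
        rw [h.second hz, hc _ z hz, hc _ z hz, hc _ z hz, hsingle, hsingle, hkr b a]
        have : c 0 * (Pi.single e.succ 1 : Indep) 1 + c 1 * (Pi.single e.succ 1 : Indep) 2
            + c 2 * (Pi.single e.succ 1 : Indep) 3 = c e := by
          fin_cases e <;> simp
        simp only [Pi.single_apply, zero_mul, add_zero] at this ⊢
        rw [this]; simp [(Fin.succ_ne_zero e).symm])
  choose m hm using key2
  have key3 : ∀ a : Fin 3, ∃ g, ∀ z ∈ B.Ω, pd 0 (ξ a.succ) z = p₂ * z a.succ + g := fun a =>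
    eq_add_const (hp a.succ 0) (g := fun z => p₂ * z a.succ) (by fun_prop) (by
      intro z hz i
      simp (disch := fun_prop) only [pd_mul, pd_const, pd_coord]
      induction i using Fin.cases with
      | zero => rw [hat z hz]; simp
      | succ b => rw [h0b z hz, hsingle, hkr]; ring)
  choose g hg using key3
  have key4 : ∀ a : Fin 3, ∃ T, ∀ z ∈ B.Ω, ξ a.succ z =
      g a * z 0 + (m a 0 * z 1 + m a 1 * z 2 + m a 2 * z 3)
        + p₂ * z 0 * z a.succ + (c 0 * z 1 + c 1 * z 2 + c 2 * z 3) * z a.succ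
        - 1 / 2 * c a * (z 1 ^ 2 + z 2 ^ 2 + z 3 ^ 2) + T := fun a =>
    eq_add_const (hs a.succ) (g := fun z => g a * z 0 + (m a 0 * z 1 + m a 1 * z 2 + m a 2 * z 3)
        + p₂ * z 0 * z a.succ + (c 0 * z 1 + c 1 * z 2 + c 2 * z 3) * z a.succ
        - 1 / 2 * c a * (z 1 ^ 2 + z 2 ^ 2 + z 3 ^ 2)) (by fun_prop) (by
      intro z hz i
      simp (disch := fun_prop) only [pd_mul, pd_const, pd_coord, pd_add, pd_sub, pd_sq]
      induction i using Fin.cases with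
      | zero => rw [hg a z hz]; simp; ring
      | succ b =>
        rw [hm a b z hz, hsingle, hkr b a]
        fin_cases b <;> simp <;> ring)
  choose T hT using key4
  obtain ⟨z₁, hz₁⟩ := B.isConnected_Ω.nonempty
  have hkk : ∀ a : Fin 3, kr a a = 1 := fun a => by simp [kr]
  have hdiag : ∀ a, m a a = m 0 0 := by
    intro a
    have h1 := h.diag z₁ hz₁ a
    have h2 := hm 0 0 z₁ hz₁
    simp only [Fin.succ_zero_eq_one] at h2
    rw [hm a a z₁ hz₁, h2, hkk, hkk] at h1
    linarith
  have hskew : ∀ a b : Fin 3, a ≠ b → m a b = -m b a := by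
    intro a b hab
    have h1 := h.skew z₁ hz₁ a b hab
    have e : kr a b = 0 := by simp [kr, hab]
    rw [hm a b z₁ hz₁, hm b a z₁ hz₁, hkr b a, e] at h1
    linarith
  -- The integration constants `m` form a conformal matrix. Its common diagonal entry becomes `ℓ`,
  -- and the rest is skew.
  refine ⟨p₀, p₁, m 0 0, T, c, g, fun a b => m a b - m 0 0 * kr a b, ?_, fun z hz =>
    ⟨?_, ?_, fun a => hc a z hz, ?_, fun a => hg a z hz, fun a => ?_⟩⟩
  · intro a b
    beta_reduce
    rcases eq_or_ne a b with rfl | hab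
    · rw [hkk, hdiag]; ring
    · rw [hskew a b hab, hkr b a]
      have e : kr a b = 0 := by simp [kr, hab]
      rw [e]; ring
  · rw [hp₀ z hz]; ring
  · rw [hp₁ z hz]; ring
  · have := hm 0 0 z hz
    simp only [Fin.succ_zero_eq_one] at this
    rw [this, hkk]; ring
  · rw [hT a z hz]
    fin_cases a <;> simp [kr] <;> ring

end

/-! ### The operators of the table solve the determining system. -/

/-- An operator which agrees on the domain with one given by a solution of the determining
equations. -/
def HasData (B : Region) (d : Fin 2 → ℝ → ℝ) (X : Operator) : Prop :=
  ∃ ξ A b C, DetEqs B d ξ A b C ∧ ∀ m ∈ B.dom, X m = dataOp ξ A b C m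

section

variable {B : Region} {d : Fin 2 → ℝ → ℝ}

lemma single_succ (a b : Fin 3) : (Pi.single a.succ 1 : Indep) b.succ = kr a b := by
  simp [Pi.single_apply, kr, eq_comm]

/-- The Kronecker symbol for the dependent variables. -/
def kr2 (j k : Fin 2) : ℝ := if j = k then 1 else 0

lemma hasData_mk {X : Operator} (τ : Indep → ℝ) (σ : Fin 3 → Indep → ℝ) (A b : Fin 2 → Indep → ℝ)
    (C : Fin 2 → ℝ) (hX : ∀ m, X m = coeffs (τ m.1) (fun a => σ a m.1)
      (fun k => A k m.1 * m.2 k + C k * m.2 k.rev + b k m.1))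
    (sτ : ContDiff ℝ ∞ τ) (sσ : ∀ a, ContDiff ℝ ∞ (σ a)) (sA : ∀ k, ContDiff ℝ ∞ (A k))
    (sb : ∀ k, ContDiffOn ℝ ∞ (b k) B.Ω)
    (cross : C = 0 ∨ ∃ κ, ∀ k, IsConstOn (d k) (B.I k) κ)
    (time : ∀ z, ∀ a : Fin 3, pd a.succ τ z = 0)
    (skew : ∀ z, ∀ a b : Fin 3, a ≠ b → pd a.succ (σ b) z + pd b.succ (σ a) z = 0)
    (scale : ∀ z ∈ B.Ω, ∀ k, ∀ w ∈ B.I k, ∀ a : Fin 3, deriv (d k) w * (A k z * w + b k z) =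
      d k w * (2 * pd a.succ (σ a) z - pd 0 τ z))
    (drift : ∀ z ∈ B.Ω, ∀ k, ∀ w ∈ B.I k, ∀ a : Fin 3, -pd 0 (σ a) z
      - 2 * d k w * pd a.succ (A k) z + d k w * (∑ b : Fin 3, pd b.succ (pd b.succ (σ a)) z)
      - 2 * deriv (d k) w * (pd a.succ (A k) z * w + pd a.succ (b k) z) = 0)
    (heat : ∀ z ∈ B.Ω, ∀ k, ∀ w ∈ B.I k, pd 0 (A k) z * w + pd 0 (b k) z =
      d k w * ∑ a : Fin 3, (pd a.succ (pd a.succ (A k)) z * w + pd a.succ (pd a.succ (b k)) z)) :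
    HasData B d X := by
  refine ⟨Fin.cons τ σ, A, b, C, ⟨fun l => ?_, fun k => (sA k).contDiffOn, sb, cross,
    fun z _ a => time z a, fun z _ a b hab => skew z a b hab, scale, drift, heat⟩, fun m _ => ?_⟩
  · induction l using Fin.cases with
    | zero => exact sτ.contDiffOn
    | succ a => exact (sσ a).contDiffOn
  · rw [hX]
    ext l
    · induction l using Fin.cases <;> rfl
    · rfl

/-- Operators without `η`. -/
lemma hasData_of_eta_zero {X : Operator} (τ : Indep → ℝ) (σ : Fin 3 → Indep → ℝ)
    (hX : ∀ m, X m = coeffs (τ m.1) (fun a => σ a m.1) 0)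
    (sτ : ContDiff ℝ ∞ τ) (sσ : ∀ a, ContDiff ℝ ∞ (σ a))
    (time : ∀ z, ∀ a : Fin 3, pd a.succ τ z = 0)
    (skew : ∀ z, ∀ a b : Fin 3, a ≠ b → pd a.succ (σ b) z + pd b.succ (σ a) z = 0)
    (scale : ∀ z, ∀ a : Fin 3, 2 * pd a.succ (σ a) z = pd 0 τ z)
    (drift : ∀ z, ∀ a : Fin 3, pd 0 (σ a) z = 0)
    (lap : ∀ z, ∀ a : Fin 3, ∑ b : Fin 3, pd b.succ (pd b.succ (σ a)) z = 0) :
    HasData B d X := by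
  refine hasData_mk τ σ (fun _ _ => 0) (fun _ _ => 0) 0 (fun m => ?_) sτ sσ
    (fun k => contDiff_const) (fun k => contDiffOn_const) (Or.inl rfl) time skew ?_ ?_ ?_
  · rw [hX]; congr; ext; simp
  · intro z _ k w _ a
    rw [scale z a]; ring
  · intro z _ k w _ a
    simp [pd_const, drift z a, lap z a]
  · intro z _ k w _
    simp [pd_const]

/-- Operators without `ξ`. -/
lemma hasData_of_xi_zero {X : Operator} (A b : Fin 2 → Indep → ℝ)
    (C : Fin 2 → ℝ) (hX : ∀ m, X m = coeffs 0 0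
      (fun k => A k m.1 * m.2 k + C k * m.2 k.rev + b k m.1))
    (sA : ∀ k, ContDiff ℝ ∞ (A k)) (sb : ∀ k, ContDiffOn ℝ ∞ (b k) B.Ω)
    (cross : C = 0 ∨ ∃ κ, ∀ k, IsConstOn (d k) (B.I k) κ)
    (scale : ∀ z ∈ B.Ω, ∀ k, ∀ w ∈ B.I k, deriv (d k) w * (A k z * w + b k z) = 0)
    (drift : ∀ z ∈ B.Ω, ∀ k, ∀ w ∈ B.I k, ∀ a : Fin 3,
      d k w * pd a.succ (A k) z + deriv (d k) w * (pd a.succ (A k) z * w + pd a.succ (b k) z) = 0)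
    (heat : ∀ z ∈ B.Ω, ∀ k, ∀ w ∈ B.I k, pd 0 (A k) z * w + pd 0 (b k) z =
      d k w * ∑ a : Fin 3, (pd a.succ (pd a.succ (A k)) z * w + pd a.succ (pd a.succ (b k)) z)) :
    HasData B d X := by
  refine hasData_mk (fun _ => 0) (fun _ _ => 0) A b C (fun m => ?_) contDiff_const
    (fun _ => contDiff_const) sA sb cross ?_ ?_ ?_ ?_ heat
  · rw [hX]; rfl
  · simp [pd_const]
  · simp [pd_const]
  · intro z hz k w hw a
    rw [scale z hz k w hw]; simp [pd_const]
  · intro z hz k w hw a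
    simp only [pd_const]
    have := drift z hz k w hw a
    simp only [Finset.sum_const_zero]
    linarith

lemma hasData_gensAE {X : Operator} (hX : X ∈ gensAE) : HasData B d X := by
  rcases hX with ((hX | ⟨a, rfl⟩) | ⟨a, b, hab, rfl⟩) | hX
  · rw [Set.mem_singleton_iff] at hX
    subst hX
    refine hasData_of_eta_zero (fun _ => 1) (fun _ _ => 0) (fun m => rfl) ?_ ?_ ?_ ?_ ?_ ?_ ?_ <;>
    simp [pd_const, contDiff_const]
  · refine hasData_of_eta_zero (fun _ => 0) (fun c _ => (Pi.single a 1 : Fin 3 → ℝ) c)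
      (fun m => rfl) ?_ ?_ ?_ ?_ ?_ ?_ ?_ <;>
    simp [pd_const, contDiff_const]
  · refine hasData_of_eta_zero (fun _ => 0) (fun c z => z a.succ * kr c b - z b.succ * kr c a)
      (fun m => ?_) ?_ ?_ ?_ ?_ ?_ ?_ ?_
    · refine congrArg (fun σ => coeffs 0 σ 0) ?_
      ext c
      simp [Pi.single_apply, kr, sp]
    · fun_prop
    · intro c; fun_prop
    · simp [pd_const]
    · intro z c e hce
      simp (disch := fun_prop) only [pd_mul, pd_const, pd_coord, pd_sub, single_succ]
      ring
    · intro z c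
      simp (disch := fun_prop) only [pd_mul, pd_const, pd_coord, pd_sub, single_succ]
      ring
    · intro z c
      simp (disch := fun_prop) only [pd_mul, pd_const, pd_coord, pd_sub]
      simp
    · intro z c
      simp (disch := fun_prop) only [pd_mul, pd_const, pd_coord, pd_sub]
      simp [pd_const]
  · rw [Set.mem_singleton_iff] at hX
    subst hX
    refine hasData_of_eta_zero (fun z => 2 * z 0) (fun a z => z a.succ)
      (fun m => rfl) ?_ ?_ ?_ ?_ ?_ ?_ ?_
    · fun_prop
    · intro c; fun_prop
    · intro z c
      simp (disch := fun_prop) only [pd_mul, pd_const, pd_coord]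
      simp
    · intro z c e hce
      simp only [pd_coord, single_succ, kr, if_neg hce, if_neg hce.symm]
      simp
    · intro z c
      simp (disch := fun_prop) only [pd_mul, pd_const, pd_coord]
      simp
    · simp [pd_coord]
    · simp [pd_coord, pd_const]

/-- The scaling operator for diffusivities with `d' (a w + b) = d`. -/
lemma hasData_opD (a b : Fin 2 → ℝ)
    (hd : ∀ k, ∀ w ∈ B.I k, deriv (d k) w * (a k * w + b k) = d k w) :
    HasData B d (opD (fun p => 2 * (a 0 * p.2 0 + b 0)) (fun p => 2 * (a 1 * p.2 1 + b 1))) := by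
  refine hasData_mk (fun _ => 0) (fun a z => z a.succ) (fun k _ => 2 * a k) (fun k _ => 2 * b k) 0
    (fun m => ?_) contDiff_const (fun a => ?_) (fun _ => contDiff_const) (fun _ => contDiffOn_const)
    (Or.inl rfl) ?_ ?_ ?_ ?_ ?_
  · rw [opD]
    congr
    ext k
    fin_cases k <;> simp <;> ring
  · fun_prop
  · simp [pd_const]
  · intro z c e hce
    simp only [pd_coord, single_succ, kr, if_neg hce, if_neg hce.symm]
    simp
  · intro z _ k w hw c
    simp only [pd_coord, single_succ, kr, pd_const, if_true]
    linear_combination 2 * hd k w hw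
  · intro z _ k w hw c
    simp [pd_coord, pd_const]
  · simp [pd_const]

/-- The special conformal operators for diffusivities proportional to `w ^ (-4/5)`. -/
lemma hasData_opK (e : Fin 3)
    (hd : ∀ k, ∀ w ∈ B.I k, deriv (d k) w * (-(5 / 4) * w) = d k w) : HasData B d (opK e) := by
  refine hasData_mk (fun _ => 0)
    (fun a z => kr a e * (z 1 ^ 2 + z 2 ^ 2 + z 3 ^ 2) - 2 * z e.succ * z a.succ)
    (fun k z => 5 * z e.succ) (fun k _ => 0) 0
    (fun m => ?_) contDiff_const (fun a => ?_) (fun _ => ?_) (fun _ => contDiffOn_const)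
    (Or.inl rfl) ?_ ?_ ?_ ?_ ?_
  · rw [opK]
    congr
    · ext a
      simp [Pi.single_apply, kr, sp, spSq, Fin.sum_univ_three]
    · ext k; simp [sp]
  · fun_prop
  · fun_prop
  · simp [pd_const]
  · intro z c a hca
    simp (disch := fun_prop) only [pd_mul, pd_const, pd_coord, pd_sub, pd_add, pd_sq]
    fin_cases e <;> fin_cases c <;> fin_cases a <;> simp [kr] at hca ⊢
  · intro z _ k w hw c
    simp (disch := fun_prop) only [pd_mul, pd_const, pd_coord, pd_sub, pd_add, pd_sq]
    have := hd k w hw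
    fin_cases e <;> fin_cases c <;> simp [kr]
    all_goals first
      | linear_combination (-4 * z 1) * this
      | linear_combination (-4 * z 2) * this
      | linear_combination (-4 * z 3) * this
  · intro z _ k w hw c
    simp (disch := fun_prop) only [pd_mul, pd_const, pd_coord, pd_sub, pd_add, pd_sq,
      Fin.sum_univ_three]
    have := hd k w hw
    fin_cases e <;> fin_cases c <;> simp [kr]
    all_goals linarith
  · intro z _ k w hw
    simp (disch := fun_prop) only [pd_mul, pd_const, pd_coord]
    simp [pd_const]

/-- Multiples of a dependent variable with constant diffusivity. -/
lemma hasData_opW_self {k : Fin 2} {κ : ℝ} (hκ : IsConstOn (d k) (B.I k) κ) :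
    HasData B d (opW k (fun m => m.2 k)) := by
  have h0 := fun {w} hw => deriv_eq_zero_of_isConstOn (B.isOpen_I k) hκ (w := w) hw
  refine hasData_of_xi_zero (fun j _ => kr2 j k) (fun _ _ => 0) 0 (fun m => ?_)
    (fun _ => contDiff_const) (fun _ => contDiffOn_const) (Or.inl rfl) ?_ ?_ ?_
  · refine congrArg (coeffs 0 0) ?_
    ext j
    rcases eq_or_ne j k with rfl | hj
    · simp [kr2]
    · simp [kr2, hj]
  · intro z _ j w hw
    rcases eq_or_ne j k with rfl | hj
    · rw [h0 hw, zero_mul]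
    · simp [kr2, hj]
  · simp [pd_const]
  · simp [pd_const]

/-- The operators `f ∂_{w_k}`, where `f` solves the linear heat equation. -/
lemma hasData_opW_heat {k : Fin 2} {κ : ℝ} (hκ : IsConstOn (d k) (B.I k) κ) {f : Indep → ℝ}
    (hf : f ∈ heatSolutions B.Ω κ) : HasData B d (opW k (fun m => f m.1)) := by
  have h0 := fun {w} hw => deriv_eq_zero_of_isConstOn (B.isOpen_I k) hκ (w := w) hw
  have hs : ∀ j, (Pi.single k f : Fin 2 → Indep → ℝ) j = if j = k then f else fun _ => 0 := by
    intro j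
    simp only [Pi.single_apply]
    rfl
  refine hasData_of_xi_zero (fun _ _ => 0) (Pi.single k f) 0 (fun m => ?_)
    (fun _ => contDiff_const) (fun j => ?_) (Or.inl rfl) ?_ ?_ ?_
  · refine congrArg (coeffs 0 0) ?_
    ext j
    rw [hs]
    rcases eq_or_ne j k with rfl | hj
    · simp
    · simp [hj]
  · rw [hs]; split_ifs
    · exact hf.1
    · exact contDiffOn_const
  · intro z _ j w hw
    rw [hs]
    rcases eq_or_ne j k with rfl | hj
    · rw [h0 hw, zero_mul]
    · simp [hj]
  · intro z _ j w hw a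
    rw [hs]
    rcases eq_or_ne j k with rfl | hj
    · rw [h0 hw]; simp [pd_const]
    · simp [hj, pd_const]
  · intro z hz j w hw
    rw [hs]
    rcases eq_or_ne j k with rfl | hj
    · simp [pd_const, hf.2 z hz, hκ w hw]
    · simp [hj, pd_const]

/-- The operators mixing the two dependent variables. -/
lemma hasData_opW_rev {κ : ℝ} (hκ : ∀ k, IsConstOn (d k) (B.I k) κ) (k : Fin 2) :
    HasData B d (opW k (fun m => m.2 k.rev)) := by
  refine hasData_of_xi_zero (fun _ _ => 0) (fun _ _ => 0) (Pi.single k 1) (fun m => ?_)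
    (fun _ => contDiff_const) (fun _ => contDiffOn_const) (Or.inr ⟨κ, hκ⟩) ?_ ?_ ?_
  · refine congrArg (coeffs 0 0) ?_
    ext j
    rcases eq_or_ne j k with rfl | hj
    · simp
    · simp [hj]
  · simp
  · simp [pd_const]
  · simp [pd_const]

/-- The Galilean operators. -/
lemma hasData_opG {κ : Fin 2 → ℝ} (hκ : ∀ k, IsConstOn (d k) (B.I k) (κ k)) (h0 : ∀ k, κ k ≠ 0)
    (e : Fin 3) : HasData B d (opG κ e) := by
  have hd0 := fun k {w} hw => deriv_eq_zero_of_isConstOn (B.isOpen_I k) (hκ k) (w := w) hw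
  refine hasData_mk (fun _ => 0) (fun a z => kr a e * z 0)
    (fun k z => -(1 / (2 * κ k)) * z e.succ) (fun k _ => 0) 0
    (fun m => ?_) contDiff_const (fun a => ?_) (fun _ => ?_) (fun _ => contDiffOn_const)
    (Or.inl rfl) ?_ ?_ ?_ ?_ ?_
  · rw [opG]
    congr
    · ext a
      simp [Pi.single_apply, kr, tm]
    · ext k; simp [sp]; ring
  · fun_prop
  · fun_prop
  · simp [pd_const]
  · intro z c a hca
    simp (disch := fun_prop) only [pd_mul, pd_const, pd_coord]
    simp
  · intro z _ k w hw c
    simp (disch := fun_prop) only [pd_mul, pd_const, pd_coord]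
    simp [hd0 k hw]
  · intro z _ k w hw c
    simp (disch := fun_prop) only [pd_mul, pd_const, pd_coord, single_succ]
    rw [hd0 k hw, hκ k w hw]
    have := h0 k
    simp [pd_const]
    field_simp
    ring
  · intro z _ k w hw
    simp (disch := fun_prop) only [pd_mul, pd_const, pd_coord]
    simp [pd_const]

/-- The projective operator. -/
lemma hasData_opPi {κ : Fin 2 → ℝ} (hκ : ∀ k, IsConstOn (d k) (B.I k) (κ k)) (h0 : ∀ k, κ k ≠ 0) :
    HasData B d (opPi κ) := by
  have hd0 := fun k {w} hw => deriv_eq_zero_of_isConstOn (B.isOpen_I k) (hκ k) (w := w) hw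
  refine hasData_mk (fun z => z 0 ^ 2) (fun a z => z 0 * z a.succ)
    (fun k z => -(1 / (4 * κ k)) * (z 1 ^ 2 + z 2 ^ 2 + z 3 ^ 2 + 6 * κ k * z 0)) (fun k _ => 0) 0
    (fun m => ?_) ?_ (fun a => ?_) (fun _ => ?_) (fun _ => contDiffOn_const)
    (Or.inl rfl) ?_ ?_ ?_ ?_ ?_
  · rw [opPi]
    congr
    ext k
    simp [tm, spSq, sp, Fin.sum_univ_three]
  · fun_prop
  · fun_prop
  · fun_prop
  · intro z a
    simp (disch := fun_prop) only [pd_sq, pd_coord]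
    simp
  · intro z c a hca
    simp (disch := fun_prop) only [pd_mul, pd_coord, single_succ, kr, if_neg hca, if_neg hca.symm]
    simp
  · intro z _ k w hw c
    simp (disch := fun_prop) only [pd_mul, pd_coord, pd_sq, single_succ, kr, if_true]
    rw [hd0 k hw]
    simp
  · intro z _ k w hw c
    simp (disch := fun_prop) only [pd_mul, pd_const, pd_coord, pd_sq, pd_add, single_succ]
    rw [hd0 k hw, hκ k w hw]
    have := h0 k
    fin_cases c <;> simp <;> field_simp <;> ring
  · intro z _ k w hw
    simp (disch := fun_prop) only [pd_mul, pd_const, pd_coord, pd_sq, pd_add, Fin.sum_univ_three]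
    rw [hκ k w hw]
    have := h0 k
    simp
    field_simp
    ring

end

/-! ### Solving the system when some diffusivity is not constant. -/

section

variable {B : Region} {d : Fin 2 → ℝ → ℝ}

/-- The general element of `AE(1,3)`. -/
lemma mem_AE {X : B.dom → Jet0} (p₀ τ : ℝ) (T : Fin 3 → ℝ) (r : Fin 3 → Fin 3 → ℝ)
    (hr : ∀ a b, r a b = -r b a) (hX : ∀ m : B.dom, X m = coeffs (p₀ + 2 * τ * m.1.1 0)
      (fun a => T a + (r a 0 * m.1.1 1 + r a 1 * m.1.1 2 + r a 2 * m.1.1 3) + τ * m.1.1 a.succ)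
      0) : X ∈ B.AE := by
  have hmem : ∀ Y ∈ gensAE, B.dom.domRestrict Y ∈ B.AE := fun Y hY =>
    Submodule.subset_span ⟨Y, hY, rfl⟩
  have hT := hmem opT (Or.inl (Or.inl (Or.inl rfl)))
  have hP := fun a => hmem (opP a) (Or.inl (Or.inl (Or.inr ⟨a, rfl⟩)))
  have hJ := fun a b hab => hmem (opJ a b) (Or.inl (Or.inr ⟨a, b, hab, rfl⟩))
  have hD := hmem opD0 (Or.inr rfl)
  have e : X = p₀ • B.dom.domRestrict opT + T 0 • B.dom.domRestrict (opP 0)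
      + T 1 • B.dom.domRestrict (opP 1) + T 2 • B.dom.domRestrict (opP 2)
      + r 0 1 • B.dom.domRestrict (opJ 1 0) + r 0 2 • B.dom.domRestrict (opJ 2 0)
      + r 1 2 • B.dom.domRestrict (opJ 2 1) + τ • B.dom.domRestrict opD0 := by
    funext m
    rw [hX m]
    have h00 : r 0 0 = 0 := by linarith [hr 0 0]
    have h11 : r 1 1 = 0 := by linarith [hr 1 1]
    have h22 : r 2 2 = 0 := by linarith [hr 2 2]
    have h10 := hr 1 0
    have h20 := hr 2 0
    have h21 := hr 2 1
    ext i
    · refine Fin.cases ?_ (fun a => ?_) i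
      · simp [coeffs, opT, opP, opJ, opD0, tm]; ring
      · simp only [Pi.add_apply, Pi.smul_apply, Set.domRestrict_apply, Prod.fst_add, Prod.smul_fst,
          opT, opP, opJ, opD0, coeffs, Fin.cons_succ, smul_eq_mul, sp]
        fin_cases a <;> simp [h00, h11, h22, h10, h20, h21] <;> ring
    · simp [coeffs, opT, opP, opJ, opD0]
  rw [e]
  exact B.AE.add_mem (B.AE.add_mem (B.AE.add_mem (B.AE.add_mem (B.AE.add_mem (B.AE.add_mem
    (B.AE.add_mem (B.AE.smul_mem _ hT) (B.AE.smul_mem _ (hP 0))) (B.AE.smul_mem _ (hP 1)))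
    (B.AE.smul_mem _ (hP 2))) (B.AE.smul_mem _ (hJ 1 0 (by decide))))
    (B.AE.smul_mem _ (hJ 2 0 (by decide)))) (B.AE.smul_mem _ (hJ 2 1 (by decide))))
    (B.AE.smul_mem _ hD)

lemma affine_eq_zero {I : Set ℝ} (hI : IsOpen I) (hne : I.Nonempty) {x y : ℝ}
    (h : ∀ w ∈ I, x * w + y = 0) : x = 0 ∧ y = 0 := by
  obtain ⟨w, hw⟩ := hne
  obtain ⟨ε, hε, hb⟩ := Metric.isOpen_iff.1 hI w hw
  have h1 := h w hw
  have h2 := h (w + ε / 2) (hb (by simp [abs_of_pos hε]; linarith))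
  have hx : x = 0 := by
    have : x * (ε / 2) = 0 := by linarith
    exact (mul_eq_zero.1 this).resolve_right (by positivity)
  subst hx
  exact ⟨rfl, by linarith⟩

/-- A nonconstant `d` is linearly independent of `1`. This splits equations that contain `w` only
through `d`. -/
lemma eq_zero_of_not_const {d : ℝ → ℝ} {I : Set ℝ} (hne : I.Nonempty)
    (hd : ¬ ∃ κ, IsConstOn d I κ) {x y : ℝ} (h : ∀ w ∈ I, x + d w * y = 0) : x = 0 ∧ y = 0 := by
  obtain ⟨w, hw⟩ := hne
  obtain ⟨w', hw', hne'⟩ := exists_ne_of_not_const hd (d w)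
  have h1 := h w hw
  have h2 := h w' hw'
  have hy : y = 0 := by
    have : (d w' - d w) * y = 0 := by linarith
    exact (mul_eq_zero.1 this).resolve_left (sub_ne_zero.2 hne')
  subst hy
  exact ⟨by linarith, rfl⟩

lemma not_const_of_scale (hd : B.Admissible d) {k : Fin 2} {a b : ℝ}
    (hab : ∀ w ∈ B.I k, deriv (d k) w * (a * w + b) = d k w) :
    ¬ ∃ κ, IsConstOn (d k) (B.I k) κ := by
  rintro ⟨κ, hκ⟩
  obtain ⟨w, hw⟩ := (B.isConnected_I k).nonempty
  have := hab w hw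
  rw [deriv_eq_zero_of_isConstOn (B.isOpen_I k) hκ hw, zero_mul] at this
  exact ((hd k).2 w hw).ne this

section

variable {ξ : Fin 4 → Indep → ℝ} {A b : Fin 2 → Indep → ℝ} {C : Fin 2 → ℝ}

lemma DetEqs.conformal (hd : B.Admissible d) (h : DetEqs B d ξ A b C) : Conformal B ξ := by
  refine ⟨h.smooth_xi, h.skew, fun z hz a => ?_⟩
  obtain ⟨w, hw⟩ := (B.isConnected_I 0).nonempty
  have h1 := h.scale z hz 0 w hw a
  have h2 := h.scale z hz 0 w hw 0
  have := mul_left_cancel₀ ((hd 0).2 w hw).ne' (h1.symm.trans h2)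
  simp only [Fin.succ_zero_eq_one] at this
  linarith

/-- Tracing the formula for second derivatives gives `2λ_a - 3λ_a`; the dimension enters here. -/
lemma Conformal.laplacian (h : Conformal B ξ) {z : Indep} (hz : z ∈ B.Ω) (a : Fin 3) :
    ∑ b : Fin 3, pd b.succ (pd b.succ (ξ a.succ)) z = -pd a.succ (pd 1 (ξ 1)) z := by
  simp only [h.second hz]
  rw [Fin.sum_univ_three]
  fin_cases a <;> simp [kr]

/-- The coefficient `2 λ - ξ⁰_t`. -/
def mu (ξ : Fin 4 → Indep → ℝ) (z : Indep) : ℝ := 2 * pd 1 (ξ 1) z - pd 0 (ξ 0) z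

lemma DetEqs.pd_mu (h : DetEqs B d ξ A b C) {z : Indep} (hz : z ∈ B.Ω) (i : Fin 4) :
    pd i (mu ξ) z = 2 * pd i (pd 1 (ξ 1)) z - pd i (pd 0 (ξ 0)) z := by
  rw [pd_linear (contDiffOn_pd B.isOpen_Ω (h.smooth_xi 1) 1)
    (contDiffOn_pd B.isOpen_Ω (h.smooth_xi 0) 0) (c := 2) (e := -1)
    (fun y _ => by rw [mu]; ring) hz]
  ring

lemma DetEqs.contDiffOn_mu (h : DetEqs B d ξ A b C) : ContDiffOn ℝ ∞ (mu ξ) B.Ω :=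
  (contDiffOn_const.mul (contDiffOn_pd B.isOpen_Ω (h.smooth_xi 1) 1)).sub
    (contDiffOn_pd B.isOpen_Ω (h.smooth_xi 0) 0)

lemma DetEqs.pd_pd_time (h : DetEqs B d ξ A b C) {z : Indep} (hz : z ∈ B.Ω) (a : Fin 3) :
    pd a.succ (pd 0 (ξ 0)) z = 0 := by
  rw [pd_comm (h.smooth_xi 0) hz, pd_eq_zero_of_eqOn (fun y hy => h.time y hy a) hz]

lemma DetEqs.pd_mu_space (h : DetEqs B d ξ A b C) {z : Indep} (hz : z ∈ B.Ω) (a : Fin 3) :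
    pd a.succ (mu ξ) z = 2 * pd a.succ (pd 1 (ξ 1)) z := by
  rw [h.pd_mu hz, h.pd_pd_time hz]; ring

/-- The solutions `ξ` with time-independent spatial part and `ξ⁰_tt = 0`. -/
lemma DetEqs.static (hd : B.Admissible d) (h : DetEqs B d ξ A b C)
    (h1 : ∀ z ∈ B.Ω, ∀ a : Fin 3, pd 0 (ξ a.succ) z = 0) (h2 : ∀ z ∈ B.Ω, pd 0 (mu ξ) z = 0) :
    ∃ (p₀ p₁ ℓ : ℝ) (T c : Fin 3 → ℝ) (r : Fin 3 → Fin 3 → ℝ), (∀ a b, r a b = -r b a) ∧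
      ∀ z ∈ B.Ω, ξ 0 z = p₀ + p₁ * z 0 ∧
      mu ξ z = 2 * (c 0 * z 1 + c 1 * z 2 + c 2 * z 3 + ℓ) - p₁ ∧
      (∀ a : Fin 3, pd a.succ (pd 1 (ξ 1)) z = c a) ∧
      (∀ a : Fin 3, ξ a.succ z = T a + (r a 0 * z 1 + r a 1 * z 2 + r a 2 * z 3)
        + ℓ * z a.succ + (c 0 * z 1 + c 1 * z 2 + c 2 * z 3) * z a.succ
        - 1 / 2 * c a * (z 1 ^ 2 + z 2 ^ 2 + z 3 ^ 2)) := by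
  have hab : ∀ i, ∀ z ∈ B.Ω, ∀ a : Fin 3, pd i (pd 0 (ξ a.succ)) z = 0 := fun i z hz a =>
    pd_eq_zero_of_eqOn (fun y hy => h1 y hy a) hz i
  -- The spatial part is static, so `λ_t = 0`, and `μ_t = 0` reduces to `ξ⁰_tt = 0`.
  have h00 : ∀ z ∈ B.Ω, pd 0 (pd 0 (ξ 0)) z = 0 := by
    intro z hz
    have e1 := h.pd_mu hz 0
    have e2 := pd_comm (h.smooth_xi 1) hz 0 1
    have e3 : pd 1 (pd 0 (ξ 1)) z = 0 := hab 1 z hz 0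
    rw [h2 z hz, e2, e3] at e1
    linarith
  obtain ⟨p₀, p₁, ℓ, T, c, g, r, hr, hz⟩ := (h.conformal hd).integrate h.time (p₂ := 0)
    (by simpa using h00) (fun z hz a b => by rw [hab _ z hz, zero_mul]) (hab 0)
  refine ⟨p₀, p₁, ℓ, T, c, r, hr, fun z hzΩ => ?_⟩
  obtain ⟨e1, e2, e3, e4, e5, e6⟩ := hz z hzΩ
  refine ⟨by rw [e1]; ring, by rw [mu, e4, e2]; ring, e3, fun a => ?_⟩
  have : g a = 0 := by
    have := e5 a
    rw [h1 z hzΩ a] at this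
    linarith
  rw [e6 a, this]; ring

lemma Region.nonempty_I (B : Region) (k : Fin 2) : (B.I k).Nonempty := (B.isConnected_I k).nonempty

lemma DetEqs.scale_mu (h : DetEqs B d ξ A b C) {z : Indep} (hz : z ∈ B.Ω) {k : Fin 2} {w : ℝ}
    (hw : w ∈ B.I k) : deriv (d k) w * (A k z * w + b k z) = d k w * mu ξ z := h.scale z hz k w hw 0

/-- The symmetries when both diffusivities satisfy `d' (α w + β) = d`. -/
theorem DetEqs.scaling_form (hd : B.Admissible d) (h : DetEqs B d ξ A b C) {α β : Fin 2 → ℝ}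
    (hαβ : ∀ k, ∀ w ∈ B.I k, deriv (d k) w * (α k * w + β k) = d k w) :
    ∃ (p₀ p₁ ℓ : ℝ) (T c : Fin 3 → ℝ) (r : Fin 3 → Fin 3 → ℝ), (∀ a b, r a b = -r b a) ∧
      (∀ k a, c a * (5 + 4 * α k) = 0) ∧
      ∀ m ∈ B.dom, dataOp ξ A b C m = coeffs (p₀ + p₁ * m.1 0)
        (fun a => T a + (r a 0 * m.1 1 + r a 1 * m.1 2 + r a 2 * m.1 3)
          + ℓ * m.1 a.succ + (c 0 * m.1 1 + c 1 * m.1 2 + c 2 * m.1 3) * m.1 a.succ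
          - 1 / 2 * c a * (m.1 1 ^ 2 + m.1 2 ^ 2 + m.1 3 ^ 2))
        (fun k => (2 * (c 0 * m.1 1 + c 1 * m.1 2 + c 2 * m.1 3 + ℓ) - p₁)
          * (α k * m.2 k + β k)) := by
  have hnc := fun k => not_const_of_scale hd (hαβ k)
  have hC : C = 0 := h.cross.resolve_right fun ⟨κ, hκ⟩ => hnc 0 ⟨κ, hκ 0⟩
  have hne : ∀ k, ∀ w ∈ B.I k, deriv (d k) w ≠ 0 ∧ α k * w + β k ≠ 0 := by
    intro k w hw
    have := ((hd k).2 w hw).ne'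
    rw [← hαβ k w hw] at this
    exact mul_ne_zero_iff.1 this
  -- The scale equation minus `μ` times the hypothesis on `d` is `d'` times an affine function of
  -- `w`, and `d'` has no zero.
  have hAb : ∀ k, ∀ z ∈ B.Ω, A k z = α k * mu ξ z ∧ b k z = β k * mu ξ z := by
    intro k z hz
    have := affine_eq_zero (B.isOpen_I k) (B.nonempty_I k) (x := A k z - α k * mu ξ z)
      (y := b k z - β k * mu ξ z) (fun w hw => by
        have e := h.scale_mu hz hw
        rw [← hαβ k w hw] at e
        refine mul_left_cancel₀ (hne k w hw).1 ?_
        linear_combination e)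
    exact ⟨by linarith [this.1], by linarith [this.2]⟩
  have hμ := h.contDiffOn_mu
  have dA : ∀ k i, ∀ z ∈ B.Ω, pd i (A k) z = α k * pd i (mu ξ) z := fun k i z hz =>
    pd_of_eqOn_mul hμ (fun y hy => (hAb k y hy).1) hz i
  have db : ∀ k i, ∀ z ∈ B.Ω, pd i (b k) z = β k * pd i (mu ξ) z := fun k i z hz =>
    pd_of_eqOn_mul hμ (fun y hy => (hAb k y hy).2) hz i
  have ddA : ∀ k i j, ∀ z ∈ B.Ω, pd j (pd i (A k)) z = α k * pd j (pd i (mu ξ)) z :=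
    fun k i j z hz => pd_of_eqOn_mul (contDiffOn_pd B.isOpen_Ω hμ i) (dA k i) hz j
  have ddb : ∀ k i j, ∀ z ∈ B.Ω, pd j (pd i (b k)) z = β k * pd j (pd i (mu ξ)) z :=
    fun k i j z hz => pd_of_eqOn_mul (contDiffOn_pd B.isOpen_Ω hμ i) (db k i) hz j
  have hconf := h.conformal hd
  -- With `μ_a = 2λ_a` and `Δξ^a = -λ_a`, the drift equation reads `-ξ^a_t - (5 + 4α_k) λ_a d_k =
  -- 0`, and `1, d_k` are independent.
  have hdr : ∀ k, ∀ z ∈ B.Ω, ∀ a : Fin 3, -pd 0 (ξ a.succ) z = 0 ∧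
      -pd a.succ (pd 1 (ξ 1)) z * (5 + 4 * α k) = 0 := by
    intro k z hz a
    refine eq_zero_of_not_const (B.nonempty_I k) (hnc k) fun w hw => ?_
    have e := h.drift z hz k w hw a
    rw [dA k _ z hz, db k _ z hz, hconf.laplacian hz, h.pd_mu_space hz] at e
    linear_combination e + 4 * pd a.succ (pd 1 (ξ 1)) z * hαβ k w hw
  -- The nonzero factor `α w + β` cancels from the heat equation and leaves `μ_t = d Δμ`, again
  -- split by independence of `1` and `d`.
  have hht : ∀ z ∈ B.Ω, pd 0 (mu ξ) z = 0 := by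
    intro z hz
    refine (eq_zero_of_not_const (B.nonempty_I 0) (hnc 0)
      (y := -∑ a : Fin 3, pd a.succ (pd a.succ (mu ξ)) z) fun w hw => ?_).1
    have e := h.heat z hz 0 w hw
    simp only [dA 0 _ z hz, db 0 _ z hz, ddA 0 _ _ z hz, ddb 0 _ _ z hz, Fin.sum_univ_three] at e ⊢
    refine mul_left_cancel₀ (hne 0 w hw).2 ?_
    linear_combination e
  obtain ⟨p₀, p₁, ℓ, T, c, r, hr, hform⟩ := h.static hd
    (fun z hz a => neg_eq_zero.1 (hdr 0 z hz a).1) hht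
  obtain ⟨z₁, hz₁⟩ := B.isConnected_Ω.nonempty
  refine ⟨p₀, p₁, ℓ, T, c, r, hr, fun k a => ?_, fun m hm => ?_⟩
  · rw [← (hform z₁ hz₁).2.2.1 a]
    linarith [(hdr k z₁ hz₁ a).2]
  · obtain ⟨e0, eμ, -, es⟩ := hform m.1 hm.1
    ext i
    · refine Fin.cases ?_ (fun a => ?_) i
      · exact e0
      · exact es a
    · change A i m.1 * m.2 i + C i * m.2 i.rev + b i m.1 = _ * (α i * m.2 i + β i)
      rw [← eμ, (hAb i m.1 hm.1).1, (hAb i m.1 hm.1).2, hC]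
      simp; ring

/-- A nonconstant `d` has `d' ≠ 0` on some nonempty open set, and an affine function vanishing there
is zero. -/
lemma eq_zero_of_deriv_mul (hd : B.Admissible d) {k : Fin 2}
    (hk : ¬ ∃ κ, IsConstOn (d k) (B.I k) κ) {x y : ℝ}
    (h : ∀ w ∈ B.I k, deriv (d k) w * (x * w + y) = 0) : x = 0 ∧ y = 0 := by
  obtain ⟨w₁, hw₁, hne⟩ : ∃ w ∈ B.I k, deriv (d k) w ≠ 0 := by
    by_contra! h0
    obtain ⟨w₀, hw₀⟩ := B.nonempty_I k
    refine hk ⟨d k w₀, fun w hw => ?_⟩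
    exact (B.isOpen_I k).is_const_of_deriv_eq_zero (B.isConnected_I k).isPreconnected
      (fun s hs => (hd.differentiableAt hs).differentiableWithinAt) h0 hw hw₀
  have hU : IsOpen (B.I k ∩ deriv (d k) ⁻¹' {0}ᶜ) :=
    ContinuousOn.isOpen_inter_preimage (fun w hw =>
      (hd.differentiableAt_deriv hw).continuousAt.continuousWithinAt) (B.isOpen_I k)
      isOpen_compl_singleton
  exact affine_eq_zero hU ⟨w₁, hw₁, hne⟩ fun w hw => (mul_eq_zero.1 (h w hw.1)).resolve_left hw.2

/-- The symmetries with `2 λ = ξ⁰_t`, when a diffusivity is not constant. -/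
theorem DetEqs.rigid_form (hd : B.Admissible d) (h : DetEqs B d ξ A b C) {k : Fin 2}
    (hk : ¬ ∃ κ, IsConstOn (d k) (B.I k) κ) (hμ : ∀ z ∈ B.Ω, mu ξ z = 0) :
    ∃ (p₀ τ : ℝ) (T : Fin 3 → ℝ) (r : Fin 3 → Fin 3 → ℝ), (∀ a b, r a b = -r b a) ∧
      ∀ z ∈ B.Ω, ξ 0 z = p₀ + 2 * τ * z 0 ∧
      (∀ a : Fin 3, ξ a.succ z = T a + (r a 0 * z 1 + r a 1 * z 2 + r a 2 * z 3)
        + τ * z a.succ) ∧ (∀ a : Fin 3, pd 0 (ξ a.succ) z = 0) ∧ A k z = 0 ∧ b k z = 0 := by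
  have hAb : ∀ z ∈ B.Ω, A k z = 0 ∧ b k z = 0 := fun z hz =>
    eq_zero_of_deriv_mul hd hk fun w hw => by rw [h.scale_mu hz hw, hμ z hz, mul_zero]
  have hl : ∀ z ∈ B.Ω, ∀ a : Fin 3, pd a.succ (pd 1 (ξ 1)) z = 0 := by
    intro z hz a
    have e := h.pd_mu_space hz a
    rw [pd_eq_zero_of_eqOn hμ hz] at e
    linarith
  have hdr : ∀ z ∈ B.Ω, ∀ a : Fin 3, pd 0 (ξ a.succ) z = 0 := by
    intro z hz a
    obtain ⟨w, hw⟩ := B.nonempty_I k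
    have e := h.drift z hz k w hw a
    rw [(h.conformal hd).laplacian hz, hl z hz, pd_eq_zero_of_eqOn (fun y hy => (hAb y hy).1) hz,
      pd_eq_zero_of_eqOn (fun y hy => (hAb y hy).2) hz] at e
    linarith
  obtain ⟨p₀, p₁, ℓ, T, c, r, hr, hform⟩ := h.static hd hdr
    (fun z hz => pd_eq_zero_of_eqOn hμ hz 0)
  refine ⟨p₀, ℓ, T, r, hr, fun z hz => ?_⟩
  obtain ⟨e0, eμ, ec, es⟩ := hform z hz
  have hc : ∀ a, c a = 0 := fun a => by rw [← ec a, hl z hz]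
  rw [hμ z hz, hc, hc, hc] at eμ
  refine ⟨by rw [e0]; linear_combination z 0 * eμ, fun a => ?_, hdr z hz, hAb z hz⟩
  rw [es a, hc, hc, hc, hc]; ring

end

end

/-! ### Solving the system when diffusivities are constant. -/

section

variable {B : Region} {d : Fin 2 → ℝ → ℝ} {ξ : Fin 4 → Indep → ℝ} {A b : Fin 2 → Indep → ℝ}
  {C : Fin 2 → ℝ}

lemma DetEqs.heat_of_const (h : DetEqs B d ξ A b C) {k : Fin 2} {κ : ℝ}
    (hκ : IsConstOn (d k) (B.I k) κ) {z : Indep} (hz : z ∈ B.Ω) :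
    pd 0 (A k) z = κ * ∑ a : Fin 3, pd a.succ (pd a.succ (A k)) z ∧
    pd 0 (b k) z = κ * ∑ a : Fin 3, pd a.succ (pd a.succ (b k)) z := by
  have := affine_eq_zero (B.isOpen_I k) (B.nonempty_I k)
    (x := pd 0 (A k) z - κ * ∑ a : Fin 3, pd a.succ (pd a.succ (A k)) z)
    (y := pd 0 (b k) z - κ * ∑ a : Fin 3, pd a.succ (pd a.succ (b k)) z) (fun w hw => by
      have e := h.heat z hz k w hw
      rw [hκ w hw, Finset.sum_add_distrib, ← Finset.sum_mul] at e
      linear_combination e)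
  exact ⟨sub_eq_zero.1 this.1, sub_eq_zero.1 this.2⟩

/-- One constant diffusivity makes the left side of its scale equation vanish, and so constrains the
`ξ` that both equations share. -/
lemma DetEqs.mu_eq_zero (hd : B.Admissible d) (h : DetEqs B d ξ A b C) {k : Fin 2} {κ : ℝ}
    (hκ : IsConstOn (d k) (B.I k) κ) {z : Indep} (hz : z ∈ B.Ω) : mu ξ z = 0 := by
  obtain ⟨w, hw⟩ := B.nonempty_I k
  have e := h.scale_mu hz hw
  rw [deriv_eq_zero_of_isConstOn (B.isOpen_I k) hκ hw, zero_mul] at e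
  exact (mul_eq_zero.1 e.symm).resolve_left ((hd k).2 w hw).ne'

lemma DetEqs.mem_heatSolutions (h : DetEqs B d ξ A b C) {k : Fin 2} {κ : ℝ}
    (hκ : IsConstOn (d k) (B.I k) κ) : b k ∈ heatSolutions B.Ω κ :=
  ⟨h.smooth_b k, fun _ hz => (h.heat_of_const hκ hz).2⟩

/-- The symmetries when both equations are linear. -/
theorem DetEqs.linear_form (hd : B.Admissible d) (h : DetEqs B d ξ A b C) {κ : Fin 2 → ℝ}
    (hκ : ∀ k, IsConstOn (d k) (B.I k) (κ k)) (h0 : ∀ k, κ k ≠ 0) :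
    ∃ (p₀ τ p₂ : ℝ) (T g : Fin 3 → ℝ) (α : Fin 2 → ℝ) (r : Fin 3 → Fin 3 → ℝ),
      (∀ a b, r a b = -r b a) ∧
      ∀ z ∈ B.Ω, ξ 0 z = p₀ + 2 * τ * z 0 + p₂ * z 0 ^ 2 ∧
      (∀ a : Fin 3, ξ a.succ z = T a + (r a 0 * z 1 + r a 1 * z 2 + r a 2 * z 3)
        + τ * z a.succ + g a * z 0 + p₂ * z 0 * z a.succ) ∧
      ∀ k, A k z = -(1 / (2 * κ k)) * (g 0 * z 1 + g 1 * z 2 + g 2 * z 3)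
        - p₂ * (1 / (4 * κ k)) * (z 1 ^ 2 + z 2 ^ 2 + z 3 ^ 2 + 6 * κ k * z 0) + α k := by
  have hμ : ∀ z ∈ B.Ω, mu ξ z = 0 := fun z hz => h.mu_eq_zero hd (hκ 0) hz
  have hconf := h.conformal hd
  have hs := h.smooth_xi
  have hp := fun l j => contDiffOn_pd B.isOpen_Ω (hs l) j
  have hpA := fun l j => contDiffOn_pd B.isOpen_Ω (h.smooth_A l) j
  have hla : ∀ z ∈ B.Ω, ∀ a : Fin 3, pd a.succ (pd 1 (ξ 1)) z = 0 := by
    intro z hz a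
    have e := h.pd_mu_space hz a
    rw [pd_eq_zero_of_eqOn hμ hz] at e
    linarith
  have hlt : ∀ z ∈ B.Ω, pd 0 (pd 0 (ξ 0)) z = 2 * pd 0 (pd 1 (ξ 1)) z := by
    intro z hz
    have e := h.pd_mu hz 0
    rw [pd_eq_zero_of_eqOn hμ hz] at e
    linarith
  have hA : ∀ k, ∀ z ∈ B.Ω, ∀ a : Fin 3, pd a.succ (A k) z = -(1 / (2 * κ k)) * pd 0 (ξ a.succ) z := by
    intro k z hz a
    obtain ⟨w, hw⟩ := B.nonempty_I k
    have e := h.drift z hz k w hw a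
    rw [hconf.laplacian hz, hla z hz, deriv_eq_zero_of_isConstOn (B.isOpen_I k) (hκ k) hw,
      hκ k w hw] at e
    have := h0 k
    field_simp
    linarith
  have hdA : ∀ k i, ∀ z ∈ B.Ω, ∀ a : Fin 3, pd i (pd a.succ (A k)) z =
      -(1 / (2 * κ k)) * pd i (pd 0 (ξ a.succ)) z := fun k i z hz a =>
    pd_of_eqOn_mul (hp a.succ 0) (fun y hy => hA k y hy a) hz i
  have hk0 : ∀ k, -(1 / (2 * κ k)) ≠ 0 := fun k => by
    have := h0 k
    simp [this]
  -- Since the gradient of `A` is a multiple of `(ξ^a_t)`, the matrix `∂_b ξ^a_t` is symmetric. The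
  -- Killing equations give its symmetric part, `λ_t` times the identity.
  have hsp : ∀ z ∈ B.Ω, ∀ a b : Fin 3, pd b.succ (pd 0 (ξ a.succ)) z =
      pd 0 (pd 1 (ξ 1)) z * kr a b := by
    intro z hz a b
    have e1 := pd_comm (h.smooth_A 0) hz b.succ a.succ
    rw [hdA 0 _ z hz, hdA 0 _ z hz] at e1
    have e2 := mul_left_cancel₀ (hk0 0) e1
    have e3 := hconf.pd_symm hz 0 a b
    rw [pd_comm (hs b.succ) hz, pd_comm (hs a.succ) hz] at e3
    linarith
  -- The heat equation for `A_k` with the trace of the previous identity: `κ · (-1/(2κ)) · 3 =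
  -- -3/2`.
  have hAt : ∀ k, ∀ z ∈ B.Ω, pd 0 (A k) z = -(3 / 2) * pd 0 (pd 1 (ξ 1)) z := by
    intro k z hz
    rw [(h.heat_of_const (hκ k) hz).1]
    simp only [hdA k _ z hz, hsp z hz, Fin.sum_univ_three, kr, if_true]
    have := h0 k
    field_simp
    ring
  -- Equality of the mixed derivatives `∂_t∂_a A` and `∂_a∂_t A`: the second vanishes because `λ`
  -- does not depend on `x`.
  have hatt : ∀ z ∈ B.Ω, ∀ a : Fin 3, pd 0 (pd 0 (ξ a.succ)) z = 0 := by
    intro z hz a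
    have e1 := hdA 0 0 z hz a
    rw [pd_comm (h.smooth_A 0) hz, pd_of_eqOn_mul (contDiffOn_pd B.isOpen_Ω (hp 1 1) 0) (hAt 0) hz,
      pd_comm (hp 1 1) hz, pd_eq_zero_of_eqOn (fun y hy => hla y hy a) hz, mul_zero] at e1
    exact (mul_eq_zero.1 e1.symm).resolve_left (hk0 0)
  obtain ⟨p₂, hp₂⟩ := eq_const (contDiffOn_pd B.isOpen_Ω (hp 1 1) 0) (by
    intro z hz i
    induction i using Fin.cases with
    | zero =>
      have e : ∀ y ∈ B.Ω, pd 0 (pd 1 (ξ 1)) y = pd 1 (pd 0 (ξ 1)) y := fun y hy =>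
        pd_comm (hs 1) hy 0 1
      rw [pd_congr B.isOpen_Ω e hz, pd_comm (hp 1 0) hz,
        pd_eq_zero_of_eqOn (f := pd 0 (pd 0 (ξ 1))) (fun y hy => hatt y hy 0) hz]
    | succ a =>
      rw [pd_comm (hp 1 1) hz, pd_eq_zero_of_eqOn (fun y hy => hla y hy a) hz])
  obtain ⟨p₀, p₁, ℓ, T, c, g, r, hr, hform⟩ := hconf.integrate h.time (p₂ := p₂)
    (fun z hz => by rw [hlt z hz, hp₂ z hz]) (fun z hz a b => by rw [hsp z hz, hp₂ z hz]) hatt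
  have key : ∀ k, ∃ α, ∀ z ∈ B.Ω, A k z = -(1 / (2 * κ k)) * (g 0 * z 1 + g 1 * z 2 + g 2 * z 3)
        - p₂ * (1 / (4 * κ k)) * (z 1 ^ 2 + z 2 ^ 2 + z 3 ^ 2 + 6 * κ k * z 0) + α := fun k =>
    eq_add_const (h.smooth_A k) (g := fun z =>
      -(1 / (2 * κ k)) * (g 0 * z 1 + g 1 * z 2 + g 2 * z 3)
        - p₂ * (1 / (4 * κ k)) * (z 1 ^ 2 + z 2 ^ 2 + z 3 ^ 2 + 6 * κ k * z 0)) (by fun_prop) (by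
      intro z hz i
      simp (disch := fun_prop) only [pd_mul, pd_const, pd_coord, pd_add, pd_sub, pd_sq]
      have := h0 k
      induction i using Fin.cases with
      | zero =>
        rw [hAt k z hz, hp₂ z hz]
        simp
        field_simp
        ring
      | succ a =>
        rw [hA k z hz, (hform z hz).2.2.2.2.1 a]
        fin_cases a <;> simp <;> field_simp <;> ring)
  choose α hα using key
  refine ⟨p₀, ℓ, p₂, T, g, α, r, hr, fun z hz => ?_⟩
  obtain ⟨e0, e0t, ec, el, -, es⟩ := hform z hz
  have hc : ∀ a, c a = 0 := fun a => by rw [← ec a, hla z hz]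
  have hm := hμ z hz
  rw [mu, el, e0t, hc, hc, hc] at hm
  refine ⟨by rw [e0]; linear_combination -z 0 * hm, fun a => ?_, fun k => hα k z hz⟩
  rw [es a, hc, hc, hc, hc]; ring

end

/-! ### The algebra in each case as a span. -/

section

variable {B : Region} {d : Fin 2 → ℝ → ℝ}

lemma Region.AE_le (B : Region) (S : Set Operator) :
    B.AE ≤ Submodule.span ℝ (B.dom.domRestrict '' (gensAE ∪ S)) :=
  Submodule.span_mono (Set.image_mono Set.subset_union_left)

lemma mem_span_right {S : Set Operator} {X : Operator} (hX : X ∈ S) :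
    B.dom.domRestrict X ∈ Submodule.span ℝ (B.dom.domRestrict '' (gensAE ∪ S)) :=
  Submodule.subset_span ⟨X, Or.inr hX, rfl⟩

lemma span_union_subset_mai (hd : B.Admissible d) {S : Set Operator}
    (hS : ∀ X ∈ S, HasData B d X) :
    (Submodule.span ℝ (B.dom.domRestrict '' (gensAE ∪ S)) : Set (B.dom → Jet0)) ⊆ B.mai d :=
  span_subset_mai hd fun X hX => hX.elim hasData_gensAE (hS X)

theorem AE_subset_mai (hd : B.Admissible d) : (B.AE : Set (B.dom → Jet0)) ⊆ B.mai d :=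
  span_subset_mai hd fun _ hX => hasData_gensAE hX

/-- The scaling operator `x_a ∂_{x_a} + 2 (α₀ u + β₀) ∂_u + 2 (α₁ v + β₁) ∂_v`. -/
def opS (α β : Fin 2 → ℝ) : Operator :=
  opD (fun p => 2 * (α 0 * p.2 0 + β 0)) (fun p => 2 * (α 1 * p.2 1 + β 1))

lemma opS_apply (α β : Fin 2 → ℝ) (m : Jet0) :
    opS α β m = coeffs 0 (sp m) (fun k => 2 * (α k * m.2 k + β k)) := by
  refine Prod.ext rfl (funext fun k => ?_)
  fin_cases k <;> rfl

/-- The algebra when both diffusivities satisfy `d' (α w + β) = d`. -/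
theorem mai_eq_of_scale (hd : B.Admissible d) {α β : Fin 2 → ℝ}
    (hαβ : ∀ k, ∀ w ∈ B.I k, deriv (d k) w * (α k * w + β k) = d k w)
    (hα : ∃ k, 5 + 4 * α k ≠ 0) :
    B.mai d = (Submodule.span ℝ (B.dom.domRestrict '' (gensAE ∪ {opS α β})) :
      Set (B.dom → Jet0)) := by
  refine Set.Subset.antisymm (fun X hX => ?_) (span_union_subset_mai hd ?_)
  · obtain ⟨ξ, A, b, C, h, hXm⟩ := (mem_mai_iff hd).1 hX
    obtain ⟨p₀, p₁, ℓ, T, c, r, hr, hc, hform⟩ := h.scaling_form hd hαβ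
    obtain ⟨k, hk⟩ := hα
    have hc0 : ∀ a, c a = 0 := fun a => (mul_eq_zero.1 (hc k a)).resolve_right hk
    -- Here `μ = 2ℓ - p₁`, so this multiple of the scaling operator removes all of `η`. The
    -- remaining dilation coefficient `p₁ / 2` matches `ξ⁰_t = p₁`.
    have hAE : X - (ℓ - p₁ / 2) • B.dom.domRestrict (opS α β) ∈ B.AE := by
      refine mem_AE p₀ (p₁ / 2) T r hr fun m => ?_
      rw [Pi.sub_apply, hXm, hform m m.2]
      ext i
      · refine Fin.cases ?_ (fun a => ?_) i
        · simp [coeffs, opS_apply, mul_div_cancel₀]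
        · simp [coeffs, opS_apply, hc0, sp]; ring
      · simp [coeffs, opS_apply, hc0]; ring
    have := Submodule.add_mem _ (B.AE_le {opS α β} hAE) (Submodule.smul_mem _ (ℓ - p₁ / 2)
      (mem_span_right (B := B) (Set.mem_singleton (opS α β))))
    rwa [sub_add_cancel] at this
  · rintro X rfl
    exact hasData_opD α β hαβ

theorem mai_eq_of_conformal (hd : B.Admissible d)
    (hαβ : ∀ k, ∀ w ∈ B.I k, deriv (d k) w * (-(5 / 4) * w + 0) = d k w) :
    B.mai d = (Submodule.span ℝ (B.dom.domRestrict '' (gensAE ∪ (Set.range opK ∪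
      {opS (fun _ => -(5 / 4)) (fun _ => 0)}))) : Set (B.dom → Jet0)) := by
  refine Set.Subset.antisymm (fun X hX => ?_) (span_union_subset_mai hd ?_)
  · obtain ⟨ξ, A, b, C, h, hXm⟩ := (mem_mai_iff hd).1 hX
    obtain ⟨p₀, p₁, ℓ, T, c, r, hr, -, hform⟩ := h.scaling_form hd hαβ
    set S := (Set.range opK ∪ {opS (fun _ => -(5 / 4)) (fun _ => 0)}) with hS
    -- The quadratic part of `ξ` is `-½ (c_a |x|² - 2 (c·x) x_a)`, hence the coefficients `-c_a /
    -- 2`.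
    set Y : B.dom → Jet0 := (ℓ - p₁ / 2) • B.dom.domRestrict (opS (fun _ => -(5 / 4)) (fun _ => 0))
      + (-(c 0 / 2)) • B.dom.domRestrict (opK 0) + (-(c 1 / 2)) • B.dom.domRestrict (opK 1)
      + (-(c 2 / 2)) • B.dom.domRestrict (opK 2) with hY
    have hAE : X - Y ∈ B.AE := by
      refine mem_AE p₀ (p₁ / 2) T r hr fun m => ?_
      rw [Pi.sub_apply, hXm, hform m m.2]
      ext i
      · refine Fin.cases ?_ (fun a => ?_) i
        · simp [hY, coeffs, opS_apply, opK, mul_div_cancel₀]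
        · simp only [hY, coeffs, opS_apply, opK, sp, spSq, Pi.add_apply, Pi.smul_apply,
            Set.domRestrict_apply, Prod.fst_add, Prod.smul_fst, Prod.fst_sub, Pi.sub_apply,
            Fin.cons_succ, smul_eq_mul, Fin.sum_univ_three]
          fin_cases a <;> simp <;> ring
      · simp [hY, coeffs, opS_apply, opK, sp]; ring
    have hmem : Y ∈ Submodule.span ℝ (B.dom.domRestrict '' (gensAE ∪ S)) := by
      have hK := fun a => mem_span_right (B := B) (S := S) (X := opK a) (Or.inl ⟨a, rfl⟩)
      exact Submodule.add_mem _ (Submodule.add_mem _ (Submodule.add_mem _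
        (Submodule.smul_mem _ _ (mem_span_right (Or.inr rfl))) (Submodule.smul_mem _ _ (hK 0)))
        (Submodule.smul_mem _ _ (hK 1))) (Submodule.smul_mem _ _ (hK 2))
    have := Submodule.add_mem _ (B.AE_le S hAE) hmem
    rwa [sub_add_cancel] at this
  · rintro X (⟨e, rfl⟩ | rfl)
    · exact hasData_opK e fun k w hw => by rw [← hαβ k w hw]; ring
    · exact hasData_opD _ _ hαβ

/-- The constant diffusivity gives `μ = 0`, and the nonconstant one then makes `ξ` rigid and static.
In the linear equation the drift and heat equations therefore reduce to `A_k` being constant, while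
`b_k` is any solution of the heat equation. -/
theorem mai_eq_of_const_nonconst (hd : B.Admissible d) {k : Fin 2} {κ : ℝ}
    (hκ : IsConstOn (d k) (B.I k) κ) (hnc : ¬ ∃ κ, IsConstOn (d k.rev) (B.I k.rev) κ) :
    B.mai d = (Submodule.span ℝ (B.dom.domRestrict '' (gensAE ∪ ({opW k (fun m => m.2 k)} ∪
      gensHeat B.Ω k κ))) : Set (B.dom → Jet0)) := by
  refine Set.Subset.antisymm (fun X hX => ?_) (span_union_subset_mai hd ?_)
  · obtain ⟨ξ, A, b, C, h, hXm⟩ := (mem_mai_iff hd).1 hX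
    have hC : C = 0 := h.cross.resolve_right fun ⟨κ, hκ⟩ => hnc ⟨κ, hκ _⟩
    obtain ⟨p₀, τ, T, r, hr, hform⟩ := h.rigid_form hd hnc (fun z hz => h.mu_eq_zero hd hκ hz)
    have hA : ∀ z ∈ B.Ω, ∀ a : Fin 3, pd a.succ (A k) z = 0 := by
      intro z hz a
      obtain ⟨w, hw⟩ := B.nonempty_I k
      have e := h.drift z hz k w hw a
      have e1 := h.pd_mu_space hz a
      rw [pd_eq_zero_of_eqOn (fun y hy => h.mu_eq_zero hd hκ hy) hz] at e1
      have e2 : pd a.succ (pd 1 (ξ 1)) z = 0 := by linarith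
      rw [(h.conformal hd).laplacian hz, e2, (hform z hz).2.2.1,
        deriv_eq_zero_of_isConstOn (B.isOpen_I k) hκ hw] at e
      have := ((hd k).2 w hw).ne'
      have e3 : d k w * pd a.succ (A k) z = 0 := by linarith
      exact (mul_eq_zero.1 e3).resolve_left this
    obtain ⟨α, hα⟩ := eq_const (h.smooth_A k) (by
      intro z hz i
      induction i using Fin.cases with
      | zero =>
        rw [(h.heat_of_const hκ hz).1, Finset.sum_eq_zero, mul_zero]
        exact fun a _ => pd_eq_zero_of_eqOn (fun y hy => hA y hy a) hz _
      | succ a => exact hA z hz a)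
    set S := ({opW k (fun m => m.2 k)} ∪ gensHeat B.Ω k κ) with hS
    set Y : B.dom → Jet0 := α • B.dom.domRestrict (opW k (fun m => m.2 k))
      + B.dom.domRestrict (opW k (fun m => b k m.1)) with hY
    have hAE : X - Y ∈ B.AE := by
      refine mem_AE p₀ τ T r hr fun m => ?_
      obtain ⟨e0, es, -, e4, e5⟩ := hform m.1.1 m.2.1
      rw [Pi.sub_apply, hXm]
      ext i
      · refine Fin.cases ?_ (fun a => ?_) i
        · simp [hY, coeffs, opW, dataOp, e0]
        · simp [hY, coeffs, opW, dataOp, es]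
      · rcases eq_or_ne i k with rfl | hi
        · simp [hY, coeffs, opW, dataOp, lin, hC, hα _ m.2.1]
        · have : i = k.rev := by
            revert hi; fin_cases i <;> fin_cases k <;> decide
          subst this
          simp [hY, coeffs, opW, dataOp, lin, hC, e4, e5, rev_ne]
    have hmem : Y ∈ Submodule.span ℝ (B.dom.domRestrict '' (gensAE ∪ S)) :=
      Submodule.add_mem _ (Submodule.smul_mem _ _ (mem_span_right (Or.inl rfl)))
        (mem_span_right (Or.inr ⟨b k, h.mem_heatSolutions hκ, rfl⟩))
    have := Submodule.add_mem _ (B.AE_le S hAE) hmem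
    rwa [sub_add_cancel] at this
  · rintro X (rfl | ⟨f, hf, rfl⟩)
    · exact hasData_opW_self hκ
    · exact hasData_opW_heat hκ hf

/-- Splits off the mixing operators, so that distinct and equal constants are treated together. -/
lemma linear_mem (hd : B.Admissible d) {κ : Fin 2 → ℝ}
    (hκ : ∀ k, IsConstOn (d k) (B.I k) (κ k)) {X : B.dom → Jet0} (hX : X ∈ B.mai d) :
    ∃ C : Fin 2 → ℝ, (C = 0 ∨ ∃ κ, ∀ k, IsConstOn (d k) (B.I k) κ) ∧
      X - (C 0 • B.dom.domRestrict (opW 0 (fun m => m.2 1))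
        + C 1 • B.dom.domRestrict (opW 1 (fun m => m.2 0)))
        ∈ Submodule.span ℝ (B.dom.domRestrict '' (gensAE ∪ gensLinear B.Ω κ)) := by
  have h0 : ∀ k, κ k ≠ 0 := fun k => by
    obtain ⟨w, hw⟩ := B.nonempty_I k
    rw [← hκ k w hw]; exact ((hd k).2 w hw).ne'
  obtain ⟨ξ, A, b, C, h, hXm⟩ := (mem_mai_iff hd).1 hX
  obtain ⟨p₀, τ, p₂, T, g, α, r, hr, hform⟩ := h.linear_form hd hκ h0
  refine ⟨C, h.cross, ?_⟩
  set Z : B.dom → Jet0 := C 0 • B.dom.domRestrict (opW 0 (fun m => m.2 1))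
        + C 1 • B.dom.domRestrict (opW 1 (fun m => m.2 0)) with hZ
  set Y : B.dom → Jet0 := α 0 • B.dom.domRestrict (opW 0 (fun m => m.2 0))
    + α 1 • B.dom.domRestrict (opW 1 (fun m => m.2 1))
    + B.dom.domRestrict (opW 0 (fun m => b 0 m.1)) + B.dom.domRestrict (opW 1 (fun m => b 1 m.1))
    + g 0 • B.dom.domRestrict (opG κ 0) + g 1 • B.dom.domRestrict (opG κ 1)
    + g 2 • B.dom.domRestrict (opG κ 2) + p₂ • B.dom.domRestrict (opPi κ) with hY
  have hAE : X - Z - Y ∈ B.AE := by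
    refine mem_AE p₀ τ T r hr fun m => ?_
    obtain ⟨e0, es, eA⟩ := hform m.1.1 m.2.1
    rw [Pi.sub_apply, Pi.sub_apply, hXm]
    ext i
    · refine Fin.cases ?_ (fun a => ?_) i
      · simp [hY, hZ, coeffs, opW, opG, opPi, dataOp, e0, tm]
      · simp only [hY, hZ, coeffs, opW, opG, opPi, dataOp, es, sp, tm, Pi.add_apply, Pi.smul_apply,
            Set.domRestrict_apply, Prod.fst_add, Prod.smul_fst, Prod.fst_sub, Pi.sub_apply,
            Fin.cons_succ, smul_eq_mul]
        fin_cases a <;> simp <;> ring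
    · fin_cases i <;> simp [hY, hZ, coeffs, opW, opG, opPi, dataOp, lin, eA, sp, spSq, tm,
        Fin.sum_univ_three] <;> ring
  have hG := fun a => mem_span_right (B := B) (S := gensLinear B.Ω κ) (X := opG κ a)
    (Or.inl (Or.inr ⟨a, rfl⟩))
  have hmem : Y ∈ Submodule.span ℝ (B.dom.domRestrict '' (gensAE ∪ gensLinear B.Ω κ)) := by
    refine Submodule.add_mem _ (Submodule.add_mem _ (Submodule.add_mem _ (Submodule.add_mem _
      (Submodule.add_mem _ (Submodule.add_mem _ (Submodule.add_mem _
      (Submodule.smul_mem _ _ (mem_span_right ?_)) (Submodule.smul_mem _ _ (mem_span_right ?_)))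
      (mem_span_right ?_)) (mem_span_right ?_)) (Submodule.smul_mem _ _ (hG 0)))
      (Submodule.smul_mem _ _ (hG 1))) (Submodule.smul_mem _ _ (hG 2)))
      (Submodule.smul_mem _ _ (mem_span_right (Or.inr rfl)))
    · exact Or.inl (Or.inl (Or.inl (Or.inl (Or.inl rfl))))
    · exact Or.inl (Or.inl (Or.inl (Or.inl (Or.inr rfl))))
    · exact Or.inl (Or.inl (Or.inl (Or.inr ⟨b 0, h.mem_heatSolutions (hκ 0), rfl⟩)))
    · exact Or.inl (Or.inl (Or.inr ⟨b 1, h.mem_heatSolutions (hκ 1), rfl⟩))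
  have := Submodule.add_mem _ (B.AE_le (gensLinear B.Ω κ) hAE) hmem
  rwa [sub_add_cancel] at this

lemma hasData_gensLinear (hd : B.Admissible d) {κ : Fin 2 → ℝ}
    (hκ : ∀ k, IsConstOn (d k) (B.I k) (κ k)) {X : Operator} (hX : X ∈ gensLinear B.Ω κ) :
    HasData B d X := by
  have h0 : ∀ k, κ k ≠ 0 := fun k => by
    obtain ⟨w, hw⟩ := B.nonempty_I k
    rw [← hκ k w hw]; exact ((hd k).2 w hw).ne'
  rcases hX with ((((rfl | rfl) | ⟨f, hf, rfl⟩) | ⟨f, hf, rfl⟩) | ⟨a, rfl⟩) | rfl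
  · exact hasData_opW_self (hκ 0)
  · exact hasData_opW_self (hκ 1)
  · exact hasData_opW_heat (hκ 0) hf
  · exact hasData_opW_heat (hκ 1) hf
  · exact hasData_opG hκ h0 a
  · exact hasData_opPi hκ h0

theorem mai_eq_of_const_const (hd : B.Admissible d) {κ : Fin 2 → ℝ}
    (hκ : ∀ k, IsConstOn (d k) (B.I k) (κ k)) (hne : κ 0 ≠ κ 1) :
    B.mai d = (Submodule.span ℝ (B.dom.domRestrict '' (gensAE ∪ gensLinear B.Ω κ)) :
      Set (B.dom → Jet0)) := by
  refine Set.Subset.antisymm (fun X hX => ?_)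
    (span_union_subset_mai hd fun X hX => hasData_gensLinear hd hκ hX)
  obtain ⟨C, hC, hmem⟩ := linear_mem hd hκ hX
  have hC0 : C = 0 := hC.resolve_right fun ⟨κ', h'⟩ => hne (by
    obtain ⟨w, hw⟩ := B.nonempty_I 0
    obtain ⟨w', hw'⟩ := B.nonempty_I 1
    rw [← hκ 0 w hw, ← hκ 1 w' hw', h' 0 w hw, h' 1 w' hw'])
  simpa [hC0] using hmem

theorem mai_eq_of_const_same (hd : B.Admissible d) {κ : ℝ}
    (hκ : ∀ k, IsConstOn (d k) (B.I k) κ) :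
    B.mai d = (Submodule.span ℝ (B.dom.domRestrict '' (gensAE ∪ (gensLinear B.Ω ![κ, κ] ∪
      {opW 0 (fun m => m.2 1), opW 1 (fun m => m.2 0)}))) : Set (B.dom → Jet0)) := by
  have hκ' : ∀ k, IsConstOn (d k) (B.I k) (![κ, κ] k) := by
    intro k; fin_cases k <;> exact hκ _
  refine Set.Subset.antisymm (fun X hX => ?_) (span_union_subset_mai hd ?_)
  · obtain ⟨C, -, hmem⟩ := linear_mem hd hκ' hX
    have h1 := Submodule.span_mono (R := ℝ) (Set.image_mono (f := B.dom.domRestrict)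
      (Set.union_subset_union_right gensAE (Set.subset_union_left (s := gensLinear B.Ω ![κ, κ])
        (t := {opW 0 (fun m => m.2 1), opW 1 (fun m => m.2 0)})))) hmem
    have h2 := Submodule.add_mem _ h1 (Submodule.add_mem _
      (Submodule.smul_mem _ (C 0) (mem_span_right (Or.inr (Or.inl rfl))))
      (Submodule.smul_mem _ (C 1) (mem_span_right (Or.inr (Or.inr rfl)))))
    rwa [sub_add_cancel] at h2
  · rintro X (hX | rfl | rfl)
    · exact hasData_gensLinear hd hκ' hX
    · exact hasData_opW_rev hκ 0
    · exact hasData_opW_rev hκ 1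

end

/-! ### Strictness of the extensions and their dimension. -/

section

variable {B : Region} {d : Fin 2 → ℝ → ℝ}

lemma Region.exists_mem_dom (B : Region) {k : Fin 2} {w : ℝ} (hw : w ∈ B.I k) :
    ∃ m : B.dom, m.1.2 k = w := by
  obtain ⟨z, hz⟩ := B.isConnected_Ω.nonempty
  choose v hv using B.nonempty_I
  refine ⟨⟨(z, Function.update v k w), hz, fun j => ?_⟩, by simp⟩
  rcases eq_or_ne j k with rfl | hj
  · simpa using hw
  · simpa [hj] using hv j

/-- This is the invariant that separates the extensions from `AE(1,3)`: each extension contains an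
operator whose `η` is nonzero somewhere. -/
lemma snd_eq_zero_of_mem_AE {X : B.dom → Jet0} (hX : X ∈ B.AE) (m : B.dom) : (X m).2 = 0 := by
  induction hX using Submodule.span_induction with
  | mem X hX =>
    obtain ⟨Y, hY, rfl⟩ := hX
    rcases hY with ((rfl | ⟨a, rfl⟩) | ⟨a, b, -, rfl⟩) | rfl <;> rfl
  | zero => rfl
  | add X Y _ _ h1 h2 => rw [Pi.add_apply, Prod.snd_add, h1, h2, add_zero]
  | smul c X _ h => rw [Pi.smul_apply, Prod.smul_snd, h, smul_zero]

lemma AE_lt {S : Set Operator} {X : Operator} (hX : X ∈ S) {k : Fin 2} {m : B.dom}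
    (hm : (X m).2 k ≠ 0) :
    B.AE < Submodule.span ℝ (B.dom.domRestrict '' (gensAE ∪ S)) :=
  SetLike.lt_iff_le_and_exists.2 ⟨B.AE_le S, _, mem_span_right hX, fun h =>
    hm (congrFun (snd_eq_zero_of_mem_AE h m) k)⟩

lemma AE_lt_of_opW {S : Set Operator} {k : Fin 2} (hX : opW k (fun m => m.2 k) ∈ S) :
    B.AE < Submodule.span ℝ (B.dom.domRestrict '' (gensAE ∪ S)) := by
  obtain ⟨w, hw, h0⟩ : ∃ w ∈ B.I k, w ≠ 0 := by
    by_contra! h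
    exact one_ne_zero (affine_eq_zero (B.isOpen_I k) (B.nonempty_I k) (x := 1) (y := 0)
      (fun w hw => by rw [h w hw]; ring)).1
  obtain ⟨m, rfl⟩ := B.exists_mem_dom hw
  exact AE_lt hX (k := k) (m := m) (by simpa [opW, coeffs] using h0)

lemma AE_lt_of_opS (hd : B.Admissible d) {S : Set Operator} {α β : Fin 2 → ℝ}
    (hαβ : ∀ k, ∀ w ∈ B.I k, deriv (d k) w * (α k * w + β k) = d k w) (hX : opS α β ∈ S) :
    B.AE < Submodule.span ℝ (B.dom.domRestrict '' (gensAE ∪ S)) := by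
  obtain ⟨w, hw⟩ := B.nonempty_I 0
  obtain ⟨m, rfl⟩ := B.exists_mem_dom hw
  refine AE_lt hX (k := 0) (m := m) ?_
  have h := hαβ 0 _ hw
  have h1 : α 0 * m.1.2 0 + β 0 ≠ 0 := fun h0 => by
    rw [h0, mul_zero] at h
    exact ((hd 0).2 _ hw).ne h
  simpa [opS_apply, coeffs] using h1

lemma finite_gensAE : gensAE.Finite := by
  refine (((Set.finite_singleton _).union (Set.finite_range _)).union ?_).union
    (Set.finite_singleton _)
  refine (Set.finite_range fun p : Fin 3 × Fin 3 => opJ p.1 p.2).subset ?_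
  rintro X ⟨a, b, -, rfl⟩
  exact ⟨(a, b), rfl⟩

lemma finiteDimensional_span {S : Set Operator} (hS : S.Finite) :
    FiniteDimensional ℝ (Submodule.span ℝ (B.dom.domRestrict '' (gensAE ∪ S))) :=
  FiniteDimensional.span_of_finite ℝ ((finite_gensAE.union hS).image _)

lemma pd_exp (i : Fin 4) {f : Indep → ℝ} (hf : Differentiable ℝ f) :
    pd i (fun z => Real.exp (f z)) = fun z => Real.exp (f z) * pd i f z := by
  ext z
  rw [pd, fderiv_exp (hf z)]; rfl

/-- The solution `exp (κ n² (t - t₀) + n x₁)` of the linear heat equation. -/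
def expSol (κ t₀ : ℝ) (n : ℕ) (z : Indep) : ℝ :=
  Real.exp (κ * (n : ℝ) ^ 2 * (z 0 - t₀) + n * z 1)

lemma expSol_mem (Ω : Set Indep) (κ t₀ : ℝ) (n : ℕ) : expSol κ t₀ n ∈ heatSolutions Ω κ := by
  unfold expSol
  refine ⟨by fun_prop, fun z _ => ?_⟩
  simp (disch := fun_prop) only [Fin.sum_univ_three, pd_exp, pd_add, pd_sub, pd_mul, pd_const,
    pd_coord]
  simp
  ring

/-- At the time `t₀` the `n`-th solution is the `n`-th power of `exp x₁`. A linear relation thus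
gives a polynomial that vanishes at infinitely many points, because `Ω` contains a piece of a line
parallel to the `x₁`-axis. -/
lemma linearIndependent_expSol (B : Region) (k : Fin 2) (κ t₀ : ℝ) {z : Indep} (hz : z ∈ B.Ω)
    (h0 : z 0 = t₀) :
    LinearIndependent ℝ fun n => B.dom.domRestrict (opW k fun m => expSol κ t₀ n m.1) := by
  rw [linearIndependent_iff']
  intro s g hg n hn
  choose v hv using B.nonempty_I
  let γ : ℝ → Indep := fun y => Function.update z 1 y
  have hγ : Continuous γ := continuous_const.update 1 continuous_id
  have hU : IsOpen (γ ⁻¹' B.Ω) := B.isOpen_Ω.preimage hγ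
  have hinf : (Real.exp '' (γ ⁻¹' B.Ω)).Infinite := by
    refine Set.Infinite.image Real.exp_injective.injOn (infinite_of_mem_nhds (z 1) ?_)
    exact hU.mem_nhds (by simpa [γ] using hz)
  have hq : ∑ i ∈ s, Polynomial.monomial i (g i) = 0 := by
    refine Polynomial.eq_zero_of_infinite_isRoot _ (hinf.mono ?_)
    rintro _ ⟨y, hy, rfl⟩
    have e := congrArg (fun x => x.2 k) (congrFun hg ⟨(γ y, v), hy, hv⟩)
    simp only [Finset.sum_apply, Pi.smul_apply, Set.domRestrict_apply, Prod.snd_sum,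
      Prod.smul_snd, opW, coeffs, Pi.single_eq_same, smul_eq_mul, Pi.zero_apply, Prod.snd_zero]
      at e
    rw [Set.mem_ofPred_eq, Polynomial.IsRoot.def, Polynomial.eval_finsetSum, ← e]
    refine Finset.sum_congr rfl fun i _ => ?_
    rw [Polynomial.eval_monomial, expSol, ← Real.exp_nat_mul]
    simp [γ, h0]
  have := congrArg (Polynomial.coeff · n) hq
  simpa [Polynomial.finsetSum_coeff, Polynomial.coeff_monomial, hn] using this

lemma not_finiteDimensional_span {S : Set Operator} {k : Fin 2} {κ : ℝ}
    (hS : gensHeat B.Ω k κ ⊆ S) :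
    ¬ FiniteDimensional ℝ (Submodule.span ℝ (B.dom.domRestrict '' (gensAE ∪ S))) := by
  intro hfin
  obtain ⟨z, hz⟩ := B.isConnected_Ω.nonempty
  have hli := linearIndependent_expSol B k κ (z 0) hz rfl
  let v : ℕ → Submodule.span ℝ (B.dom.domRestrict '' (gensAE ∪ S)) := fun n =>
    ⟨_, mem_span_right (hS ⟨_, expSol_mem B.Ω κ (z 0) n, rfl⟩)⟩
  have hv : LinearIndependent ℝ v := LinearIndependent.of_comp (Submodule.subtype _) hli
  exact not_finite_iff_infinite.2 inferInstance hv.finite_of_isNoetherian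

lemma IsExpOn.scale {I : Set ℝ} (hI : IsOpen I) {d : ℝ → ℝ} (h : IsExpOn d I) {w : ℝ}
    (hw : w ∈ I) : deriv d w * (0 * w + 1) = d w := by
  have e : d =ᶠ[nhds w] Real.exp := by
    filter_upwards [hI.mem_nhds hw] with y hy using h y hy
  rw [e.deriv_eq, Real.deriv_exp, h w hw]; ring

lemma IsPowOn.scale {I : Set ℝ} (hI : IsOpen I) {d : ℝ → ℝ} {n : ℝ} (h : IsPowOn d I n) {w : ℝ}
    (hw : w ∈ I) : deriv d w * (1 / n * w + 0) = d w := by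
  have e : d =ᶠ[nhds w] fun y => y ^ n := by
    filter_upwards [hI.mem_nhds hw] with y hy using (h.2 y hy).2
  have hn := h.1
  have hw0 := (h.2 w hw).1
  rw [e.deriv_eq, Real.deriv_rpow_const, (h.2 w hw).2, Real.rpow_sub_one hw0.ne']
  field_simp
  ring

lemma opD_eq_opS {f g : Jet0 → ℝ} {α β : Fin 2 → ℝ} (hf : ∀ p, f p = 2 * (α 0 * p.2 0 + β 0))
    (hg : ∀ p, g p = 2 * (α 1 * p.2 1 + β 1)) : opD f g = opS α β := by
  rw [funext hf, funext hg, opS]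

/-- A case given by a scaling operator that is not the conformal one. -/
lemma algebra_of_scale (hd : B.Admissible d) {c : ExtCase} {α β : Fin 2 → ℝ} {f g : Jet0 → ℝ}
    (hc' : c.gens B.Ω = {opD f g})
    (hαβ : ∀ k, ∀ w ∈ B.I k, deriv (d k) w * (α k * w + β k) = d k w)
    (hα : ∃ k, 5 + 4 * α k ≠ 0) (hf : ∀ p, f p = 2 * (α 0 * p.2 0 + β 0))
    (hg : ∀ p, g p = 2 * (α 1 * p.2 1 + β 1)) (hc : ¬ c.IsLinear) :
    B.mai d = (c.algebra B : Set (B.dom → Jet0)) ∧ B.AE < c.algebra B ∧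
      (FiniteDimensional ℝ (c.algebra B) ↔ ¬ c.IsLinear) := by
  rw [ExtCase.algebra, hc', opD_eq_opS hf hg]
  exact ⟨mai_eq_of_scale hd hαβ hα, AE_lt_of_opS hd hαβ rfl,
    fun _ => hc, fun _ => finiteDimensional_span (Set.finite_singleton _)⟩

theorem algebra_of_describes (hd : B.Admissible d) {c : ExtCase} (hc : c.Describes B d) :
    B.mai d = (c.algebra B : Set (B.dom → Jet0)) ∧ B.AE < c.algebra B ∧
      (FiniteDimensional ℝ (c.algebra B) ↔ ¬ c.IsLinear) := by
  -- All the nonlinear cases are instances of `d'(αw + β) = d`: an exponential has `(α, β) = (0, 1)`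
  -- and the power `w^n` has `(1/n, 0)`.
  have hE := fun k => @IsExpOn.scale _ (B.isOpen_I k) (d k)
  have hP := fun k => @IsPowOn.scale _ (B.isOpen_I k) (d k)
  cases c with
  | constAny k₁ =>
    exact ⟨mai_eq_of_const_nonconst hd hc.1 hc.2, AE_lt_of_opW (Or.inl rfl),
      iff_of_false (not_finiteDimensional_span Set.subset_union_right) (not_not.2 trivial)⟩
  | anyConst k₂ =>
    exact ⟨mai_eq_of_const_nonconst hd hc.2 hc.1, AE_lt_of_opW (Or.inl rfl),
      iff_of_false (not_finiteDimensional_span Set.subset_union_right) (not_not.2 trivial)⟩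
  | expExp =>
    refine algebra_of_scale (α := ![0, 0]) (β := ![1, 1]) hd rfl ?_ ⟨0, by simp⟩
      (by simp) (by simp) (fun h => h)
    exact Fin.forall_fin_two.2 ⟨fun w hw => hE 0 hc.1 hw, fun w hw => hE 1 hc.2 hw⟩
  | expPow m =>
    refine algebra_of_scale (α := ![0, 1 / m]) (β := ![1, 0]) hd rfl ?_ ⟨0, by simp⟩
      (by simp) (fun p => by simp; ring) (fun h => h)
    exact Fin.forall_fin_two.2 ⟨fun w hw => hE 0 hc.1 hw, fun w hw => hP 1 hc.2 hw⟩
  | powExp n =>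
    refine algebra_of_scale (α := ![1 / n, 0]) (β := ![0, 1]) hd rfl ?_ ⟨1, by simp⟩
      (fun p => by simp; ring) (by simp) (fun h => h)
    exact Fin.forall_fin_two.2 ⟨fun w hw => hP 0 hc.1 hw, fun w hw => hE 1 hc.2 hw⟩
  | powPow n m =>
    refine algebra_of_scale (α := ![1 / n, 1 / m]) (β := ![0, 0]) hd rfl ?_ ?_
      (fun p => by simp; ring) (fun p => by simp; ring) (fun h => h)
    · exact Fin.forall_fin_two.2 ⟨fun w hw => hP 0 hc.1 hw, fun w hw => hP 1 hc.2.1 hw⟩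
    -- `5 + 4/n = 0` means `n = -4/5`; it is excluded for at least one of the two exponents.
    · by_contra! h
      have h0 := hc.1.1
      have h1 := hc.2.1.1
      have e0 := h 0
      have e1 := h 1
      simp only [Matrix.cons_val_zero, Matrix.cons_val_one] at e0 e1
      field_simp at e0 e1
      exact hc.2.2 ⟨by linarith, by linarith⟩
  | conformal =>
    have hαβ : ∀ k, ∀ w ∈ B.I k, deriv (d k) w * (-(5 / 4) * w + 0) = d k w := by
      refine Fin.forall_fin_two.2 ⟨fun w hw => ?_, fun w hw => ?_⟩
      · rw [← hP 0 hc.1 hw]; norm_num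
      · rw [← hP 1 hc.2 hw]; norm_num
    have hg : ExtCase.conformal.gens B.Ω =
        Set.range opK ∪ {opS (fun _ => -(5 / 4)) (fun _ => 0)} :=
      by
      rw [← opD_eq_opS (f := fun p => 2 / (-(4 / 5)) * p.2 0) (g := fun p => 2 / (-(4 / 5)) * p.2 1)
        (fun p => by ring) (fun p => by ring)]; rfl
    rw [ExtCase.algebra, hg]
    exact ⟨mai_eq_of_conformal hd hαβ, AE_lt_of_opS hd hαβ (Or.inr rfl), fun _ h => h,
      fun _ => finiteDimensional_span ((Set.finite_range _).union (Set.finite_singleton _))⟩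
  | constConst k₁ k₂ =>
    exact ⟨mai_eq_of_const_const (κ := ![k₁, k₂]) hd
      (Fin.forall_fin_two.2 ⟨hc.1, hc.2.1⟩) hc.2.2,
      AE_lt_of_opW (k := 0) (Or.inl (Or.inl (Or.inl (Or.inl (Or.inl rfl))))),
      iff_of_false (not_finiteDimensional_span (k := 0) (κ := k₁)
        fun X hX => Or.inl (Or.inl (Or.inl (Or.inr hX)))) (not_not.2 trivial)⟩
  | constSame k₁ =>
    exact ⟨mai_eq_of_const_same hd (Fin.forall_fin_two.2 ⟨hc.1, hc.2⟩),
      AE_lt_of_opW (k := 0) (Or.inl (Or.inl (Or.inl (Or.inl (Or.inl (Or.inl rfl)))))),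
      iff_of_false (not_finiteDimensional_span (k := 0) (κ := k₁)
        fun X hX => Or.inl (Or.inl (Or.inl (Or.inl (Or.inr hX))))) (not_not.2 trivial)⟩

end

/-! ### Nonconstant diffusivities and transport under affine changes of `w`. -/

section

variable {B : Region} {d : Fin 2 → ℝ → ℝ}

/-- When no diffusivity is constant, an extension of `AE(1,3)` forces `d' (α w + β) = d`. -/
theorem mai_eq_AE_or_scale (hd : B.Admissible d) (hnc : ∀ k, ¬ ∃ κ, IsConstOn (d k) (B.I k) κ) :
    B.mai d = (B.AE : Set (B.dom → Jet0)) ∨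
      ∃ α β : Fin 2 → ℝ, ∀ k, ∀ w ∈ B.I k, deriv (d k) w * (α k * w + β k) = d k w := by
  by_cases H : ∃ ξ A b C, DetEqs B d ξ A b C ∧ ∃ z ∈ B.Ω, mu ξ z ≠ 0
  · right
    obtain ⟨ξ, A, b, C, h, z, hz, hμ⟩ := H
    -- The scale equation at the one point `z`, divided by `μ(z) ≠ 0`, holds for all `w` and for
    -- both equations at once.
    refine ⟨fun k => A k z / mu ξ z, fun k => b k z / mu ξ z, fun k w hw => ?_⟩
    have e := h.scale_mu hz hw
    field_simp
    linarith
  · left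
    push Not at H
    refine Set.Subset.antisymm (fun X hX => ?_) (AE_subset_mai hd)
    obtain ⟨ξ, A, b, C, h, hXm⟩ := (mem_mai_iff hd).1 hX
    have hμ := H ξ A b C h
    have hC : C = 0 := h.cross.resolve_right fun ⟨κ, hκ⟩ => hnc 0 ⟨κ, hκ 0⟩
    obtain ⟨p₀, τ, T, r, hr, hform⟩ := h.rigid_form hd (hnc 0) hμ
    obtain ⟨_, _, _, _, _, hform'⟩ := h.rigid_form hd (hnc 1) hμ
    refine mem_AE p₀ τ T r hr fun m => ?_
    obtain ⟨e0, es, -, eA, eb⟩ := hform m.1.1 m.2.1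
    obtain ⟨-, -, -, eA', eb'⟩ := hform' m.1.1 m.2.1
    rw [hXm]
    ext i
    · refine Fin.cases ?_ (fun a => ?_) i
      · simp [coeffs, dataOp, e0]
      · simp [coeffs, dataOp, es]
    · fin_cases i <;> simp [coeffs, dataOp, lin, hC, eA, eb, eA', eb']

/-- Change of the data of an operator under `w_k ↦ (w_k - q_k) / p_k`. -/
lemma DetEqs.rescale {B' : Region} {d' : Fin 2 → ℝ → ℝ} {ξ : Fin 4 → Indep → ℝ}
    {A b : Fin 2 → Indep → ℝ} (hd : B.Admissible d) {p q s : Fin 2 → ℝ} (hs : ∀ k, s k * p k = 1)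
    (hΩ : B'.Ω = B.Ω) (hI : ∀ k, ∀ w ∈ B'.I k, p k * w + q k ∈ B.I k)
    (hdd : ∀ k, ∀ w ∈ B'.I k, d' k w = d k (p k * w + q k)) (h : DetEqs B d ξ A b 0) :
    DetEqs B' d' ξ A (fun k z => s k * b k z + s k * q k * A k z) 0 := by
  have hder : ∀ k, ∀ w ∈ B'.I k, deriv (d' k) w = p k * deriv (d k) (p k * w + q k) := by
    intro k w hw
    have e : d' k =ᶠ[nhds w] fun y => d k (p k * y + q k) := by
      filter_upwards [(B'.isOpen_I k).mem_nhds hw] with y hy using hdd k y hy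
    have h1 : HasDerivAt (fun y => p k * y + q k) (p k) w := by
      simpa using ((hasDerivAt_id w).const_mul (p k)).add_const (q k)
    rw [e.deriv_eq, mul_comm]
    exact ((hd.differentiableAt (hI k w hw)).hasDerivAt.comp w h1).deriv
  have hb : ∀ k i, ∀ z ∈ B.Ω, pd i (fun z => s k * b k z + s k * q k * A k z) z =
      s k * pd i (b k) z + s k * q k * pd i (A k) z := fun k i z hz =>
    pd_linear (h.smooth_b k) (h.smooth_A k) (fun y _ => rfl) hz i
  have hbb : ∀ k i j, ∀ z ∈ B.Ω, pd i (pd j (fun z => s k * b k z + s k * q k * A k z)) z =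
      s k * pd i (pd j (b k)) z + s k * q k * pd i (pd j (A k)) z := fun k i j z hz =>
    pd_linear (contDiffOn_pd B.isOpen_Ω (h.smooth_b k) j)
      (contDiffOn_pd B.isOpen_Ω (h.smooth_A k) j) (fun y hy => hb k j y hy) hz i
  constructor
  · rw [hΩ]; exact h.smooth_xi
  · rw [hΩ]; exact h.smooth_A
  · rw [hΩ]
    exact fun k => (contDiffOn_const.mul (h.smooth_b k)).add (contDiffOn_const.mul (h.smooth_A k))
  · exact Or.inl rfl
  · rw [hΩ]; exact h.time
  · rw [hΩ]; exact h.skew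
  · rw [hΩ]
    intro z hz k w hw a
    rw [hder k w hw, hdd k w hw, ← h.scale z hz k _ (hI k w hw) a]
    linear_combination (deriv (d k) (p k * w + q k) * (b k z + q k * A k z)) * hs k
  · rw [hΩ]
    intro z hz k w hw a
    rw [hder k w hw, hdd k w hw, ← h.drift z hz k _ (hI k w hw) a, hb k _ z hz]
    linear_combination (-2 * deriv (d k) (p k * w + q k) *
      (pd a.succ (b k) z + q k * pd a.succ (A k) z)) * hs k
  · rw [hΩ]
    intro z hz k w hw
    have e := h.heat z hz k _ (hI k w hw)
    simp only [Fin.sum_univ_three] at e ⊢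
    rw [hdd k w hw, hb k _ z hz, hbb k _ _ z hz, hbb k _ _ z hz, hbb k _ _ z hz]
    linear_combination s k * e - w * (pd 0 (A k) z - d k (p k * w + q k) *
      (pd (Fin.succ 0) (pd (Fin.succ 0) (A k)) z + pd (Fin.succ 1) (pd (Fin.succ 1) (A k)) z
        + pd (Fin.succ 2) (pd (Fin.succ 2) (A k)) z)) * hs k

/-- The transformation `w_k ↦ δ_k w_k + γ_k`. -/
def affineEquiv (δ γ : Fin 2 → ℝ) (hδ : ∀ k, δ k ≠ 0) : Equivalence where
  α := 1
  β := 1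
  R := 1
  δ := δ
  shiftT := 0
  shiftX := 0
  shiftW := γ
  hα := one_ne_zero
  hβ := one_ne_zero
  hR := one_mem _
  hδ := hδ

lemma affineEquiv_lin (δ γ : Fin 2 → ℝ) (hδ : ∀ k, δ k ≠ 0) (m : Jet0) :
    (affineEquiv δ γ hδ).lin m = (m.1, fun k => δ k * m.2 k) := by
  refine Prod.ext (funext fun i => ?_) rfl
  refine Fin.cases ?_ (fun a => ?_) i <;>
    simp [affineEquiv, Equivalence.lin, coeffs, tm, sp]

lemma affineEquiv_map (δ γ : Fin 2 → ℝ) (hδ : ∀ k, δ k ≠ 0) (m : Jet0) :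
    (affineEquiv δ γ hδ).map m = (m.1, fun k => δ k * m.2 k + γ k) := by
  rw [Equivalence.map, affineEquiv_lin]
  refine Prod.ext (funext fun i => ?_) rfl
  refine Fin.cases ?_ (fun a => ?_) i <;> simp [affineEquiv, coeffs]

/-- The image of a region under `w_k ↦ δ_k w_k + γ_k`. -/
def Region.affine (B : Region) (δ γ : Fin 2 → ℝ) (hδ : ∀ k, δ k ≠ 0) : Region where
  Ω := B.Ω
  I k := (fun w => δ k * w + γ k) '' B.I k
  isOpen_Ω := B.isOpen_Ω
  isConnected_Ω := B.isConnected_Ω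
  isOpen_I k := (affineHomeomorph (δ k) (γ k) (hδ k)).isOpenMap _ (B.isOpen_I k)
  isConnected_I k := (B.isConnected_I k).image _ (by fun_prop)

section affine

variable {δ γ : Fin 2 → ℝ} {hδ : ∀ k, δ k ≠ 0} {d' : Fin 2 → ℝ → ℝ}

lemma Region.affine_mem {k : Fin 2} {w : ℝ} (hw : w ∈ (B.affine δ γ hδ).I k) :
    (δ k)⁻¹ * w + -((δ k)⁻¹ * γ k) ∈ B.I k := by
  obtain ⟨v, hv, rfl⟩ := hw
  have := hδ k
  convert hv using 1
  field_simp
  ring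

lemma affine_comp_eq (hdd : ∀ k, ∀ w ∈ B.I k, d' k (δ k * w + γ k) = d k w) (k : Fin 2) (w : ℝ)
    (hw : w ∈ (B.affine δ γ hδ).I k) : d' k w = d k ((δ k)⁻¹ * w + -((δ k)⁻¹ * γ k)) := by
  rw [← hdd k _ (Region.affine_mem hw)]
  have := hδ k
  congr 1
  field_simp
  ring

lemma Region.Admissible.affine (hd : B.Admissible d)
    (hdd : ∀ k, ∀ w ∈ B.I k, d' k (δ k * w + γ k) = d k w) :
    (B.affine δ γ hδ).Admissible d' := by
  refine fun k => ⟨?_, fun w hw => ?_⟩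
  · refine ContDiffOn.congr (f := fun w => d k ((δ k)⁻¹ * w + -((δ k)⁻¹ * γ k))) ?_
      fun w hw => affine_comp_eq hdd k w hw
    exact (hd k).1.comp (by fun_prop) fun w hw => Region.affine_mem hw
  · rw [affine_comp_eq hdd k w hw]
    exact (hd k).2 _ (Region.affine_mem hw)

lemma affineEquiv_maps (hdd : ∀ k, ∀ w ∈ B.I k, d' k (δ k * w + γ k) = d k w) :
    (affineEquiv δ γ hδ).Maps B d (B.affine δ γ hδ) d' := by
  refine ⟨Set.Subset.antisymm ?_ fun m hm => ?_, fun k w hw => ?_⟩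
  · rintro _ ⟨m, hm, rfl⟩
    rw [affineEquiv_map]
    exact ⟨hm.1, fun k => ⟨_, hm.2 k, rfl⟩⟩
  · choose v hv hvm using hm.2
    refine ⟨(m.1, v), ⟨hm.1, hv⟩, ?_⟩
    rw [affineEquiv_map]
    exact Prod.ext rfl (funext hvm)
  · simpa [affineEquiv] using hdd k w hw

/-- `DetEqs.rescale` is applied to the change of variables and to its inverse. A nonconstant
diffusivity guarantees `C = 0`, which `rescale` requires. -/
theorem mai_eq_pullback (hd : B.Admissible d) (hnc : ¬ ∃ κ, IsConstOn (d 0) (B.I 0) κ)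
    (hdd : ∀ k, ∀ w ∈ B.I k, d' k (δ k * w + γ k) = d k w) :
    B.mai d = (affineEquiv δ γ hδ).pullback B (B.affine δ γ hδ) ((B.affine δ γ hδ).mai d') := by
  have hd' : (B.affine δ γ hδ).Admissible d' := hd.affine hdd
  have hinv : ∀ k, δ k * (δ k)⁻¹ = 1 := fun k => mul_inv_cancel₀ (hδ k)
  have hmem : ∀ k, ∀ w ∈ B.I k, δ k * w + γ k ∈ (B.affine δ γ hδ).I k := fun k w hw =>
    ⟨w, hw, rfl⟩
  ext X
  constructor
  · intro hX
    obtain ⟨ξ, A, b, C, h, hXm⟩ := (mem_mai_iff hd).1 hX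
    obtain rfl : C = 0 := h.cross.resolve_right fun ⟨κ, hκ⟩ => hnc ⟨κ, hκ 0⟩
    have h' := h.rescale (B' := B.affine δ γ hδ) hd hinv rfl
      (fun k w hw => Region.affine_mem hw) (fun k w hw => affine_comp_eq hdd k w hw)
    refine ⟨_, (mem_mai_iff hd').2 ⟨_, _, _, _, h', fun _ => rfl⟩, fun m m' hm => ?_⟩
    rw [hm, hXm, affineEquiv_map, affineEquiv_lin]
    refine Prod.ext rfl (funext fun k => ?_)
    have := hδ k
    simp [dataOp, NHE.lin]
    field_simp
    ring
  · rintro ⟨Y, hY, hYX⟩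
    obtain ⟨ξ, A, b, C, h, hYm⟩ := (mem_mai_iff hd').1 hY
    obtain rfl : C = 0 := h.cross.resolve_right fun ⟨κ, hκ⟩ => hnc ⟨κ, fun w hw => by
      rw [← hdd 0 w hw, hκ 0 _ (hmem 0 w hw)]⟩
    have h' := h.rescale (B' := B) (d' := d) hd' (s := fun k => (δ k)⁻¹)
      (fun k => inv_mul_cancel₀ (hδ k)) rfl hmem (fun k w hw => (hdd k w hw).symm)
    refine (mem_mai_iff hd).2 ⟨_, _, _, _, h', fun m => ?_⟩
    have e := hYX m ⟨(m.1.1, fun k => δ k * m.1.2 k + γ k), m.2.1,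
      fun k => hmem k _ (m.2.2 k)⟩ (affineEquiv_map δ γ hδ m).symm
    rw [hYm, affineEquiv_lin] at e
    refine Prod.ext (congrArg Prod.fst e).symm (funext fun k => ?_)
    have e2 := congrFun (congrArg Prod.snd e) k
    have := hδ k
    simp [dataOp, NHE.lin] at e2 ⊢
    field_simp
    linarith

end affine

lemma pullback_id (A : Set (B.dom → Jet0)) :
    (affineEquiv 1 0 fun _ => one_ne_zero).pullback B B A = A := by
  have hmap : ∀ m, (affineEquiv 1 0 fun _ => one_ne_zero).map m = m := fun m => by
    rw [affineEquiv_map]; simp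
  have hlin : ∀ m, (affineEquiv 1 0 fun _ => one_ne_zero).lin m = m := fun m => by
    rw [affineEquiv_lin]; simp
  ext X
  constructor
  · rintro ⟨Y, hY, h⟩
    convert hY
    funext m
    rw [h m m (hmap m).symm, hlin]
  · refine fun hX => ⟨X, hX, fun m m' h => ?_⟩
    rw [hmap] at h
    rw [hlin, Subtype.ext h]

lemma maps_id : (affineEquiv 1 0 fun _ => one_ne_zero).Maps B d B d := by
  refine ⟨?_, fun k w _ => by simp [affineEquiv]⟩
  have : ∀ m, (affineEquiv 1 0 fun _ => one_ne_zero).map m = m := fun m => by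
    rw [affineEquiv_map]; simp
  simp [this]

end

/-! ### Normal forms and completeness of the list. -/

/-- The positive solutions of `d' (α w + β) = d`, up to affine changes of `w`. -/
lemma exists_normal_form {I : Set ℝ} (hI : IsOpen I) (hc : IsConnected I) {d : ℝ → ℝ}
    (hd : ∀ w ∈ I, DifferentiableAt ℝ d w) (hpos : ∀ w ∈ I, 0 < d w) {α β : ℝ}
    (h : ∀ w ∈ I, deriv d w * (α * w + β) = d w) :
    ∃ δ γ : ℝ, δ ≠ 0 ∧ ((α = 0 ∧ ∀ w ∈ I, Real.exp (δ * w + γ) = d w) ∨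
      (α ≠ 0 ∧ ∀ w ∈ I, 0 < δ * w + γ ∧ (δ * w + γ) ^ (1 / α) = d w)) := by
  obtain ⟨w₀, hw₀⟩ := hc.nonempty
  have hne : ∀ w ∈ I, α * w + β ≠ 0 := fun w hw h0 => by
    have := h w hw
    rw [h0, mul_zero] at this
    exact (hpos w hw).ne this
  -- The equation says `(log d)' = 1/(αw + β)`, so `log d` is known up to an additive constant `c`.
  have hlog : ∀ w ∈ I, HasDerivAt (fun w => Real.log (d w)) (1 / (α * w + β)) w := by
    intro w hw
    have e := (hd w hw).hasDerivAt.log (hpos w hw).ne'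
    convert e using 1
    have h1 := hne w hw
    have h2 := (hpos w hw).ne'
    rw [div_eq_div_iff h1 h2]
    linarith [h w hw]
  have hconst : ∀ g : ℝ → ℝ, (∀ w ∈ I, HasDerivAt g (1 / (α * w + β)) w) →
      ∃ c, ∀ w ∈ I, d w = Real.exp (g w + c) := by
    intro g hg
    refine ⟨Real.log (d w₀) - g w₀, fun w hw => ?_⟩
    have := hI.is_const_of_deriv_eq_zero hc.isPreconnected (f := fun w => Real.log (d w) - g w)
      (fun w hw => ((hlog w hw).sub (hg w hw)).differentiableAt.differentiableWithinAt)
      (fun w hw => ((hlog w hw).sub (hg w hw)).deriv.trans (sub_self _)) hw hw₀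
    rw [← this, add_sub_cancel, Real.exp_log (hpos w hw)]
  rcases eq_or_ne α 0 with rfl | hα
  · have hβ : β ≠ 0 := by simpa using hne w₀ hw₀
    obtain ⟨c, hc⟩ := hconst (fun w => 1 / β * w) fun w _ => by
      simpa using (hasDerivAt_id w).const_mul (1 / β)
    exact ⟨1 / β, c, by simpa using hβ, Or.inl ⟨rfl, fun w hw => (hc w hw).symm⟩⟩
  · obtain ⟨c, hc'⟩ := hconst (fun w => 1 / α * Real.log (α * w + β)) fun w hw => by
      have e : HasDerivAt (fun w => α * w + β) α w := by
        simpa using ((hasDerivAt_id w).const_mul α).add_const β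
      have e' := (e.log (hne w hw)).const_mul (1 / α)
      rwa [show 1 / α * (α / (α * w + β)) = 1 / (α * w + β) by field_simp] at e'
    -- The affine function has no zero on the connected `I`, so it keeps its sign `s`; a reflection
    -- of `w` makes it positive.
    obtain ⟨s, hs, habs⟩ : ∃ s : ℝ, s ≠ 0 ∧ ∀ w ∈ I, s * (α * w + β) = |α * w + β| := by
      have hcont : ContinuousOn (fun w => α * w + β) I := by fun_prop
      rcases lt_or_gt_of_ne (hne w₀ hw₀) with h0 | h0
      · refine ⟨-1, by norm_num, fun w hw => ?_⟩
        rw [abs_of_neg, neg_one_mul]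
        by_contra! h1
        obtain ⟨y, hy, hy0⟩ := hc.isPreconnected.intermediate_value hw₀ hw hcont ⟨h0.le, h1⟩
        exact hne y hy hy0
      · refine ⟨1, one_ne_zero, fun w hw => ?_⟩
        rw [abs_of_pos, one_mul]
        by_contra! h1
        obtain ⟨y, hy, hy0⟩ := hc.isPreconnected.intermediate_value hw hw₀ hcont ⟨h1, h0.le⟩
        exact hne y hy hy0
    -- From `log d = (1/α) log|αw + β| + c` one gets `d = (e^{αc} |αw + β|)^{1/α}`; the
    -- multiplicative constant is absorbed into the new variable.
    refine ⟨Real.exp (α * c) * s * α, Real.exp (α * c) * s * β, by simp [hs, hα],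
      Or.inr ⟨hα, fun w hw => ?_⟩⟩
    have e : Real.exp (α * c) * s * α * w + Real.exp (α * c) * s * β =
        Real.exp (α * c) * |α * w + β| := by rw [← habs w hw]; ring
    have hp : 0 < |α * w + β| := abs_pos.2 (hne w hw)
    rw [e]
    refine ⟨by positivity, ?_⟩
    rw [Real.rpow_def_of_pos (by positivity), Real.log_mul (by positivity) hp.ne', Real.log_exp,
      Real.log_abs, hc' w hw]
    congr 1
    field_simp
    ring

section

variable {B : Region} {d : Fin 2 → ℝ → ℝ}

/-- Each diffusivity is normalised separately, so affine changes of `u` and `v` alone are enough,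
with `t`, `x` and the values of `d_k` untouched. -/
lemma exists_describes_of_scale (hd : B.Admissible d) {α β : Fin 2 → ℝ}
    (hαβ : ∀ k, ∀ w ∈ B.I k, deriv (d k) w * (α k * w + β k) = d k w) :
    ∃ (δ γ : Fin 2 → ℝ) (hδ : ∀ k, δ k ≠ 0) (d' : Fin 2 → ℝ → ℝ) (c : ExtCase),
      (∀ k, ∀ w ∈ B.I k, d' k (δ k * w + γ k) = d k w) ∧ c.Describes (B.affine δ γ hδ) d' := by
  choose δ γ hδ hform using fun k => exists_normal_form (B.isOpen_I k) (B.isConnected_I k)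
    (fun w hw => hd.differentiableAt hw) (hd k).2 (hαβ k)
  refine ⟨δ, γ, hδ, fun k => if α k = 0 then Real.exp else (· ^ (1 / α k)), ?_⟩
  have hdd : ∀ k, ∀ w ∈ B.I k,
      (if α k = 0 then Real.exp else (· ^ (1 / α k)) : ℝ → ℝ) (δ k * w + γ k) = d k w := by
    intro k w hw
    rcases hform k with ⟨h0, h⟩ | ⟨h0, h⟩
    · simpa only [h0, if_true] using h w hw
    · simpa only [h0, if_false] using (h w hw).2
  have hE : ∀ k, α k = 0 → IsExpOn (if α k = 0 then Real.exp else (· ^ (1 / α k)))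
      ((B.affine δ γ hδ).I k) := fun k h0 w _ => by rw [if_pos h0]
  have hP : ∀ k, α k ≠ 0 → IsPowOn (if α k = 0 then Real.exp else (· ^ (1 / α k)))
      ((B.affine δ γ hδ).I k) (1 / α k) := fun k h0 => by
    refine ⟨one_div_ne_zero h0, ?_⟩
    rintro _ ⟨w, hw, rfl⟩
    rw [if_neg h0]
    exact ⟨(((hform k).resolve_left fun h => h0 h.1).2 w hw).1, rfl⟩
  by_cases h0 : α 0 = 0 <;> by_cases h1 : α 1 = 0
  · exact ⟨.expExp, hdd, hE 0 h0, hE 1 h1⟩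
  · exact ⟨.expPow _, hdd, hE 0 h0, hP 1 h1⟩
  · exact ⟨.powExp _, hdd, hP 0 h0, hE 1 h1⟩
  · by_cases hc : 1 / α 0 = -(4 / 5) ∧ 1 / α 1 = -(4 / 5)
    · refine ⟨.conformal, hdd, ?_, ?_⟩
      · rw [← hc.1]; exact hP 0 h0
      · rw [← hc.2]; exact hP 1 h1
    · exact ⟨.powPow _ _, hdd, hP 0 h0, hP 1 h1, hc⟩

lemma exists_describes_of_const {k : Fin 2} {κ : ℝ} (hκ : IsConstOn (d k) (B.I k) κ) :
    ∃ c : ExtCase, c.Describes B d := by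
  by_cases h0 : ∃ κ, IsConstOn (d 0) (B.I 0) κ <;> by_cases h1 : ∃ κ, IsConstOn (d 1) (B.I 1) κ
  · obtain ⟨κ₀, h0⟩ := h0
    obtain ⟨κ₁, h1⟩ := h1
    rcases eq_or_ne κ₀ κ₁ with rfl | hne
    · exact ⟨.constSame κ₀, h0, h1⟩
    · exact ⟨.constConst κ₀ κ₁, h0, h1, hne⟩
  · obtain ⟨κ₀, h0⟩ := h0
    exact ⟨.constAny κ₀, h0, h1⟩
  · obtain ⟨κ₁, h1⟩ := h1
    exact ⟨.anyConst κ₁, h0, h1⟩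
  · fin_cases k
    exacts [absurd ⟨κ, hκ⟩ h0, absurd ⟨κ, hκ⟩ h1]

theorem classification (hd : B.Admissible d) :
    B.mai d = (B.AE : Set (B.dom → Jet0)) ∨
      ∃ (e : Equivalence) (B' : Region) (d' : Fin 2 → ℝ → ℝ) (c : ExtCase),
        B'.Admissible d' ∧ e.Maps B d B' d' ∧ c.Describes B' d' ∧
        B.mai d = e.pullback B B' (c.algebra B' : Set (B'.dom → Jet0)) := by
  by_cases hnc : ∀ k, ¬ ∃ κ, IsConstOn (d k) (B.I k) κ
  · refine (mai_eq_AE_or_scale hd hnc).imp_right ?_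
    rintro ⟨α, β, hαβ⟩
    obtain ⟨δ, γ, hδ, d', c, hdd, hc⟩ := exists_describes_of_scale hd hαβ
    refine ⟨affineEquiv δ γ hδ, B.affine δ γ hδ, d', c, hd.affine hdd, affineEquiv_maps hdd, hc, ?_⟩
    rw [← (algebra_of_describes (hd.affine hdd) hc).1]
    exact mai_eq_pullback hd (hnc 0) hdd
  · push Not at hnc
    obtain ⟨k, κ, hκ⟩ := hnc
    obtain ⟨c, hc⟩ := exists_describes_of_const hκ
    -- A system with a constant diffusivity is already in the list, so the identity transformation
    -- serves.
    refine Or.inr ⟨affineEquiv 1 0 fun _ => one_ne_zero, B, d, c, hd, maps_id, hc, ?_⟩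
    rw [pullback_id, (algebra_of_describes hd hc).1]

/-! ### The operators admitted by all diffusivities. -/

lemma not_scale_exp_sq {I : Set ℝ} (hI : IsOpen I) (hne : I.Nonempty) {α β : ℝ}
    (h : ∀ w ∈ I, 2 * w * (α * w + β) = 1) : False := by
  have hα : α = 0 := by
    obtain ⟨w, hw⟩ := hne
    obtain ⟨ε, hε, hb⟩ := Metric.isOpen_iff.1 hI w hw
    have h1 := h w hw
    have h2 := h (w + ε / 2) (hb (by simp [abs_of_pos hε]; linarith))
    have h3 := h (w - ε / 2) (hb (by simp [abs_of_pos hε]; linarith))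
    -- The second difference with step `ε / 2` of the quadratic `2w(αw + β)`, which is constant on
    -- `I`.
    have : α * ε ^ 2 = 0 := by linear_combination h2 + h3 - 2 * h1
    exact (mul_eq_zero.1 this).resolve_right (by positivity)
  subst hα
  have := (affine_eq_zero hI hne (x := 2 * β) (y := -1)
    fun w hw => by linear_combination h w hw).2
  norm_num at this

theorem iInter_mai (B : Region) :
    (⋂ d ∈ {d : Fin 2 → ℝ → ℝ | B.Admissible d}, B.mai d) = (B.AE : Set (B.dom → Jet0)) := by
  refine Set.Subset.antisymm ?_ (Set.subset_iInter₂ fun d hd => AE_subset_mai hd)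
  -- A single system suffices: `exp(w²)` is admissible on every region, nonconstant on every open
  -- interval, and has `d'/d = 2w`, which is not the reciprocal of an affine function.
  have hd : B.Admissible fun _ w => Real.exp (w ^ 2) := fun k =>
    ⟨by fun_prop, fun w _ => Real.exp_pos _⟩
  have hder : ∀ w : ℝ, deriv (fun w => Real.exp (w ^ 2)) w = Real.exp (w ^ 2) * (2 * w) := by
    intro w
    simp
  have hnc : ∀ k : Fin 2, ¬ ∃ κ, IsConstOn (fun w => Real.exp (w ^ 2)) (B.I k) κ := by
    rintro k ⟨κ, hκ⟩
    have h := affine_eq_zero (B.isOpen_I k) (B.nonempty_I k) (x := 2) (y := 0) fun w hw => by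
      have e := deriv_eq_zero_of_isConstOn (B.isOpen_I k) hκ hw
      rw [hder] at e
      simpa using e
    exact two_ne_zero h.1
  rcases mai_eq_AE_or_scale hd hnc with h | ⟨α, β, h⟩
  · rw [← h]
    exact Set.biInter_subset_of_mem hd
  · refine (not_scale_exp_sq (B.isOpen_I 0) (B.nonempty_I 0) (α := α 0) (β := β 0)
      fun w hw => ?_).elim
    have e := h 0 w hw
    rw [hder] at e
    have := Real.exp_ne_zero (w ^ 2)
    apply mul_left_cancel₀ this
    linarith

end

end NHE

end

theorem theorem1 :
    -- case of arbitrary diffusivities: the operators admitted by all systems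
    (∀ B : NHE.Region,
      (⋂ d ∈ {d : Fin 2 → ℝ → ℝ | B.Admissible d}, B.mai d) = (B.AE : Set (B.dom → NHE.Jet0))) ∧
    -- the cases with an extension of `AE(1,3)`
    (∀ (c : NHE.ExtCase) (B : NHE.Region) (d : Fin 2 → ℝ → ℝ),
      B.Admissible d → c.Describes B d →
        B.mai d = (c.algebra B : Set (B.dom → NHE.Jet0)) ∧
        B.AE < c.algebra B ∧
        (FiniteDimensional ℝ (c.algebra B) ↔ ¬ c.IsLinear)) ∧
    -- completeness of the list, up to equivalence
    (∀ (B : NHE.Region) (d : Fin 2 → ℝ → ℝ), B.Admissible d →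
      B.mai d = (B.AE : Set (B.dom → NHE.Jet0)) ∨
      ∃ (e : NHE.Equivalence) (B' : NHE.Region) (d' : Fin 2 → ℝ → ℝ) (c : NHE.ExtCase),
        B'.Admissible d' ∧ e.Maps B d B' d' ∧ c.Describes B' d' ∧
        B.mai d = e.pullback B B' (c.algebra B' : Set (B'.dom → NHE.Jet0))) := by
  exact ⟨NHE.iInter_mai, fun _ _ _ hd hc => NHE.algebra_of_describes hd hc,
    fun _ _ hd => NHE.classification hd⟩
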